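/- Let $d\ge 2$ be even, $m>0$, and let $x\cdot y=x^0y^0-\sum_{j\ge1}x^jy^j$ on $\mathbb R^d$. Let $W_0=\{x: x^1>|x^0|\}$ be the right wedge, $W_0'=-W_0$, and $\overline{V_+}$ the closed forward light cone. A *deformation function* is a smooth $R:\mathbb R\to\mathbb C$ with $R(a)^{-1}=\overline{R(a)}=R(-a)$, $R(0)=1$, all derivatives polynomially bounded, and (tempered) Fourier transform supported in $[0,\infty)$ (that is, $R(a)=(2\pi)^{-1/2}\int\tilde R(\lambda)e^{i\lambda a}d\lambda$ with $\operatorname{supp}\tilde R\subset[0,\infty)$). An *admissible matrix* is a real $d\times d$ matrix $Q$ that is antisymmetric with respect to the Minkowski product, satisfies $\Lambda Q\Lambda^{-1}=Q$ (respectively $=-Q$) for all proper orthochronous (respectively proper antichronous) Lorentz transformations $\Lambda$ with $\Lambda W_0=W_0$, and satisfies $Q\overline{V_+}\subset\overline{W_0}$. Let $\underline{\mathscr S}=\bigoplus_{n\ge0}\mathscr S_n$, $\mathscr S_n=\mathscr S(\mathbb R^{nd})$, be the Borchers–Uhlmann algebra with the tensor product, $\tilde f_n(p_1,\dots,p_n)=(2\pi)^{-nd/2}\int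 f_n(x)\,e^{i\sum_k p_k\cdot x_k}dx$, and let $\rho=\rho(R,Q):\underline{\mathscr S}\to\underline{\mathscr S}$ be the map that multiplies $\tilde f_n$ by $\prod_{1\le l<r\le n}R(-p_l\cdot Qp_r)$. The deformed product is $f\otimes_\rho g=\rho^{-1}(\rho(f)\otimes\rho(g))$. Let $\mathcal H$ be the Bose Fock space over $L^2(\mathbb R^d,d\mu)$, $d\mu(p)=\varepsilon_{\mathbf p}^{-1}\delta(p^0-\varepsilon_{\mathbf p})dp$, $\varepsilon_{\mathbf p}=(\mathbf p^2+m^2)^{1/2}$, with vacuum $\Omega$, let $\phi$ be the free scalar field of mass $m$ on $\mathcal H$, that is $\phi(f_1)=a^\dagger(f_1^+)+a(\overline{f_1^-})$ with $f_1^\pm(p)=\tilde f_1(\pm p)$ on the mass shell, extended to $\underline{\mathscr S}$, and put $\Psi(g)=\phi(g)\Omega$, $\mathcal D=\{\Psi(g): g\in\underline{\mathscr S}\}$. The deformed field $\phi_{R,Q}(f)$, $f\in\underline{\mathscr S}$, is the operator with domain $\mathcal D$ given by $\phi_{R,Q}(f)\Psi(g)=\Psi(f\otimes_{\rho(R,Q)}g)$.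 **Proposition.** Let $R$ be a deformation function and $Q$ an admissible matrix. (i) For every real $f_1\in\mathscr S_1$, the operator $\phi_{R,Q}(f_1)$ is well defined on $\mathcal D$, every $\Psi\in\mathcal D$ is an entire analytic vector for it (that is, $\Psi$ lies in the domain of all its powers and $\sum_n \frac{t^n}{n!}\|\phi_{R,Q}(f_1)^n\Psi\|<\infty$ for all $t>0$), and $\phi_{R,Q}(f_1)$ is essentially self-adjoint. (ii) Let $f_1,g_1\in\mathscr S_1$ be real with $\operatorname{supp}f_1\subset W_0$ and $\operatorname{supp}g_1\subset W_0'$. Then the closures $\overline{\phi_{R,Q}(f_1)}$ and $\overline{\phi_{R,-Q}(g_1)}$ generate strongly continuous one-parameter unitary groups, and these commute: $$\left[e^{it\overline{\phi_{R,Q}(f_1)}},\,e^{is\overline{\phi_{R,-Q}(g_1)}}\right]=0,\qquad t,s\in\mathbb R .$$ -/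

import Mathlib

open MeasureTheory SchwartzMap Filter Topology
open scoped FourierTransform ComplexConjugate

namespace DeformedQFT
noncomputable section
/-- Minkowski space of dimension `d = s + 2`, with coordinates `x⁰, x¹, …, x^{s+1}`. -/
abbrev Vec (s : ℕ) : Type := Fin (s + 2) → ℝ
/-- The Minkowski product `x · y = x⁰ y⁰ - x¹ y¹ - ⋯ - x^{d-1} y^{d-1}`. -/
def mink {s : ℕ} (x y : Vec s) : ℝ := x 0 * y 0 - ∑ j : Fin (s + 1), x j.succ * y j.succ
/-- The right wedge `W₀ = {x | x¹ > |x⁰|}`. -/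
def rightWedge (s : ℕ) : Set (Vec s) := {x | |x 0| < x 1}
/-- The causal complement `W₀' = -W₀` of the right wedge. -/
def leftWedge (s : ℕ) : Set (Vec s) := {x | -x ∈ rightWedge s}
/-- The closed forward light cone. -/
def closedForwardCone (s : ℕ) : Set (Vec s) := {p | 0 ≤ mink p p ∧ 0 ≤ p 0}

/-- Proper Lorentz transformations, not necessarily orthochronous (`Λ` is orthochronous iff
`0 < Λ⁰₀` and antichronous iff `Λ⁰₀ < 0`). -/
structure IsProperLorentz {s : ℕ} (Λ : Matrix (Fin (s + 2)) (Fin (s + 2)) ℝ) : Prop where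
  isometry : ∀ x y : Vec s, mink (Λ.mulVec x) (Λ.mulVec y) = mink x y
  det_eq : Λ.det = 1

/-- Admissible matrices: antisymmetric with respect to the Minkowski product, invariant (up to the
sign, for time reversing transformations) under the Lorentz transformations that preserve the right
wedge, and mapping the closed forward cone into the closed right wedge. -/
structure IsAdmissible {s : ℕ} (Q : Matrix (Fin (s + 2)) (Fin (s + 2)) ℝ) : Prop where
  antisymm : ∀ x y : Vec s, mink x (Q.mulVec y) = -mink (Q.mulVec x) y
  covariant_of_orthochronous : ∀ Λ : Matrix (Fin (s + 2)) (Fin (s + 2)) ℝ,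
    IsProperLorentz Λ → 0 < Λ 0 0 → Λ.mulVec '' rightWedge s = rightWedge s → Λ * Q * Λ⁻¹ = Q
  covariant_of_antichronous : ∀ Λ : Matrix (Fin (s + 2)) (Fin (s + 2)) ℝ,
    IsProperLorentz Λ → Λ 0 0 < 0 → Λ.mulVec '' rightWedge s = rightWedge s → Λ * Q * Λ⁻¹ = -Q
  maps_cone : Set.MapsTo Q.mulVec (closedForwardCone s) (closure (rightWedge s))

/-- Deformation functions: smooth functions of modulus one with `conj (R a) = R (-a)`, `R 0 = 1`,
polynomially bounded derivatives, and Fourier transform (as a tempered distribution) supported on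
the positive half line. -/
structure IsDeformationFunction (R : ℝ → ℂ) : Prop where
  conj_mul_self : ∀ a, conj (R a) * R a = 1
  conj_eq : ∀ a, conj (R a) = R (-a)
  map_zero : R 0 = 1
  hasTemperateGrowth : R.HasTemperateGrowth
  fourier_support :
    Distribution.dsupport (𝓕 hasTemperateGrowth.toTemperedDistribution : 𝓢'(ℝ, ℂ)) ⊆ Set.Ici (0 : ℝ)

/-- The Schwartz space `𝒮_n = 𝒮(ℝ^{nd})`; in particular `𝒮_0 = ℂ`. -/
abbrev TestFn (s n : ℕ) : Type := 𝓢(Fin n → Vec s, ℂ)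

/-- The Schwartz function `x ↦ f (a x) * g (b x)`. -/
def schwartzProd {D E F : Type*} [NormedAddCommGroup D] [NormedSpace ℝ D] [NormedAddCommGroup E]
    [NormedSpace ℝ E] [NormedAddCommGroup F] [NormedSpace ℝ F] (a : D →L[ℝ] E) (b : D →L[ℝ] F)
    (hab : ∀ x, ‖x‖ ≤ max ‖a x‖ ‖b x‖) (f : 𝓢(E, ℂ)) (g : 𝓢(F, ℂ)) : 𝓢(D, ℂ) where
  toFun x := f (a x) * g (b x)
  smooth' := ((f.smooth ⊤).comp a.contDiff).mul ((g.smooth ⊤).comp b.contDiff)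
  decay' := by
    intro k n
    have hcast : ∀ j : ℕ, (j : WithTop ℕ∞) ≤ ((⊤ : ℕ∞) : WithTop ℕ∞) :=
      fun j => by exact_mod_cast le_top
    have hf : ∀ i, ∃ C, 0 ≤ C ∧ ∀ y, (1 + ‖y‖) ^ k * ‖iteratedFDeriv ℝ i f y‖ ≤ C := fun i =>
      ⟨_, by positivity, fun y => one_add_le_sup_seminorm_apply (𝕜 := ℝ) (m := (k, i)) le_rfl le_rfl f y⟩
    have hg : ∀ i, ∃ C, 0 ≤ C ∧ ∀ y, (1 + ‖y‖) ^ k * ‖iteratedFDeriv ℝ i g y‖ ≤ C := fun i =>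
      ⟨_, by positivity, fun y => one_add_le_sup_seminorm_apply (𝕜 := ℝ) (m := (k, i)) le_rfl le_rfl g y⟩
    choose A hA0 hA using hf
    choose B hB0 hB using hg
    refine ⟨∑ i ∈ Finset.range (n + 1),
      (n.choose i : ℝ) * (A i * ‖a‖ ^ i) * (B (n - i) * ‖b‖ ^ (n - i)), fun x => ?_⟩
    have h1 := norm_iteratedFDeriv_mul_le (𝕜 := ℝ) (N := ((⊤ : ℕ∞) : WithTop ℕ∞)) (n := n) (x := x)
      ((f.smooth ⊤).comp a.contDiff) ((g.smooth ⊤).comp b.contDiff)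
      (hcast n)
    have h2 : ‖x‖ ^ k ≤ (1 + ‖a x‖) ^ k * (1 + ‖b x‖) ^ k := by
      rw [← mul_pow]
      refine pow_le_pow_left₀ (norm_nonneg _) ((hab x).trans ?_) k
      have := norm_nonneg (a x)
      have := norm_nonneg (b x)
      refine max_le ?_ ?_ <;> nlinarith [mul_nonneg (norm_nonneg (a x)) (norm_nonneg (b x))]
    refine (mul_le_mul h2 h1 (norm_nonneg _) (by positivity)).trans ?_
    rw [Finset.mul_sum]
    refine Finset.sum_le_sum fun i _ => ?_
    have h3 : ‖iteratedFDeriv ℝ i (⇑f ∘ ⇑a) x‖ ≤ ‖iteratedFDeriv ℝ i f (a x)‖ * ‖a‖ ^ i := by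
      rw [a.iteratedFDeriv_comp_right (f.smooth ⊤) x (hcast i)]
      simpa using ContinuousMultilinearMap.norm_compContinuousLinearMap_le (iteratedFDeriv ℝ i f (a x)) fun _ => a
    have h4 : ‖iteratedFDeriv ℝ (n - i) (⇑g ∘ ⇑b) x‖ ≤
        ‖iteratedFDeriv ℝ (n - i) g (b x)‖ * ‖b‖ ^ (n - i) := by
      rw [b.iteratedFDeriv_comp_right (g.smooth ⊤) x (hcast (n - i))]
      simpa using ContinuousMultilinearMap.norm_compContinuousLinearMap_le
        (iteratedFDeriv ℝ (n - i) g (b x)) fun _ => b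
    calc _ ≤ (1 + ‖a x‖) ^ k * (1 + ‖b x‖) ^ k * ((n.choose i : ℝ) *
          (‖iteratedFDeriv ℝ i f (a x)‖ * ‖a‖ ^ i) *
          (‖iteratedFDeriv ℝ (n - i) g (b x)‖ * ‖b‖ ^ (n - i))) := by gcongr
      _ = (n.choose i : ℝ) * (((1 + ‖a x‖) ^ k * ‖iteratedFDeriv ℝ i f (a x)‖) * ‖a‖ ^ i) *
          (((1 + ‖b x‖) ^ k * ‖iteratedFDeriv ℝ (n - i) g (b x)‖) * ‖b‖ ^ (n - i)) := by ring
      _ ≤ _ := by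
        have := hA i (a x)
        have := hB (n - i) (b x)
        have := hA0 i
        gcongr

/-- `(x₁, …, x_{k+l}) ↦ (x₁, …, x_k)`. -/
def firstVars (s k l : ℕ) : (Fin (k + l) → Vec s) →L[ℝ] (Fin k → Vec s) :=
  ContinuousLinearMap.pi fun i => ContinuousLinearMap.proj (Fin.castAdd l i)

/-- `(x₁, …, x_{k+l}) ↦ (x_{k+1}, …, x_{k+l})`. -/
def lastVars (s k l : ℕ) : (Fin (k + l) → Vec s) →L[ℝ] (Fin l → Vec s) :=
  ContinuousLinearMap.pi fun i => ContinuousLinearMap.proj (Fin.natAdd k i)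

theorem norm_le_vars (s k l : ℕ) (x : Fin (k + l) → Vec s) :
    ‖x‖ ≤ max ‖firstVars s k l x‖ ‖lastVars s k l x‖ := by
  refine (pi_norm_le_iff_of_nonneg (le_max_of_le_left (norm_nonneg _))).2 fun i => ?_
  refine Fin.addCases (fun j => ?_) (fun j => ?_) i
  · exact le_max_of_le_left (norm_le_pi_norm (firstVars s k l x) j)
  · exact le_max_of_le_right (norm_le_pi_norm (lastVars s k l x) j)

/-- The tensor product `𝒮_k × 𝒮_l → 𝒮_{k+l}` of test functions. -/
def tensor (s k l : ℕ) : TestFn s k →ₗ[ℂ] TestFn s l →ₗ[ℂ] TestFn s (k + l) :=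
  LinearMap.mk₂ ℂ (schwartzProd (firstVars s k l) (lastVars s k l) (norm_le_vars s k l))
    (fun f f' g => by ext x; exact add_mul _ _ _)
    (fun c f g => by ext x; exact mul_assoc _ _ _)
    (fun f g g' => by ext x; exact mul_add _ _ _)
    (fun c f g => by ext x; exact mul_left_comm _ _ _)

@[simp]
theorem tensor_apply {s k l : ℕ} (f : TestFn s k) (g : TestFn s l) (x : Fin (k + l) → Vec s) :
    tensor s k l f g x = f (fun i => x (Fin.castAdd l i)) * g (fun i => x (Fin.natAdd k i)) := rfl

/-- The Borchers-Uhlmann algebra `⨁ₙ 𝒮_n` of terminating sequences of test functions, as a vector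
space. Its undeformed product is `BUAlg.mul`. -/
abbrev BUAlg (s : ℕ) : Type := DirectSum ℕ fun n => TestFn s n

/-- The product of the Borchers-Uhlmann algebra,
`(f ⊗ g)_n (x₁, …, x_n) = ∑ₖ f_k (x₁, …, x_k) g_{n-k} (x_{k+1}, …, x_n)`. -/
def BUAlg.mul {s : ℕ} : BUAlg s →ₗ[ℂ] BUAlg s →ₗ[ℂ] BUAlg s :=
  DirectSum.toModule ℂ ℕ _ fun k => LinearMap.flip <| DirectSum.toModule ℂ ℕ _ fun l =>
    LinearMap.flip <| (tensor s k l).compr₂ (DirectSum.lof ℂ ℕ (fun n => TestFn s n) (k + l))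

theorem BUAlg.mul_lof {s k l : ℕ} (f : TestFn s k) (g : TestFn s l) :
    BUAlg.mul (DirectSum.lof ℂ ℕ (fun n => TestFn s n) k f)
      (DirectSum.lof ℂ ℕ (fun n => TestFn s n) l g) =
    DirectSum.lof ℂ ℕ (fun n => TestFn s n) (k + l) (tensor s k l f g) := by
  simp [BUAlg.mul]

theorem measurePreserving_curry (ι κ : Type*) [Fintype ι] [Fintype κ] :
    MeasurePreserving (fun (x : ι → κ → ℝ) (q : ι × κ) => x q.1 q.2) := by
  refine ⟨by fun_prop, ?_⟩
  refine (Measure.pi_eq fun t ht => ?_).symm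
  rw [Measure.map_apply (by fun_prop) (MeasurableSet.univ_pi ht)]
  have : (fun (x : ι → κ → ℝ) (q : ι × κ) => x q.1 q.2) ⁻¹' Set.univ.pi t =
      Set.univ.pi fun i => Set.univ.pi fun j => t (i, j) := by
    ext x; simp [Set.mem_pi]
  rw [this, volume_pi_pi]
  simp_rw [volume_pi_pi]
  rw [Fintype.prod_prod_type]

def euclEquiv (s n : ℕ) : (Fin n → Vec s) ≃L[ℝ] EuclideanSpace ℝ (Fin n × Fin (s + 2)) :=
  ((LinearEquiv.curry ℝ ℝ (Fin n) (Fin (s + 2))).symm.toContinuousLinearEquiv).trans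
    (EuclideanSpace.equiv (Fin n × Fin (s + 2)) ℝ).symm

/-- `(p⁰, p¹, …) ↦ (-p⁰, p¹, …)`. -/
def flipVec (s : ℕ) : Vec s →ₗ[ℝ] Vec s where
  toFun p := Fin.cons (-p 0) (fun j => p j.succ)
  map_add' p q := by
    ext μ; refine Fin.cases ?_ (fun j => ?_) μ <;> simp [add_comm]
  map_smul' c p := by
    ext μ; refine Fin.cases ?_ (fun j => ?_) μ <;> simp

/-- Composition with a linear isomorphism. -/
def pullback {D E : Type*} [NormedAddCommGroup D] [NormedSpace ℝ D] [NormedAddCommGroup E]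
    [NormedSpace ℝ E] (g : D ≃L[ℝ] E) : 𝓢(E, ℂ) ≃L[ℂ] 𝓢(D, ℂ) :=
  ContinuousLinearEquiv.equivOfInverse (compCLMOfContinuousLinearEquiv ℂ g)
    (compCLMOfContinuousLinearEquiv ℂ g.symm) (fun f => by ext x; simp) (fun f => by ext x; simp)

/-- `p ↦ (2π)⁻¹ (-p⁰, p¹, …)` in each variable; it turns the convention `e^{-2πi⟨x, p⟩}` of the
Euclidean Fourier transform into `e^{i p · x}` with the Minkowski product. -/
def scaleEquiv (s n : ℕ) : (Fin n → Vec s) ≃L[ℝ] (Fin n → Vec s) :=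
  LinearEquiv.toContinuousLinearEquiv <| LinearEquiv.ofLinearMap
    ((2 * Real.pi)⁻¹ • LinearMap.pi fun k => flipVec s ∘ₗ LinearMap.proj k)
    ((2 * Real.pi) • LinearMap.pi fun k => flipVec s ∘ₗ LinearMap.proj k)
    (by
      have : Real.pi ≠ 0 := Real.pi_ne_zero
      ext i x k μ; refine Fin.cases ?_ (fun j => ?_) μ <;> simp [flipVec] <;> field_simp)
    (by
      have : Real.pi ≠ 0 := Real.pi_ne_zero
      ext i x k μ; refine Fin.cases ?_ (fun j => ?_) μ <;> simp [flipVec] <;> field_simp)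

/-- The Fourier transform `f ↦ f̃` on `𝒮_n`, see `momentum_apply` for the integral formula. -/
def momentum (s n : ℕ) : TestFn s n ≃L[ℂ] TestFn s n :=
  (((pullback (euclEquiv s n).symm).trans
    (FourierTransform.fourierCLE ℂ 𝓢(EuclideanSpace ℝ (Fin n × Fin (s + 2)), ℂ))).trans
    (pullback ((scaleEquiv s n).trans (euclEquiv s n)))).trans
    (ContinuousLinearEquiv.smulLeft (Units.mk0
      ((((2 * Real.pi) ^ (-((n * (s + 2) : ℕ) : ℝ) / 2) : ℝ)) : ℂ) (by
        rw [Complex.ofReal_ne_zero]; positivity)))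

theorem momentum_apply {s n : ℕ} (f : TestFn s n) (p : Fin n → Vec s) :
    momentum s n f p = (((2 * Real.pi) ^ (-((n * (s + 2) : ℕ) : ℝ) / 2) : ℝ) : ℂ) *
      ∫ x : Fin n → Vec s, f x * Complex.exp (Complex.I * (∑ k, mink (p k) (x k) : ℝ)) := by
  have h1 : momentum s n f p = (((2 * Real.pi) ^ (-((n * (s + 2) : ℕ) : ℝ) / 2) : ℝ) : ℂ) *
      𝓕 (fun v => f ((euclEquiv s n).symm v)) (euclEquiv s n (scaleEquiv s n p)) := rfl
  rw [h1, Real.fourier_eq, ← (((PiLp.volume_preserving_toLp (Fin n × Fin (s + 2)))).comp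
    (measurePreserving_curry (Fin n) (Fin (s + 2)))).integral_comp
    (euclEquiv s n).toHomeomorph.measurableEmbedding]
  congr 1
  refine integral_congr_ae (Eventually.of_forall fun x => ?_)
  have h2 : (euclEquiv s n).symm (euclEquiv s n x) = x := (euclEquiv s n).symm_apply_apply x
  have h3 : inner ℝ (euclEquiv s n x) (euclEquiv s n (scaleEquiv s n p)) =
      -((2 * Real.pi)⁻¹ * ∑ k, mink (p k) (x k)) := by
    have h4 : ∀ (k : Fin n) (μ : Fin (s + 2)),
        (euclEquiv s n (scaleEquiv s n p)) (k, μ) = (2 * Real.pi)⁻¹ * flipVec s (p k) μ :=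
      fun _ _ => rfl
    have h5 : ∀ (k : Fin n) (μ : Fin (s + 2)), (euclEquiv s n x) (k, μ) = x k μ := fun _ _ => rfl
    rw [PiLp.inner_apply, Fintype.sum_prod_type, Finset.mul_sum, ← Finset.sum_neg_distrib]
    refine Finset.sum_congr rfl fun k _ => ?_
    simp only [h4, h5, Fin.sum_univ_succ (n := s + 1), flipVec, mink]
    simp [mul_sub, Finset.mul_sum, mul_assoc, mul_left_comm]
    ring
  change 𝐞 (-inner ℝ (euclEquiv s n x) (euclEquiv s n (scaleEquiv s n p))) •
    f ((euclEquiv s n).symm (euclEquiv s n x)) = _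
  rw [h2, h3, neg_neg, Circle.smul_def, Real.fourierChar_apply, smul_eq_mul, mul_comm]
  congr 2
  push_cast
  have : (Real.pi : ℂ) ≠ 0 := by exact_mod_cast Real.pi_ne_zero
  field_simp



/-- `ε_𝐤 = (𝐤² + m²)^{1/2}`. -/
def energy {s : ℕ} (m : ℝ) (k : Fin (s + 1) → ℝ) : ℝ := √(∑ j, k j ^ 2 + m ^ 2)

/-- The point `(ε_𝐤, 𝐤)` of the upper mass shell. -/
def onShell {s : ℕ} (m : ℝ) (k : Fin (s + 1) → ℝ) : Vec s := Fin.cons (energy m k) k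

/-- The measure `dμ(p) = ε_𝐩⁻¹ δ(p⁰ - ε_𝐩) dp` on `ℝ^d`; the one particle space is `L²(ℝ^d, dμ)`. -/
def massShell (s : ℕ) (m : ℝ) : Measure (Vec s) :=
  Measure.map (onShell m)
    ((volume : Measure (Fin (s + 1) → ℝ)).withDensity fun k => ENNReal.ofReal (energy m k)⁻¹)

theorem continuous_energy {s : ℕ} (m : ℝ) : Continuous (energy (s := s) m) := by
  unfold energy; fun_prop

theorem continuous_onShell {s : ℕ} (m : ℝ) : Continuous (onShell (s := s) m) := by
  refine continuous_pi fun μ => ?_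
  refine Fin.cases ?_ (fun j => ?_) μ
  · simpa [onShell] using continuous_energy m
  · simpa [onShell] using continuous_apply j

instance (s : ℕ) (m : ℝ) : SigmaFinite (massShell s m) := by
  have : MeasurableEmbedding (onShell (s := s) m) :=
    (continuous_onShell m).measurableEmbedding fun k k' h => by
      ext j; simpa [onShell] using congrFun h j.succ
  have := SigmaFinite.withDensity_ofReal (μ := (volume : Measure (Fin (s + 1) → ℝ)))
    (fun k => (energy m k)⁻¹)
  exact MeasurableEmbedding.sigmaFinite_map ‹_›

instance (s : ℕ) (m : ℝ) [hm : Fact (0 < m)] : (massShell s m).HasTemperateGrowth := by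
  obtain ⟨N, hN⟩ := (inferInstance : (volume : Measure (Fin (s + 1) → ℝ)).HasTemperateGrowth)
  refine ⟨N, ?_⟩
  have hc : Continuous fun x : Vec s => (1 + ‖x‖) ^ (-(N : ℝ)) :=
    (continuous_const.add continuous_norm).rpow_const fun x =>
      Or.inl (add_pos_of_pos_of_nonneg one_pos (norm_nonneg x)).ne'
  have he : ∀ k : Fin (s + 1) → ℝ, m ≤ energy m k := fun k =>
    Real.le_sqrt_of_sq_le (by have := Finset.sum_nonneg (fun j (_ : j ∈ Finset.univ) => sq_nonneg (k j)); linarith)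
  rw [massShell, integrable_map_measure hc.aestronglyMeasurable (continuous_onShell m).aemeasurable,
    integrable_withDensity_iff_integrable_smul' (by
      exact ((continuous_energy m).measurable.inv).ennreal_ofReal) (by simp)]
  refine (hN.const_mul m⁻¹).mono' ?_ (Eventually.of_forall fun k => ?_)
  · refine Measurable.aestronglyMeasurable ?_
    exact ((continuous_energy m).measurable.inv.ennreal_ofReal.ennreal_toReal).smul
      (hc.comp (continuous_onShell m)).measurable
  · have hk : ‖k‖ ≤ ‖onShell m k‖ := (pi_norm_le_iff_of_nonneg (norm_nonneg _)).2 fun j => by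
      simpa [onShell] using norm_le_pi_norm (onShell m k) j.succ
    have hm0 : 0 < m := hm.out
    have he' := he k
    have : 0 < energy m k := hm0.trans_le he'
    rw [norm_smul, ENNReal.toReal_ofReal (by positivity), Real.norm_of_nonneg (by positivity),
      Real.norm_of_nonneg (by simp only [Function.comp]; positivity)]
    refine mul_le_mul (inv_anti₀ hm0 he') ?_ (by simp only [Function.comp]; positivity) (by positivity)
    exact Real.rpow_le_rpow_of_nonpos (by positivity) (by linarith) (by simp)

/-- Sequences of `k`-particle wave functions, before passing to classes modulo null functions. -/
abbrev FockFn (s : ℕ) : Type := (k : ℕ) → (Fin k → Vec s) → ℂ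

/-- The expression `∫ dp a†(p) V(p)` for a family `V` of Fock space functions, which evaluates the
family on the upper mass shell:
`(create V)_k (x₁, …, x_k) = k^{-1/2} ∑ᵢ V(xᵢ)_{k-1} (x₁, …, x̂ᵢ, …, x_k)`. -/
def create {s : ℕ} (V : Vec s → FockFn s) : FockFn s
  | 0, _ => 0
  | k + 1, x => (√(k + 1 : ℝ) : ℂ)⁻¹ * ∑ i : Fin (k + 1), V (x i) k (i.removeNth x)

/-- The expression `∫ dμ(q) a(q) V(-q)` for a family `V` of Fock space functions, which evaluates
the family on the lower mass shell:
`(annihilate V)_k (x₁, …, x_k) = (k+1)^{1/2} ∫ dμ(q) V(-q)_{k+1} (q, x₁, …, x_k)`. -/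
def annihilate {s : ℕ} (m : ℝ) (V : Vec s → FockFn s) : FockFn s := fun k x =>
  (√(k + 1 : ℝ) : ℂ) * ∫ q, V (-q) (k + 1) (Fin.cons q x) ∂massShell s m

/-- `∫ dp₁ ⋯ dp_n F(p₁, …, p_n) φ̃(p₁) ⋯ φ̃(p_n) Ω` for the free field
`φ(f) = a†(f⁺) + a(conj f⁻)`, `f^±(p) = f̃(±p)`, that is `φ(f) = ∫ dp f̃(p) φ̃(p)`. The variable
`p₁` belongs to the leftmost field operator, which acts last. -/
def fieldProduct {s : ℕ} (m : ℝ) : (n : ℕ) → ((Fin n → Vec s) → ℂ) → FockFn s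
  | 0, F => fun k _ => if k = 0 then F 0 else 0
  | n + 1, F => create (fun p => fieldProduct m n fun p' => F (Fin.cons p p')) +
      annihilate m (fun p => fieldProduct m n fun p' => F (Fin.cons p p'))

/-- Continuous functions that decay faster than any power. -/
def RapidDecay {E : Type*} [NormedAddCommGroup E] (G : E → ℂ) : Prop :=
  Continuous G ∧ ∀ N : ℕ, ∃ C : ℝ, ∀ x, (1 + ‖x‖) ^ N * ‖G x‖ ≤ C

namespace RapidDecay
variable {E D : Type*} [NormedAddCommGroup E] [NormedAddCommGroup D]

theorem comp {G : E → ℂ} (hG : RapidDecay G) {a : D → E} (ha : Continuous a)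
    (hn : ∀ x, ‖x‖ ≤ ‖a x‖) : RapidDecay fun x => G (a x) := by
  refine ⟨hG.1.comp ha, fun N => ?_⟩
  obtain ⟨C, hC⟩ := hG.2 N
  refine ⟨C, fun x => le_trans ?_ (hC (a x))⟩
  have := hn x
  gcongr

theorem add {G H : E → ℂ} (hG : RapidDecay G) (hH : RapidDecay H) :
    RapidDecay fun x => G x + H x := by
  refine ⟨hG.1.add hH.1, fun N => ?_⟩
  obtain ⟨C, hC⟩ := hG.2 N
  obtain ⟨C', hC'⟩ := hH.2 N
  refine ⟨C + C', fun x => le_trans ?_ (add_le_add (hC x) (hC' x))⟩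
  rw [← mul_add]
  gcongr
  exact norm_add_le _ _

theorem const_mul {G : E → ℂ} (hG : RapidDecay G) (c : ℂ) : RapidDecay fun x => c * G x := by
  refine ⟨continuous_const.mul hG.1, fun N => ?_⟩
  obtain ⟨C, hC⟩ := hG.2 N
  refine ⟨‖c‖ * C, fun x => ?_⟩
  rw [norm_mul, mul_left_comm]
  exact mul_le_mul_of_nonneg_left (hC x) (norm_nonneg _)

theorem zero : RapidDecay fun _ : E => (0 : ℂ) := ⟨continuous_const, fun _ => ⟨0, by simp⟩⟩

theorem sum {ι : Type*} (t : Finset ι) {G : ι → E → ℂ} (hG : ∀ i, RapidDecay (G i)) :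
    RapidDecay fun x => ∑ i ∈ t, G i x := by
  classical
  induction t using Finset.induction_on with
  | empty => simpa using zero
  | insert i t hi ih => simpa [Finset.sum_insert hi] using (hG i).add ih

theorem schwartz [NormedSpace ℝ E] (f : 𝓢(E, ℂ)) : RapidDecay f := by
  refine ⟨f.continuous, fun N => ?_⟩
  have h := one_add_le_sup_seminorm_apply (𝕜 := ℝ) (m := (N, 0)) (k := N) (n := 0) le_rfl le_rfl f
  simp only [norm_iteratedFDeriv_zero] at h
  exact ⟨_, h⟩

theorem bound {G : E → ℂ} {N : ℕ} {C : ℝ} (h : ∀ x, (1 + ‖x‖) ^ N * ‖G x‖ ≤ C) (x : E) :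
    ‖G x‖ ≤ C * (1 + ‖x‖) ^ (-(N : ℝ)) := by
  rw [Real.rpow_neg (by positivity), Real.rpow_natCast, ← div_eq_mul_inv, le_div_iff₀ (by positivity),
    mul_comm]
  exact h x

theorem integrable [MeasurableSpace E] [BorelSpace E] [SecondCountableTopology E] {G : E → ℂ}
    (hG : RapidDecay G) (μ : Measure E) [hμ : μ.HasTemperateGrowth] : Integrable G μ := by
  obtain ⟨N, hN⟩ := hμ
  obtain ⟨C, hC⟩ := hG.2 N
  exact (hN.const_mul C).mono' hG.1.aestronglyMeasurable (Eventually.of_forall (bound hC))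

theorem integral [MeasurableSpace E] [BorelSpace E] [SecondCountableTopology E]
    {G : D × E → ℂ} (hG : RapidDecay G) (μ : Measure E) [hμ : μ.HasTemperateGrowth] :
    RapidDecay fun y => ∫ x, G (y, x) ∂μ := by
  obtain ⟨K, hK⟩ := hμ
  have key : ∀ N : ℕ, ∃ C : ℝ, ∀ y x, (1 + ‖y‖) ^ N * ‖G (y, x)‖ ≤ C * (1 + ‖x‖) ^ (-(K : ℝ)) := by
    intro N
    obtain ⟨C, hC⟩ := hG.2 (N + K)
    refine ⟨C, fun y x => ?_⟩
    rw [Real.rpow_neg (by positivity), Real.rpow_natCast, ← div_eq_mul_inv,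
      le_div_iff₀ (by positivity)]
    refine le_trans ?_ (hC (y, x))
    rw [pow_add, mul_right_comm]
    have h1 : ‖y‖ ≤ ‖(y, x)‖ := le_max_left _ _
    have h2 : ‖x‖ ≤ ‖(y, x)‖ := le_max_right _ _
    gcongr
  have hi : ∀ y, Integrable (fun x => G (y, x)) μ := fun y => by
    obtain ⟨C, hC⟩ := key 0
    exact (hK.const_mul C).mono' (hG.1.comp (by fun_prop)).aestronglyMeasurable
      (Eventually.of_forall fun x => by simpa using hC y x)
  refine ⟨?_, fun N => ?_⟩
  · obtain ⟨C, hC⟩ := key 0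
    refine continuous_of_dominated (fun y => (hi y).aestronglyMeasurable)
      (fun y => Eventually.of_forall fun x => ?_) (hK.const_mul C)
      (Eventually.of_forall fun x => hG.1.comp (by fun_prop))
    simpa using hC y x
  · obtain ⟨C, hC⟩ := key N
    refine ⟨∫ x, C * (1 + ‖x‖) ^ (-(K : ℝ)) ∂μ, fun y => ?_⟩
    calc _ ≤ (1 + ‖y‖) ^ N * ∫ x, ‖G (y, x)‖ ∂μ := by
          gcongr; exact norm_integral_le_integral_norm _
      _ = ∫ x, (1 + ‖y‖) ^ N * ‖G (y, x)‖ ∂μ := (integral_const_mul _ _).symm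
      _ ≤ _ := integral_mono ((hi y).norm.const_mul _) (hK.const_mul C) (hC y)

theorem memLp {ι : Type*} [Fintype ι] [MeasurableSpace E] [BorelSpace E]
    [SecondCountableTopology E] {G : (ι → E) → ℂ} (hG : RapidDecay G) (μ : Measure E) [SigmaFinite μ]
    [hμ : μ.HasTemperateGrowth] : MemLp G 2 (Measure.pi fun _ : ι => μ) := by
  obtain ⟨K, hK⟩ := hμ
  obtain ⟨C, hC⟩ := hG.2 (Fintype.card ι * K)
  have hb : ∀ x, ‖G x‖ ^ 2 ≤ C ^ 2 * ∏ i, (1 + ‖x i‖) ^ (-(K : ℝ)) := by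
    intro x
    have h1 : (1:ℝ) ≤ ∏ i, (1 + ‖x i‖) ^ K :=
      Finset.one_le_prod fun i _ => one_le_pow₀ (by linarith [norm_nonneg (x i)])
    have h2 : ∏ i, (1 + ‖x i‖) ^ K ≤ (1 + ‖x‖) ^ (Fintype.card ι * K) := by
      calc _ ≤ ∏ _i : ι, (1 + ‖x‖) ^ K := Finset.prod_le_prod (fun i _ => by positivity)
            fun i _ => by gcongr; exact norm_le_pi_norm x i
        _ = _ := by simp [← pow_mul, mul_comm]
    have h3 : ∏ i, (1 + ‖x i‖) ^ (-(K : ℝ)) = (∏ i, (1 + ‖x i‖) ^ K)⁻¹ := by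
      rw [← Finset.prod_inv_distrib]
      exact Finset.prod_congr rfl fun i _ => by
        rw [Real.rpow_neg (by positivity), Real.rpow_natCast]
    rw [h3, ← div_eq_mul_inv, le_div_iff₀ (by positivity)]
    set P := ∏ i, (1 + ‖x i‖) ^ K
    calc ‖G x‖ ^ 2 * P ≤ ‖G x‖ ^ 2 * P ^ 2 := by
          gcongr; nlinarith
      _ = (P * ‖G x‖) ^ 2 := by ring
      _ ≤ C ^ 2 := by
          gcongr
          exact le_trans (by gcongr) (hC x)
  rw [memLp_two_iff_integrable_sq_norm hG.1.aestronglyMeasurable]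
  exact ((Integrable.fintype_prod fun _ : ι => hK).const_mul (C ^ 2)).mono'
    (hG.1.norm.pow 2).aestronglyMeasurable (Eventually.of_forall fun x => by
      rw [Real.norm_of_nonneg (by positivity)]; exact hb x)

end RapidDecay

theorem norm_le_cons {s n : ℕ} (p : Vec s) (x : Fin n → Vec s) :
    ‖x‖ ≤ ‖(Fin.cons p x : Fin (n + 1) → Vec s)‖ :=
  (pi_norm_le_iff_of_nonneg (norm_nonneg _)).2 fun i => by
    simpa using norm_le_pi_norm (Fin.cons p x : Fin (n + 1) → Vec s) i.succ

theorem norm_head_le_cons {s n : ℕ} (p : Vec s) (x : Fin n → Vec s) :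
    ‖p‖ ≤ ‖(Fin.cons p x : Fin (n + 1) → Vec s)‖ := by
  simpa using norm_le_pi_norm (Fin.cons p x : Fin (n + 1) → Vec s) 0

theorem continuous_cons {s n : ℕ} {E : Type*} [TopologicalSpace E] {a : E → Vec s}
    {b : E → Fin n → Vec s} (ha : Continuous a) (hb : Continuous b) :
    Continuous fun e => (Fin.cons (a e) (b e) : Fin (n + 1) → Vec s) := by
  refine continuous_pi fun i => ?_
  refine Fin.cases ?_ (fun j => ?_) i
  · simpa using ha
  · simpa [Function.comp_def] using (continuous_apply j).comp hb

theorem RapidDecay.cons_left {s n : ℕ} {F : (Fin (n + 1) → Vec s) → ℂ} (hF : RapidDecay F)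
    (p : Vec s) : RapidDecay fun p' : Fin n → Vec s => F (Fin.cons p p') :=
  hF.comp (continuous_cons continuous_const continuous_id) (norm_le_cons p)

theorem rapidDecay_fieldProduct_param {s : ℕ} (m : ℝ) [Fact (0 < m)] (n : ℕ) : ∀ {E : Type} [NormedAddCommGroup E] (F : E × (Fin n → Vec s) → ℂ),
    RapidDecay F → ∀ k, RapidDecay fun yx : E × (Fin k → Vec s) =>
      fieldProduct m n (fun p => F (yx.1, p)) k yx.2 := by
  induction n with
  | zero =>
    intro E _ F hF k
    rcases Nat.eq_zero_or_pos k with rfl | hk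
    · refine hF.comp (a := fun yx : E × (Fin 0 → Vec s) => (yx.1, (0 : Fin 0 → Vec s))) (by fun_prop) ?_
      rintro ⟨y, x⟩
      rw [Subsingleton.elim x 0]
    · simpa [fieldProduct, hk.ne'] using RapidDecay.zero
  | succ n ih =>
    intro E _ F hF k
    have hV := ih (E := E × Vec s) (fun w => F (w.1.1, Fin.cons w.1.2 w.2))
      (hF.comp (a := fun w : (E × Vec s) × (Fin n → Vec s) =>
        (w.1.1, (Fin.cons w.1.2 w.2 : Fin (n + 1) → Vec s)))
        (by
          refine (by fun_prop : Continuous fun w : (E × Vec s) × (Fin n → Vec s) => w.1.1).prodMk ?_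
          exact continuous_cons (by fun_prop) (by fun_prop))
        (fun w => by
          refine max_le (max_le ?_ ?_) ?_
          · exact le_max_left _ _
          · exact (norm_head_le_cons _ _).trans (le_max_right _ _)
          · exact (norm_le_cons _ _).trans (le_max_right _ _)))
    refine RapidDecay.add (G := fun yx : E × (Fin k → Vec s) => create (fun p => fieldProduct m n fun p' =>
      F (yx.1, Fin.cons p p')) k yx.2) ?_ ?_
    · rcases k with _ | k
      · exact RapidDecay.zero
      · refine RapidDecay.const_mul (RapidDecay.sum _ fun i => ?_) _
        refine (hV k).comp (a := fun yx : E × (Fin (k + 1) → Vec s) =>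
          ((yx.1, yx.2 i), i.removeNth yx.2)) ?_ ?_
        · refine Continuous.prodMk (by fun_prop) ?_
          unfold Fin.removeNth; fun_prop
        · rintro ⟨y, x⟩
          refine max_le ((le_max_left _ _).trans (le_max_left _ _)) ?_
          refine (pi_norm_le_iff_of_nonneg (norm_nonneg _)).2 fun j => ?_
          rcases Fin.eq_self_or_eq_succAbove i j with rfl | ⟨j, rfl⟩
          · exact (le_max_right _ _).trans (le_max_left _ _)
          · exact (norm_le_pi_norm (i.removeNth x) j).trans (le_max_right _ _)
    · refine RapidDecay.const_mul ?_ _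
      refine RapidDecay.integral (G := fun w : (E × (Fin k → Vec s)) × Vec s =>
        fieldProduct m n (fun p' => F (w.1.1, Fin.cons (-w.2) p')) (k + 1) (Fin.cons w.2 w.1.2)) ?_ _
      refine (hV (k + 1)).comp (a := fun w : (E × (Fin k → Vec s)) × Vec s =>
          ((w.1.1, -w.2), (Fin.cons w.2 w.1.2 : Fin (k + 1) → Vec s))) ?_ ?_
      · exact Continuous.prodMk (by fun_prop) (continuous_cons (by fun_prop) (by fun_prop))
      · intro w
        refine max_le (max_le ((le_max_left _ _).trans (le_max_left _ _)) ?_) ?_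
        · exact (norm_le_cons _ _).trans (le_max_right _ _)
        · exact (norm_head_le_cons _ _).trans (le_max_right _ _)

theorem rapidDecay_fieldProduct {s : ℕ} (m : ℝ) [Fact (0 < m)] {n : ℕ} {F : (Fin n → Vec s) → ℂ} (hF : RapidDecay F) (k : ℕ) :
    RapidDecay (fieldProduct m n F k) := by
  have h := rapidDecay_fieldProduct_param m n (E := PUnit) (fun w => F w.2)
    (hF.comp continuous_snd fun w => by
      rw [Prod.norm_def, Subsingleton.elim w.1 0, norm_zero]
      exact max_le (norm_nonneg _) le_rfl) k
  exact h.comp (a := fun x => (0, x)) (by fun_prop) fun x => le_max_right _ _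

theorem integrable_annihilate {s : ℕ} (m : ℝ) [Fact (0 < m)] {n : ℕ} {F : (Fin (n + 1) → Vec s) → ℂ} (hF : RapidDecay F) (k : ℕ)
    (x : Fin k → Vec s) : Integrable (fun q => fieldProduct m n (fun p' => F (Fin.cons (-q) p'))
      (k + 1) (Fin.cons q x)) (massShell s m) := by
  have h := rapidDecay_fieldProduct_param m n (E := Vec s) (fun w => F (Fin.cons w.1 w.2))
    (hF.comp (continuous_cons (by fun_prop) (by fun_prop)) fun w =>
      max_le (norm_head_le_cons _ _) (norm_le_cons _ _)) (k + 1)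
  refine RapidDecay.integrable (h.comp (a := fun q : Vec s =>
    (-q, (Fin.cons q x : Fin (k + 1) → Vec s))) ?_ fun q => ?_) _
  · exact continuous_neg.prodMk (continuous_cons continuous_id continuous_const)
  · exact (norm_head_le_cons _ _).trans (le_max_right _ _)

theorem fieldProduct_add {s : ℕ} (m : ℝ) [Fact (0 < m)] (n : ℕ) : ∀ {F G : (Fin n → Vec s) → ℂ}, RapidDecay F → RapidDecay G →
    ∀ k x, fieldProduct m n (fun p => F p + G p) k x =
      fieldProduct m n F k x + fieldProduct m n G k x := by
  induction n with
  | zero => intro F G _ _ k x; by_cases hk : k = 0 <;> simp [fieldProduct, hk]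
  | succ n ih =>
    intro F G hF hG k x
    have h1 : ∀ p, (fieldProduct m n fun p' => F (Fin.cons p p') + G (Fin.cons p p')) =
        fieldProduct m n (fun p' => F (Fin.cons p p')) +
          fieldProduct m n fun p' => G (Fin.cons p p') := fun p => by
      ext k x; exact ih (hF.cons_left p) (hG.cons_left p) k x
    have hc : create (fun p => fieldProduct m n fun p' => F (Fin.cons p p') + G (Fin.cons p p')) k x =
        create (fun p => fieldProduct m n fun p' => F (Fin.cons p p')) k x +
        create (fun p => fieldProduct m n fun p' => G (Fin.cons p p')) k x := by
      simp only [h1]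
      rcases k with _ | k
      · simp [create]
      · simp [create, Finset.sum_add_distrib, mul_add]
    have ha : annihilate m (fun p => fieldProduct m n fun p' => F (Fin.cons p p') + G (Fin.cons p p')) k x =
        annihilate m (fun p => fieldProduct m n fun p' => F (Fin.cons p p')) k x +
        annihilate m (fun p => fieldProduct m n fun p' => G (Fin.cons p p')) k x := by
      simp only [h1, annihilate, Pi.add_apply]
      rw [integral_add (integrable_annihilate m hF k x) (integrable_annihilate m hG k x), mul_add]
    simp only [fieldProduct, Pi.add_apply, hc, ha]
    ring

theorem fieldProduct_smul {s : ℕ} (m : ℝ) (n : ℕ) : ∀ (c : ℂ) (F : (Fin n → Vec s) → ℂ) (k : ℕ) (x : Fin k → Vec s),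
    fieldProduct m n (fun p => c * F p) k x = c * fieldProduct m n F k x := by
  induction n with
  | zero => intro c F k x; by_cases hk : k = 0 <;> simp [fieldProduct, hk]
  | succ n ih =>
    intro c F k x
    have hc : create (fun p => fieldProduct m n fun p' => c * F (Fin.cons p p')) k x =
        c * create (fun p => fieldProduct m n fun p' => F (Fin.cons p p')) k x := by
      rcases k with _ | k
      · simp [create]
      · simp only [create, ih, ← Finset.mul_sum]; ring
    have ha : annihilate m (fun p => fieldProduct m n fun p' => c * F (Fin.cons p p')) k x =
        c * annihilate m (fun p => fieldProduct m n fun p' => F (Fin.cons p p')) k x := by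
      simp only [annihilate, ih, integral_const_mul]; ring
    simp only [fieldProduct, Pi.add_apply, hc, ha, mul_add]

theorem removeNth_comp_perm {s k : ℕ} (σ : Equiv.Perm (Fin (k + 1))) (i : Fin (k + 1)) :
    ∃ τ : Equiv.Perm (Fin k), ∀ x : Fin (k + 1) → Vec s,
      i.removeNth (fun j => x (σ j)) = fun j => (σ i).removeNth x (τ j) := by
  have h : ∀ j : Fin k, ∃ j' : Fin k, (σ i).succAbove j' = σ (i.succAbove j) := fun j =>
    Fin.exists_succAbove_eq (fun h => Fin.succAbove_ne i j (σ.injective h))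
  choose τ hτ using h
  have hinj : Function.Injective τ := fun a b hab => by
    have := hτ a
    rw [hab, hτ b] at this
    exact (Fin.succAbove_right_injective (σ.injective this)).symm
  refine ⟨Equiv.ofBijective τ (Finite.injective_iff_bijective.1 hinj), fun x => ?_⟩
  ext1 j
  simp [Fin.removeNth, hτ]

theorem fieldProduct_perm {s : ℕ} (m : ℝ) (n : ℕ) : ∀ (F : (Fin n → Vec s) → ℂ) (k : ℕ) (σ : Equiv.Perm (Fin k))
    (x : Fin k → Vec s), fieldProduct m n F k (fun i => x (σ i)) = fieldProduct m n F k x := by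
  induction n with
  | zero => intro F k σ x; rfl
  | succ n ih =>
    intro F k σ x
    have hc : create (fun p => fieldProduct m n fun p' => F (Fin.cons p p')) k (fun i => x (σ i)) =
        create (fun p => fieldProduct m n fun p' => F (Fin.cons p p')) k x := by
      rcases k with _ | k
      · rfl
      · simp only [create]
        congr 1
        refine Fintype.sum_equiv σ _ _ fun i => ?_
        obtain ⟨τ, hτ⟩ := removeNth_comp_perm (s := s) σ i
        rw [hτ x]
        exact ih _ k τ _
    have ha : annihilate m (fun p => fieldProduct m n fun p' => F (Fin.cons p p')) k (fun i => x (σ i)) =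
        annihilate m (fun p => fieldProduct m n fun p' => F (Fin.cons p p')) k x := by
      simp only [annihilate]
      congr 1
      refine integral_congr_ae (Eventually.of_forall fun q => ?_)
      have : (Fin.cons q (fun i => x (σ i)) : Fin (k + 1) → Vec s) =
          fun j => (Fin.cons q x : Fin (k + 1) → Vec s) (Equiv.Perm.decomposeFin.symm (0, σ) j) := by
        ext1 j
        refine Fin.cases ?_ (fun j => ?_) j <;> simp
      simp only [this]
      exact ih _ _ _ _
    simp only [fieldProduct, Pi.add_apply, hc, ha]


theorem measurePreserving_perm {s n : ℕ} (μ : Measure (Vec s)) [SigmaFinite μ]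
    (σ : Equiv.Perm (Fin n)) : MeasurePreserving (fun (x : Fin n → Vec s) i => x (σ i))
      (Measure.pi fun _ => μ) (Measure.pi fun _ => μ) := by
  have h := measurePreserving_piCongrLeft (fun _ : Fin n => μ) σ.symm
  convert h using 1
  ext1 x
  ext1 i
  have := MeasurableEquiv.piCongrLeft_apply_apply (β := fun _ : Fin n => Vec s) σ.symm x (σ i)
  simpa using this.symm

/-- `L²(ℝ^{nd}, dμ^{⊗ n})`. -/
abbrev ParticleL2 (s : ℕ) (m : ℝ) (n : ℕ) : Type :=
  Lp ℂ 2 (Measure.pi fun _ : Fin n => massShell s m)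

/-- The `n`-particle space: the permutation invariant elements of `L²(ℝ^{nd}, dμ^{⊗ n})`. -/
def bosonSpace (s : ℕ) (m : ℝ) (n : ℕ) : Submodule ℂ (ParticleL2 s m n) :=
  ⨅ σ : Equiv.Perm (Fin n), LinearMap.eqLocus
    (Lp.compMeasurePreservingₗ ℂ (fun (x : Fin n → Vec s) i => x (σ i))
      (measurePreserving_perm (massShell s m) σ)) LinearMap.id

theorem isClosed_bosonSpace (s : ℕ) (m : ℝ) (n : ℕ) :
    IsClosed (bosonSpace s m n : Set (ParticleL2 s m n)) := by
  rw [bosonSpace, Submodule.coe_iInf]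
  refine isClosed_iInter fun σ => ?_
  exact isClosed_eq (Lp.isometry_compMeasurePreserving
    (measurePreserving_perm (massShell s m) σ)).continuous continuous_id

instance (s : ℕ) (m : ℝ) (n : ℕ) : CompleteSpace (bosonSpace s m n) :=
  (isClosed_bosonSpace s m n).completeSpace_coe

/-- The Bose Fock space over `L²(ℝ^d, dμ)`, which is the representation space `ℋ` of the free field. -/
abbrev FockSpace (s : ℕ) (m : ℝ) : Type := lp (fun n : ℕ => bosonSpace s m n) 2

theorem memLp_fieldProduct {s : ℕ} (m : ℝ) [Fact (0 < m)] {n : ℕ} (f : TestFn s n) (k : ℕ) :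
    MemLp (fieldProduct m n (momentum s n f) k) 2 (Measure.pi fun _ : Fin k => massShell s m) :=
  (rapidDecay_fieldProduct m (RapidDecay.schwartz (momentum s n f)) k).memLp (massShell s m)

/-- The `k`-particle component of the Fock space vector `φ(f) Ω`, `f ∈ 𝒮_n`. -/
def component (s : ℕ) (m : ℝ) [Fact (0 < m)] (n k : ℕ) : TestFn s n →ₗ[ℂ] bosonSpace s m k :=
  LinearMap.codRestrict (bosonSpace s m k)
    { toFun := fun f => (memLp_fieldProduct m f k).toLp _
      map_add' := fun f g => by
        rw [← MemLp.toLp_add]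
        congr 1
        ext1 x
        rw [map_add]
        exact fieldProduct_add m n (RapidDecay.schwartz _) (RapidDecay.schwartz _) k x
      map_smul' := fun c f => by
        rw [RingHom.id_apply, ← MemLp.toLp_const_smul]
        congr 1
        ext1 x
        rw [map_smul]
        exact fieldProduct_smul m n c _ k x }
    (fun f => by
      refine (Submodule.mem_iInf _).2 fun σ => ?_
      change Lp.compMeasurePreserving _ (measurePreserving_perm (massShell s m) σ)
        ((memLp_fieldProduct m f k).toLp _) = (memLp_fieldProduct m f k).toLp _
      rw [Lp.toLp_compMeasurePreserving]
      congr 1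
      ext1 x
      exact fieldProduct_perm m n _ k σ x)

theorem fieldProduct_eq_zero {s : ℕ} (m : ℝ) (n : ℕ) : ∀ (F : (Fin n → Vec s) → ℂ) (k : ℕ), n < k →
    fieldProduct m n F k = 0 := by
  induction n with
  | zero => intro F k hk; ext x; simp [fieldProduct, Nat.ne_of_gt hk]
  | succ n ih =>
    intro F k hk
    obtain ⟨k, rfl⟩ : ∃ l, k = l + 1 := ⟨k - 1, by omega⟩
    ext x
    simp [fieldProduct, create, annihilate, ih _ k (by omega), ih _ (k + 1 + 1) (by omega)]

/-- The vector `Ψ(f) = φ(f) Ω` of the representation of the Borchers-Uhlmann algebra by the free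
field of mass `m`. For `f ∈ 𝒮_n` its components with more than `n` particles vanish, see
`fieldProduct_eq_zero`. -/
def fockVec (s : ℕ) (m : ℝ) [Fact (0 < m)] : BUAlg s →ₗ[ℂ] FockSpace s m :=
  DirectSum.toModule ℂ ℕ _ fun n => ∑ k ∈ Finset.range (n + 1),
    lp.lsingle 2 k ∘ₗ component s m n k

/-- The `n`-point functions `ρ_n(p₁, …, p_n) = ∏_{l < r} R(-p_l · Q p_r)` of the deformation map. -/
def npoint {s : ℕ} (R : ℝ → ℂ) (Q : Matrix (Fin (s + 2)) (Fin (s + 2)) ℝ) (n : ℕ)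
    (p : Fin n → Vec s) : ℂ :=
  ∏ l : Fin n, ∏ r ∈ Finset.Ioi l, R (-mink (p l) (Q.mulVec (p r)))

/-- Multiplication by the function `u` in momentum space. -/
def multiplier {s n : ℕ} (u : (Fin n → Vec s) → ℂ) : TestFn s n →ₗ[ℂ] TestFn s n :=
  (momentum s n).symm.toLinearMap ∘ₗ (smulLeftCLM ℂ u).toLinearMap ∘ₗ (momentum s n).toLinearMap

/-- The deformation map `ρ`, which multiplies `f̃_n` by `ρ_n`. -/
def deform {s : ℕ} (R : ℝ → ℂ) (Q : Matrix (Fin (s + 2)) (Fin (s + 2)) ℝ) :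
    BUAlg s →ₗ[ℂ] BUAlg s :=
  DirectSum.lmap fun n => multiplier (npoint R Q n)

/-- The inverse `ρ⁻¹` of the deformation map. -/
def deformInv {s : ℕ} (R : ℝ → ℂ) (Q : Matrix (Fin (s + 2)) (Fin (s + 2)) ℝ) :
    BUAlg s →ₗ[ℂ] BUAlg s :=
  DirectSum.lmap fun n => multiplier fun p => (npoint R Q n p)⁻¹

/-- The deformed product `f ⊗_ρ g = ρ⁻¹(ρ(f) ⊗ ρ(g))`. -/
def deformedMul {s : ℕ} (R : ℝ → ℂ) (Q : Matrix (Fin (s + 2)) (Fin (s + 2)) ℝ) (f : BUAlg s) :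
    BUAlg s →ₗ[ℂ] BUAlg s :=
  deformInv R Q ∘ₗ BUAlg.mul (deform R Q f) ∘ₗ deform R Q

theorem IsDeformationFunction.npoint_hasTemperateGrowth {s : ℕ} {R : ℝ → ℂ} (hR : IsDeformationFunction R)
    (Q : Matrix (Fin (s + 2)) (Fin (s + 2)) ℝ) (n : ℕ) : (npoint R Q n).HasTemperateGrowth := by
  have hp : ∀ {ι : Type} (t : Finset ι) (G : ι → (Fin n → Vec s) → ℂ),
      (∀ i, (G i).HasTemperateGrowth) → (fun p => ∏ i ∈ t, G i p).HasTemperateGrowth := by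
    intro ι t G hG
    classical
    induction t using Finset.induction_on with
    | empty => simp
    | insert i t hi ih => simpa [Finset.prod_insert hi] using! (hG i).mul ih
  refine hp _ _ fun l => hp _ _ fun r => ?_
  refine hR.hasTemperateGrowth.comp ?_
  have hc : ∀ (l : Fin n) (μ : Fin (s + 2)),
      (fun p : Fin n → Vec s => p l μ).HasTemperateGrowth := fun l μ =>
    ((ContinuousLinearMap.proj (R := ℝ) (φ := fun _ : Fin (s + 2) => ℝ) μ).comp
      (ContinuousLinearMap.proj (R := ℝ) (φ := fun _ : Fin n => Vec s) l)).hasTemperateGrowth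
  have hq : ∀ (l : Fin n) (μ : Fin (s + 2)),
      (fun p : Fin n → Vec s => Q.mulVec (p l) μ).HasTemperateGrowth := fun l μ => by
    simp only [Matrix.mulVec, dotProduct]
    exact Function.HasTemperateGrowth.sum fun i _ => (Function.HasTemperateGrowth.const _).mul (hc l i)
  exact (((hc l 0).mul (hq r 0)).sub (Function.HasTemperateGrowth.sum fun j _ =>
    (hc l j.succ).mul (hq r j.succ))).neg

/-- The deformed field operator `φ_{R,Q}(f)`: the operator with domain
`𝒟 = {Ψ(g) | g in the Borchers-Uhlmann algebra}` and `φ_{R,Q}(f) Ψ(g) = Ψ(f ⊗_ρ g)`. -/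
def field {s : ℕ} (m : ℝ) [Fact (0 < m)] (R : ℝ → ℂ)
    (Q : Matrix (Fin (s + 2)) (Fin (s + 2)) ℝ) (f : BUAlg s) : FockSpace s m →ₗ.[ℂ] FockSpace s m :=
  (LinearMap.range ((fockVec s m).prod (fockVec s m ∘ₗ deformedMul R Q f))).toLinearPMap

/-- A test function `f ∈ 𝒮_1`, regarded as an element of the Borchers-Uhlmann algebra. -/
def oneParticle {s : ℕ} (f : TestFn s 1) : BUAlg s := DirectSum.lof ℂ ℕ (fun n => TestFn s n) 1 f

variable {H : Type*} [NormedAddCommGroup H] [InnerProductSpace ℂ H] 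

/-- A densely defined closable operator whose closure is self-adjoint. -/
def IsEssentiallySelfAdjoint [CompleteSpace H] (T : H →ₗ.[ℂ] H) : Prop :=
  Dense (T.domain : Set H) ∧ T.IsClosable ∧ IsSelfAdjoint T.closure

/-- `ψ` lies in the domain of all powers of `T`, and `∑ₙ tⁿ ‖Tⁿ ψ‖ / n!` converges for all `t`;
here `ξ n = Tⁿ ψ`. -/
def IsEntireAnalyticVector (T : H →ₗ.[ℂ] H) (ψ : H) : Prop :=
  ∃ ξ : ℕ → H, ξ 0 = ψ ∧ (∀ n, (ξ n, ξ (n + 1)) ∈ T.graph) ∧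
    ∀ t : ℝ, Summable fun n => t ^ n / n.factorial * ‖ξ n‖

/-- `U` is the strongly continuous one-parameter group of unitaries `t ↦ e^{itA}` generated by `A`:
the derivative of `t ↦ U t ψ` at `0` exists exactly for `ψ` in the domain of `A`, and equals `i A ψ`. -/
structure IsUnitaryGroupOf [CompleteSpace H] (A : H →ₗ.[ℂ] H) (U : ℝ → H →L[ℂ] H) : Prop where
  unitary : ∀ t, U t ∈ unitary (H →L[ℂ] H)
  map_zero : U 0 = 1
  map_add : ∀ t t', U (t + t') = U t * U t'
  continuous : ∀ ψ, Continuous fun t => U t ψ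
  generator : ∀ ψ χ, (ψ, χ) ∈ A.graph ↔ HasDerivAt (fun t => U t ψ) (Complex.I • χ) 0

end
end DeformedQFT

open DeformedQFT

/-!
The vectors `φ(g) Ω` have a representative in momentum space, a symmetric rapidly decreasing
function of finitely many momenta (`fockRep`). On these representatives the deformed field of a
test function `f` acts as a creation operator plus an annihilation operator, where the particle of
momentum `p` that is created or annihilated acquires a factor `S(p, x) = R(p · Q x)` from each of
the other particles `x` (`fockRep_deformedMul`). This holds because the multiplier of the deformed
product is a product of two-particle factors which is unchanged by the contraction of a pair of
momenta `-q, q`.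

*Self-adjointness.* As `|S| = 1`, the deformed field obeys the bounds of the free one: it is
bounded by the square root of the particle number. Hence `‖φⁿ Ψ‖` grows at most like `Cⁿ √n!`,
every vector of the dense invariant domain is entire analytic (`isEntireSymmetric_deformedMul`),
and Nelson's argument applies. In this situation it is elementary: the exponential series defines
isometries which extend to a unitary group; its generator is the adjoint of the field, hence
symmetric, and a symmetric adjoint coincides with the closure
(`IsEntireSymmetric.isEssentiallySelfAdjoint`). The same bounds make the double series for a
product of two such groups absolutely convergent, so the groups commute as soon as the two fields
commute on the domain (`IsEntireSymmetric.commute`).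

*Locality.* The kernel of `-Q` is the transpose of the kernel of `Q`. For transposed kernels the
two creation operators commute, the two annihilation operators commute, and the mixed terms leave
the difference of two contractions (`fieldFn_comm`): integrals over the mass shell of `f̃(-q)
g̃(q)`, and of `f̃(q) g̃(-q)`, times factors `R(∓ q · Q x)` for the other particles `x`. Without
these factors the two integrals agree by locality of the free field, which is proved by shifting
the rapidity of `q` by `iπ`: this maps `q` to `-q` up to a reflection of the transversal momentum,
and `e^{-i q · w}` stays bounded in between for `w` in the right wedge
(`integral_massShell_eq_neg`). The factors do not matter either: as the Fourier transform of `R`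
is supported in the half line, `R` is a limit of superpositions of `e^{iλa}` with `λ ≥ 0`
(`IsDeformationFunction.exists_approx`), and since `x` lies in the forward cone, `Q x` lies in the
closed right wedge. Inserting `R(q · Q x)` thus amounts to a superposition of translations of the
two test functions further away from each other (`IsWedgeLocal.mul_map`).
-/

namespace DeformedQFT

/-! ### Entire analytic vectors and unitary groups -/

section Nelson

variable {V H : Type*} [AddCommGroup V] [Module ℂ V] [NormedAddCommGroup H]
  [InnerProductSpace ℂ H]

/-- A linear map `M` on a vector space `V` that represents, through `Ψ : V → H` with dense range, a
symmetric operator `Ψ v ↦ Ψ (M v)` all of whose domain consists of entire analytic vectors. -/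
structure IsEntireSymmetric (Ψ : V →ₗ[ℂ] H) (M : V →ₗ[ℂ] V) : Prop where
  dense : DenseRange Ψ
  symm : ∀ u v, inner ℂ (Ψ u) (Ψ (M v)) = inner ℂ (Ψ (M u)) (Ψ v)
  summable : ∀ v (t : ℝ), Summable fun n : ℕ => t ^ n / n.factorial * ‖Ψ ((M ^ n) v)‖

/-- The power series of `e^{itT} Ψ v` for the operator `T : Ψ v ↦ Ψ (M v)`. -/
noncomputable def expSeries (Ψ : V →ₗ[ℂ] H) (M : V →ₗ[ℂ] V) (t : ℝ) (v : V) : H :=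
  ∑' n : ℕ, ((Complex.I * t) ^ n / n.factorial) • Ψ ((M ^ n) v)

/-- The operator with domain `range Ψ` and `Ψ v ↦ Ψ (M v)`. -/
noncomputable def inducedOp (Ψ : V →ₗ[ℂ] H) (M : V →ₗ[ℂ] V) : H →ₗ.[ℂ] H :=
  (LinearMap.range (Ψ.prod (Ψ ∘ₗ M))).toLinearPMap

namespace IsEntireSymmetric

variable {Ψ : V →ₗ[ℂ] H} {M : V →ₗ[ℂ] V}

theorem map_eq_zero (h : IsEntireSymmetric Ψ M) {v : V} (hv : Ψ v = 0) : Ψ (M v) = 0 := by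
  refine h.dense.eq_zero_of_inner_right ℂ fun w => ?_
  rw [h.symm, hv, inner_zero_right]

theorem map_congr (h : IsEntireSymmetric Ψ M) {u v : V} (huv : Ψ u = Ψ v) :
    Ψ (M u) = Ψ (M v) := by
  rw [← sub_eq_zero, ← map_sub, ← map_sub]
  exact h.map_eq_zero (by rw [map_sub, huv, sub_self])

theorem mem_graph_inducedOp (h : IsEntireSymmetric Ψ M) {x : H × H} :
    x ∈ (inducedOp Ψ M).graph ↔ ∃ v, (Ψ v, Ψ (M v)) = x := by
  rw [inducedOp, Submodule.toLinearPMap_graph_eq]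
  · rfl
  · rintro ⟨a, b⟩ ⟨v, hv⟩ ha
    have h1 : Ψ v = a := congrArg Prod.fst hv
    have h2 : Ψ (M v) = b := congrArg Prod.snd hv
    rw [← h2]
    exact h.map_eq_zero (h1.trans ha)

theorem domain_inducedOp (h : IsEntireSymmetric Ψ M) :
    ((inducedOp Ψ M).domain : Set H) = Set.range Ψ := by
  ext x
  rw [SetLike.mem_coe, LinearPMap.mem_domain_iff]
  simp only [h.mem_graph_inducedOp, Prod.mk.injEq, Set.mem_range]
  exact ⟨fun ⟨_, v, hv⟩ => ⟨v, hv.1⟩, fun ⟨v, hv⟩ => ⟨_, v, hv, rfl⟩⟩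

theorem isEntireAnalyticVector (h : IsEntireSymmetric Ψ M) {x : H}
    (hx : x ∈ (inducedOp Ψ M).domain) : IsEntireAnalyticVector (inducedOp Ψ M) x := by
  rw [← SetLike.mem_coe, h.domain_inducedOp] at hx
  obtain ⟨v, rfl⟩ := hx
  refine ⟨fun n => Ψ ((M ^ n) v), rfl, fun n => ?_, fun t => h.summable v t⟩
  exact h.mem_graph_inducedOp.2 ⟨(M ^ n) v, by
    simp only [pow_succ', Module.End.mul_apply]⟩

theorem summable_norm (h : IsEntireSymmetric Ψ M) (v : V) (t : ℝ) :
    Summable fun n : ℕ => ‖((Complex.I * t) ^ n / n.factorial : ℂ) • Ψ ((M ^ n) v)‖ := by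
  refine (h.summable v |t|).congr fun n => ?_
  simp [norm_smul]

theorem expSeries_zero (v : V) : expSeries Ψ M 0 v = Ψ v := by
  rw [expSeries, tsum_eq_single 0 (fun n hn => by simp [hn])]
  simp

theorem dense_domain (h : IsEntireSymmetric Ψ M) : Dense ((inducedOp Ψ M).domain : Set H) := by
  rw [h.domain_inducedOp]
  exact h.dense

variable [CompleteSpace H]

theorem hasSum_expSeries (h : IsEntireSymmetric Ψ M) (v : V) (t : ℝ) :
    HasSum (fun n : ℕ => ((Complex.I * t) ^ n / n.factorial : ℂ) • Ψ ((M ^ n) v))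
      (expSeries Ψ M t v) := (h.summable_norm v t).of_norm.hasSum

theorem inner_expSeries_right (h : IsEntireSymmetric Ψ M) (x : H) (v : V) (t : ℝ) :
    inner ℂ x (expSeries Ψ M t v) =
      ∑' n : ℕ, ((Complex.I * t) ^ n / n.factorial : ℂ) * inner ℂ x (Ψ ((M ^ n) v)) := by
  have := (innerSL ℂ x).hasSum (h.hasSum_expSeries v t)
  simp only [innerSL_apply_apply, inner_smul_right] at this
  exact this.tsum_eq.symm

theorem expSeries_add (h : IsEntireSymmetric Ψ M) (t : ℝ) (u v : V) :
    expSeries Ψ M t (u + v) = expSeries Ψ M t u + expSeries Ψ M t v := by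
  rw [← ((h.hasSum_expSeries u t).add (h.hasSum_expSeries v t)).tsum_eq, expSeries]
  simp only [map_add, smul_add]

theorem expSeries_smul (h : IsEntireSymmetric Ψ M) (t : ℝ) (c : ℂ) (v : V) :
    expSeries Ψ M t (c • v) = c • expSeries Ψ M t v := by
  rw [← ((h.hasSum_expSeries v t).const_smul c).tsum_eq, expSeries]
  simp only [map_smul, smul_comm c]

theorem hasDerivAt_expSeries (h : IsEntireSymmetric Ψ M) (v : V) (t : ℝ) :
    HasDerivAt (fun t => expSeries Ψ M t v) (Complex.I • expSeries Ψ M t (M v)) t := by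
  have hsplit : ∀ t, expSeries Ψ M t v = Ψ v + ∑' n : ℕ,
      ((Complex.I * t) ^ (n + 1) / (n + 1).factorial : ℂ) • Ψ ((M ^ n) (M v)) := fun t => by
    rw [expSeries, (h.summable_norm v t).of_norm.tsum_eq_zero_add]
    simp [pow_succ M]
  have hd : HasDerivAt (fun t : ℝ => ∑' n : ℕ,
      ((Complex.I * t) ^ (n + 1) / (n + 1).factorial : ℂ) • Ψ ((M ^ n) (M v)))
      (∑' n : ℕ, Complex.I • ((Complex.I * t) ^ n / n.factorial : ℂ) • Ψ ((M ^ n) (M v))) t := by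
    refine hasDerivAt_tsum_of_isPreconnected
      (g := fun (n : ℕ) (t : ℝ) =>
        ((Complex.I * t) ^ (n + 1) / (n + 1).factorial : ℂ) • Ψ ((M ^ n) (M v)))
      (g' := fun (n : ℕ) (t : ℝ) =>
        Complex.I • ((Complex.I * t) ^ n / n.factorial : ℂ) • Ψ ((M ^ n) (M v)))
      (t := Metric.ball (0 : ℝ) (|t| + 1)) (y₀ := (0 : ℝ)) (y := t)
      (h.summable (M v) (|t| + 1)) Metric.isOpen_ball
      Metric.isPreconnected_ball (fun n y _ => ?_) (fun n y hy => ?_)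
      (Metric.mem_ball_self (by positivity)) ?_ (by simp)
    · have h1 : HasDerivAt (fun y : ℝ => (Complex.I * y : ℂ)) Complex.I y := by
        simpa using (Complex.ofRealCLM.hasDerivAt (x := y)).const_mul Complex.I
      have h2 := ((h1.pow (n + 1)).div_const ((n + 1).factorial : ℂ)).smul_const (Ψ ((M ^ n) (M v)))
      refine h2.congr_deriv ?_
      rw [smul_smul]
      congr 1
      have : ((n + 1 : ℕ) : ℂ) ≠ 0 := by exact_mod_cast n.succ_ne_zero
      have h3 : (n.factorial : ℂ) ≠ 0 := by exact_mod_cast n.factorial_ne_zero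
      rw [Nat.factorial_succ, Nat.cast_mul, Nat.add_sub_cancel]
      field_simp
    · have hy' : |y| ≤ |t| + 1 := le_of_lt (by simpa using hy)
      simp only [norm_smul, Complex.norm_I, one_mul, norm_div, norm_pow, norm_mul,
        Complex.norm_real, Complex.norm_natCast, Real.norm_eq_abs]
      gcongr
    · simp
  rw [funext hsplit]
  refine (hd.const_add _).congr_deriv ?_
  exact ((h.hasSum_expSeries (M v) t).const_smul Complex.I).tsum_eq

/-- A pair `(x, y)` in the graph of the adjoint of `Ψ v ↦ Ψ (M v)` pairs with the power series as if
`M` were symmetric on it. -/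
theorem inner_expSeries_of_adjoint (h : IsEntireSymmetric Ψ M) {x y : H}
    (hxy : ∀ v, inner ℂ y (Ψ v) = inner ℂ x (Ψ (M v))) (t : ℝ) (v : V) :
    inner ℂ y (expSeries Ψ M t v) = inner ℂ x (expSeries Ψ M t (M v)) := by
  rw [h.inner_expSeries_right, h.inner_expSeries_right]
  refine tsum_congr fun n => ?_
  rw [hxy, ← Module.End.mul_apply, ← Module.End.mul_apply, ← pow_succ, ← pow_succ']

theorem inner_expSeries_map (h : IsEntireSymmetric Ψ M) (a b : ℝ) (u v : V) :
    inner ℂ (expSeries Ψ M a (M u)) (expSeries Ψ M b v) =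
      inner ℂ (expSeries Ψ M a u) (expSeries Ψ M b (M v)) := by
  refine h.inner_expSeries_of_adjoint (fun w => ?_) b v
  rw [← inner_conj_symm, ← inner_conj_symm (expSeries Ψ M a u)]
  congr 1
  exact (h.inner_expSeries_of_adjoint (fun w' => (h.symm w w').symm) a u).symm

/-- The pairing of two of the power series only depends on the difference of the times: its
derivative under a common translation vanishes because `M` is symmetric. -/
theorem inner_expSeries (h : IsEntireSymmetric Ψ M) (a b : ℝ) (u v : V) :
    inner ℂ (expSeries Ψ M a u) (expSeries Ψ M b v) = inner ℂ (Ψ u) (expSeries Ψ M (b - a) v) := by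
  have hd : ∀ r : ℝ, HasDerivAt (fun r : ℝ => inner ℂ (expSeries Ψ M (a + r) u)
      (expSeries Ψ M (b + r) v)) 0 r := fun r => by
    have h1 := ((h.hasDerivAt_expSeries u (a + r)).comp_const_add a r).inner ℂ
      ((h.hasDerivAt_expSeries v (b + r)).comp_const_add b r)
    refine h1.congr_deriv ?_
    rw [inner_smul_right, inner_smul_left, h.inner_expSeries_map]
    simp
  have := is_const_of_deriv_eq_zero (fun r => (hd r).differentiableAt) (fun r => (hd r).deriv) 0 (-a)
  simpa [expSeries_zero, sub_eq_add_neg] using this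

theorem norm_expSeries (h : IsEntireSymmetric Ψ M) (t : ℝ) (v : V) :
    ‖expSeries Ψ M t v‖ = ‖Ψ v‖ := by
  have := h.inner_expSeries t t v v
  rw [sub_self, expSeries_zero, inner_self_eq_norm_sq_to_K, inner_self_eq_norm_sq_to_K] at this
  have h2 : ‖expSeries Ψ M t v‖ ^ 2 = ‖Ψ v‖ ^ 2 := by exact_mod_cast this
  exact (pow_left_inj₀ (norm_nonneg _) (norm_nonneg _) two_ne_zero).1 h2

/-- The power series `expSeries` as a linear map. -/
noncomputable def expLinear (h : IsEntireSymmetric Ψ M) (t : ℝ) : V →ₗ[ℂ] H where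
  toFun := expSeries Ψ M t
  map_add' := h.expSeries_add t
  map_smul' := h.expSeries_smul t

/-- The unitary `e^{itT}`: the continuous extension of the power series to all of `H`. -/
noncomputable def expGroup (h : IsEntireSymmetric Ψ M) (t : ℝ) : H →L[ℂ] H :=
  (h.expLinear t).extendOfNorm Ψ

theorem expGroup_apply (h : IsEntireSymmetric Ψ M) (t : ℝ) (v : V) :
    h.expGroup t (Ψ v) = expSeries Ψ M t v :=
  LinearMap.extendOfNorm_eq h.dense ⟨1, fun v => by
    rw [one_mul]; exact (h.norm_expSeries t v).le⟩ v

theorem inner_expGroup_left (h : IsEntireSymmetric Ψ M) (t : ℝ) (x y : H) :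
    inner ℂ (h.expGroup (-t) x) y = inner ℂ x (h.expGroup t y) := by
  have h1 : ∀ u v, inner ℂ (h.expGroup (-t) (Ψ u)) (Ψ v) = inner ℂ (Ψ u) (h.expGroup t (Ψ v)) :=
    fun u v => by
      rw [h.expGroup_apply, h.expGroup_apply, ← expSeries_zero (M := M) v, h.inner_expSeries]
      simp
  have h2 : ∀ u, inner ℂ (h.expGroup (-t) (Ψ u)) y = inner ℂ (Ψ u) (h.expGroup t y) := fun u =>
    h.dense.induction_on (p := fun y => inner ℂ (h.expGroup (-t) (Ψ u)) y =
      inner ℂ (Ψ u) (h.expGroup t y)) y (isClosed_eq (by fun_prop) (by fun_prop)) (h1 u)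
  exact h.dense.induction_on (p := fun x => inner ℂ (h.expGroup (-t) x) y =
    inner ℂ x (h.expGroup t y)) x (isClosed_eq (by fun_prop) (by fun_prop)) h2

theorem norm_expGroup (h : IsEntireSymmetric Ψ M) (t : ℝ) (x : H) : ‖h.expGroup t x‖ = ‖x‖ :=
  h.dense.induction_on (p := fun x => ‖h.expGroup t x‖ = ‖x‖) x
    (isClosed_eq (by fun_prop) (by fun_prop)) fun v => by rw [h.expGroup_apply, h.norm_expSeries]

theorem expGroup_zero (h : IsEntireSymmetric Ψ M) : h.expGroup 0 = 1 := by
  ext x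
  exact h.dense.induction_on (p := fun x => h.expGroup 0 x = x) x
    (isClosed_eq (by fun_prop) (by fun_prop)) fun v => by rw [h.expGroup_apply, expSeries_zero]

theorem expGroup_add (h : IsEntireSymmetric Ψ M) (t t' : ℝ) :
    h.expGroup (t + t') = h.expGroup t * h.expGroup t' := by
  ext x
  refine h.dense.induction_on (p := fun x => h.expGroup (t + t') x = h.expGroup t (h.expGroup t' x)) x
    (isClosed_eq (by fun_prop) (by fun_prop)) fun v => ?_
  refine h.dense.eq_of_inner_right ℂ fun w => ?_
  rw [← h.inner_expGroup_left, h.expGroup_apply, h.expGroup_apply,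
    ← h.inner_expGroup_left, h.expGroup_apply, h.inner_expSeries, ← expSeries_zero (M := M) v,
    h.inner_expSeries]
  congr 2
  ring

theorem expGroup_mem_unitary (h : IsEntireSymmetric Ψ M) (t : ℝ) :
    h.expGroup t ∈ unitary (H →L[ℂ] H) := by
  have hs : star (h.expGroup t) = h.expGroup (-t) := by
    rw [ContinuousLinearMap.star_eq_adjoint, eq_comm, ContinuousLinearMap.eq_adjoint_iff]
    exact h.inner_expGroup_left t
  rw [Unitary.mem_iff, hs, ← h.expGroup_add, ← h.expGroup_add]
  simp [h.expGroup_zero]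

theorem continuous_expGroup (h : IsEntireSymmetric Ψ M) (x : H) :
    Continuous fun t => h.expGroup t x := by
  rw [Metric.continuous_iff]
  intro t ε hε
  obtain ⟨v, hv⟩ := h.dense.exists_dist_lt x (show 0 < ε / 3 by positivity)
  have hc : Continuous fun t => expSeries Ψ M t v :=
    continuous_iff_continuousAt.2 fun t => (h.hasDerivAt_expSeries v t).continuousAt
  obtain ⟨δ, hδ, H⟩ := Metric.continuous_iff.1 hc t (ε / 3) (by positivity)
  refine ⟨δ, hδ, fun r hr => ?_⟩
  have hn : ∀ r, dist (h.expGroup r x) (expSeries Ψ M r v) < ε / 3 := fun r => by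
    rw [← h.expGroup_apply, dist_eq_norm, ← map_sub, h.norm_expGroup, ← dist_eq_norm]
    exact hv
  have := dist_triangle4 (h.expGroup r x) (expSeries Ψ M r v) (expSeries Ψ M t v) (h.expGroup t x)
  have h3 := hn t
  rw [dist_comm] at h3
  linarith [hn r, H r hr]

/-- The generator of the group is the adjoint of the operator `Ψ v ↦ Ψ (M v)`. -/
theorem hasDerivAt_expGroup_iff (h : IsEntireSymmetric Ψ M) (x y : H) :
    HasDerivAt (fun t => h.expGroup t x) (Complex.I • y) 0 ↔
      ∀ v, inner ℂ y (Ψ v) = inner ℂ x (Ψ (M v)) := by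
  constructor
  · intro hd v
    have h1 := hd.inner ℂ (h.hasDerivAt_expSeries v 0)
    have h2 : (fun t => inner ℂ (h.expGroup t x) (expSeries Ψ M t v)) = fun _ => inner ℂ x (Ψ v) := by
      ext t
      rw [← neg_neg t, h.inner_expGroup_left, ← h.expGroup_apply, ← mul_apply_eq_comp,
        ← h.expGroup_add]
      simp [h.expGroup_zero]
    rw [h2] at h1
    have h3 := h1.unique (hasDerivAt_const 0 _)
    rw [inner_smul_right, inner_smul_left, expSeries_zero, expSeries_zero, h.expGroup_zero,
      one_apply_eq_self, Complex.conj_I] at h3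
    have h4 : Complex.I * (inner ℂ x (Ψ (M v)) - inner ℂ y (Ψ v)) = 0 := by rw [← h3]; ring
    exact (sub_eq_zero.1 ((mul_eq_zero.1 h4).resolve_left Complex.I_ne_zero)).symm
  · intro hxy
    -- the integral equation `U_t x = x + i ∫₀ᵗ U_r y dr`, tested on the dense range of `Ψ`
    have key : ∀ t, h.expGroup t x = x + Complex.I • ∫ r in (0 : ℝ)..t, h.expGroup r y := by
      intro t
      refine h.dense.eq_of_inner_right ℂ fun v => ?_
      have hy := h.continuous_expGroup y
      have hd1 : ∀ r, HasDerivAt (fun r => inner ℂ (Ψ v) (h.expGroup r x))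
          (Complex.I * inner ℂ (Ψ v) (h.expGroup r y)) r := fun r => by
        have h1 : ∀ r z, inner ℂ (Ψ v) (h.expGroup r z) = inner ℂ (expSeries Ψ M (-r) v) z :=
          fun r z => by rw [← h.inner_expGroup_left, h.expGroup_apply]
        simp only [h1]
        have h2 := ((h.hasDerivAt_expSeries v (-r)).scomp r (hasDerivAt_neg r)).inner ℂ
          (hasDerivAt_const r x)
        refine h2.congr_deriv ?_
        have h3 := h.inner_expSeries_of_adjoint hxy (-r) v
        rw [← inner_conj_symm _ y, h3, inner_conj_symm]
        simp [inner_smul_left]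
      have hd2 : ∀ r, HasDerivAt (fun r => inner ℂ (Ψ v)
          (x + Complex.I • ∫ r in (0 : ℝ)..r, h.expGroup r y))
          (Complex.I * inner ℂ (Ψ v) (h.expGroup r y)) r := fun r => by
        have h1 := (hy.integral_hasStrictDerivAt 0 r).hasDerivAt
        have h2 := (hasDerivAt_const r (Ψ v)).inner ℂ ((h1.const_smul Complex.I).const_add x)
        refine h2.congr_deriv ?_
        simp [inner_smul_right]
      have h0 := is_const_of_deriv_eq_zero (fun r => ((hd1 r).sub (hd2 r)).differentiableAt)
        (fun r => by rw [((hd1 r).sub (hd2 r)).deriv, sub_self]) t 0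
      simpa [h.expGroup_zero, sub_eq_zero, inner_add_right, inner_smul_right] using h0
    rw [funext key]
    have h1 := ((h.continuous_expGroup y).integral_hasStrictDerivAt 0 0).hasDerivAt
    simpa [h.expGroup_zero] using (h1.const_smul Complex.I).const_add x

/-- The adjoint of `Ψ v ↦ Ψ (M v)` is symmetric, being the generator of a unitary group. -/
theorem inner_symm_of_adjoint (h : IsEntireSymmetric Ψ M) {x y x' y' : H}
    (hxy : ∀ v, inner ℂ y (Ψ v) = inner ℂ x (Ψ (M v)))
    (hxy' : ∀ v, inner ℂ y' (Ψ v) = inner ℂ x' (Ψ (M v))) : inner ℂ y x' = inner ℂ x y' := by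
  rw [← h.hasDerivAt_expGroup_iff] at hxy hxy'
  have h1 := hxy.inner ℂ hxy'
  have h2 : (fun t => inner ℂ (h.expGroup t x) (h.expGroup t x')) = fun _ => inner ℂ x x' := by
    ext t
    rw [← neg_neg t, h.inner_expGroup_left, ← mul_apply_eq_comp, ← h.expGroup_add]
    simp [h.expGroup_zero]
  rw [h2] at h1
  have h3 := h1.unique (hasDerivAt_const 0 _)
  rw [inner_smul_right, inner_smul_left, h.expGroup_zero, one_apply_eq_self,
    one_apply_eq_self, Complex.conj_I] at h3
  have h4 : Complex.I * (inner ℂ x y' - inner ℂ y x') = 0 := by rw [← h3]; ring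
  exact (sub_eq_zero.1 ((mul_eq_zero.1 h4).resolve_left Complex.I_ne_zero)).symm

/-- The closure of the graph of `Ψ v ↦ Ψ (M v)` is the graph of its adjoint: a vector in the latter
that is orthogonal to the former vanishes, because the adjoint is symmetric. -/
theorem mem_closure_graph_iff (h : IsEntireSymmetric Ψ M) (x y : H) :
    (x, y) ∈ (inducedOp Ψ M).graph.topologicalClosure ↔
      ∀ v, inner ℂ y (Ψ v) = inner ℂ x (Ψ (M v)) := by
  have hsub : ∀ z : H × H, z ∈ (inducedOp Ψ M).graph.topologicalClosure →
      ∀ v, inner ℂ z.2 (Ψ v) = inner ℂ z.1 (Ψ (M v)) := by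
    intro z hz v
    have hcl : IsClosed {z : H × H | inner ℂ z.2 (Ψ v) = inner ℂ z.1 (Ψ (M v))} :=
      isClosed_eq (by fun_prop) (by fun_prop)
    refine closure_minimal ?_ hcl hz
    intro w hw
    obtain ⟨u, rfl⟩ := h.mem_graph_inducedOp.1 hw
    exact (h.symm u v).symm
  refine ⟨fun hz => hsub _ hz, fun hxy => ?_⟩
  -- `H × H` carries the maximum norm; orthogonal decompositions are taken in the `ℓ²` product
  let e := WithLp.prodContinuousLinearEquiv 2 ℂ H H
  let K : Submodule ℂ (WithLp 2 (H × H)) :=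
    (inducedOp Ψ M).graph.topologicalClosure.comap e.toLinearEquiv.toLinearMap
  have hK : IsClosed (K : Set (WithLp 2 (H × H))) :=
    ((inducedOp Ψ M).graph.isClosed_topologicalClosure).preimage e.continuous
  have : CompleteSpace K := hK.completeSpace_coe
  obtain ⟨k, hk, w, hw, hkw⟩ := K.exists_add_mem_mem_orthogonal (e.symm (x, y))
  have hk' : e k ∈ (inducedOp Ψ M).graph.topologicalClosure := hk
  have hx : x = (e k).1 + (e w).1 := by
    have := congrArg (fun z => (e z).1) hkw
    simpa using this
  have hy : y = (e k).2 + (e w).2 := by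
    have := congrArg (fun z => (e z).2) hkw
    simpa using this
  have hw1 : ∀ v, inner ℂ (e w).2 (Ψ v) = inner ℂ (e w).1 (Ψ (M v)) := fun v => by
    have h1 := hxy v
    rw [hx, hy, inner_add_left, inner_add_left, hsub _ hk' v] at h1
    exact add_left_cancel h1
  have hw2 : ∀ v, inner ℂ (-(e w).1) (Ψ v) = inner ℂ (e w).2 (Ψ (M v)) := fun v => by
    have h1 : inner ℂ w (e.symm (Ψ v, Ψ (M v))) = 0 := by
      refine Submodule.inner_left_of_mem_orthogonal (K := K) ?_ hw
      change e (e.symm (Ψ v, Ψ (M v))) ∈ (inducedOp Ψ M).graph.topologicalClosure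
      rw [e.apply_symm_apply]
      exact Submodule.le_topologicalClosure _ (h.mem_graph_inducedOp.2 ⟨v, rfl⟩)
    rw [WithLp.prod_inner_apply] at h1
    rw [inner_neg_left]
    have h2 : inner ℂ (e w).1 (Ψ v) + inner ℂ (e w).2 (Ψ (M v)) = 0 := h1
    linear_combination -h2
  have h0 := h.inner_symm_of_adjoint hw1 hw2
  rw [inner_neg_right, inner_self_eq_norm_sq_to_K, inner_self_eq_norm_sq_to_K] at h0
  have h00 : ‖(e w).2‖ ^ 2 = -‖(e w).1‖ ^ 2 := by exact_mod_cast h0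
  have hw10 : (e w).1 = 0 := norm_eq_zero.1 (by nlinarith [sq_nonneg ‖(e w).1‖, sq_nonneg ‖(e w).2‖])
  have hw20 : (e w).2 = 0 := norm_eq_zero.1 (by nlinarith [sq_nonneg ‖(e w).1‖, sq_nonneg ‖(e w).2‖])
  rw [hx, hy, hw10, hw20, add_zero, add_zero]
  exact hk'

theorem isClosable (h : IsEntireSymmetric Ψ M) : (inducedOp Ψ M).IsClosable := by
  refine ⟨(inducedOp Ψ M).graph.topologicalClosure.toLinearPMap, ?_⟩
  rw [Submodule.toLinearPMap_graph_eq]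
  rintro ⟨a, b⟩ hab (rfl : a = 0)
  rw [h.mem_closure_graph_iff] at hab
  refine h.dense.eq_zero_of_inner_left ℂ fun v => ?_
  rw [hab v, inner_zero_left]

theorem mem_graph_closure_iff (h : IsEntireSymmetric Ψ M) (x y : H) :
    (x, y) ∈ (inducedOp Ψ M).closure.graph ↔ ∀ v, inner ℂ y (Ψ v) = inner ℂ x (Ψ (M v)) := by
  rw [← h.isClosable.graph_closure_eq_closure_graph, h.mem_closure_graph_iff]

theorem mem_graph_closure (h : IsEntireSymmetric Ψ M) (v : V) :
    (Ψ v, Ψ (M v)) ∈ (inducedOp Ψ M).closure.graph :=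
  (h.mem_graph_closure_iff _ _).2 fun w => (h.symm v w).symm

/-- **Nelson's theorem**, in the case of a dense invariant domain of entire analytic vectors. -/
theorem isEssentiallySelfAdjoint (h : IsEntireSymmetric Ψ M) :
    IsEssentiallySelfAdjoint (inducedOp Ψ M) := by
  refine ⟨h.dense_domain, h.isClosable, ?_⟩
  have hd : Dense ((inducedOp Ψ M).closure.domain : Set H) :=
    h.dense_domain.mono ((inducedOp Ψ M).le_closure).1
  rw [LinearPMap.isSelfAdjoint_def]
  refine LinearPMap.eq_of_eq_graph ?_
  rw [LinearPMap.adjoint_graph_eq_graph_adjoint hd]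
  ext ⟨x, y⟩
  rw [Submodule.mem_adjoint_iff, h.mem_graph_closure_iff]
  constructor
  · intro hxy v
    have := hxy _ _ (h.mem_graph_closure v)
    rw [← inner_conj_symm, ← inner_conj_symm x, ← sub_eq_zero.1 this]
  · intro hxy a b hab
    rw [h.mem_graph_closure_iff] at hab
    rw [sub_eq_zero]
    exact h.inner_symm_of_adjoint hab hxy

theorem isUnitaryGroupOf (h : IsEntireSymmetric Ψ M) :
    IsUnitaryGroupOf (inducedOp Ψ M).closure h.expGroup where
  unitary := h.expGroup_mem_unitary
  map_zero := h.expGroup_zero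
  map_add := h.expGroup_add
  continuous := h.continuous_expGroup
  generator x y := by rw [h.mem_graph_closure_iff, h.hasDerivAt_expGroup_iff]

/-- Every unitary group generated by the closure is given by the power series on `range Ψ`. -/
theorem unitaryGroup_apply (h : IsEntireSymmetric Ψ M) {U : ℝ → H →L[ℂ] H}
    (hU : IsUnitaryGroupOf (inducedOp Ψ M).closure U) (t : ℝ) (v : V) :
    U t (Ψ v) = expSeries Ψ M t v := by
  have hnorm : ‖U t (Ψ v)‖ = ‖Ψ v‖ := Unitary.norm_map (⟨U t, hU.unitary t⟩ : unitary (H →L[ℂ] H)) _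
  have hd0 := (hU.generator _ _).1 (h.mem_graph_closure v)
  have hd : ∀ r, HasDerivAt (fun r => U r (Ψ v)) (Complex.I • U r (Ψ (M v))) r := fun r => by
    have h1 := (((U r).restrictScalars ℝ).hasFDerivAt.comp_hasDerivAt 0 hd0)
    have h2 : HasDerivAt (fun q => U r (U q (Ψ v))) (Complex.I • U r (Ψ (M v))) (r - r) := by
      rw [sub_self]; simpa [Function.comp_def] using h1
    refine (h2.comp_sub_const r r).congr_of_eventuallyEq (Eventually.of_forall fun q => ?_)
    change U q (Ψ v) = U r (U (q - r) (Ψ v))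
    rw [← mul_apply_eq_comp, ← hU.map_add, add_sub_cancel]
  have hadj : ∀ r w, inner ℂ (U r (Ψ (M v))) (Ψ w) = inner ℂ (U r (Ψ v)) (Ψ (M w)) := by
    intro r
    refine (h.mem_graph_closure_iff _ _).1 ((hU.generator _ _).2 ?_)
    have h1 := (((U r).restrictScalars ℝ).hasFDerivAt.comp_hasDerivAt 0 hd0)
    refine HasDerivAt.congr_of_eventuallyEq (f := fun q => U r (U q (Ψ v))) ?_
      (Eventually.of_forall fun q => ?_)
    · simpa [Function.comp_def] using h1
    · change U q _ = U r _
      rw [← mul_apply_eq_comp, ← hU.map_add, add_comm, hU.map_add,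
        mul_apply_eq_comp]
  -- the pairing of `U_t Ψ v` with the power series is constant in `t`, and both vectors have norm
  -- `‖Ψ v‖`, so they coincide
  have hconst : inner ℂ (U t (Ψ v)) (expSeries Ψ M t v) = inner ℂ (Ψ v) (Ψ v) := by
    have hd' : ∀ r : ℝ, HasDerivAt (fun r => inner ℂ (U r (Ψ v)) (expSeries Ψ M r v)) 0 r := fun r => by
      refine ((hd r).inner ℂ (h.hasDerivAt_expSeries v r)).congr_deriv ?_
      rw [inner_smul_right, inner_smul_left, h.inner_expSeries_of_adjoint (hadj r)]
      simp
    have := is_const_of_deriv_eq_zero (fun r => (hd' r).differentiableAt) (fun r => (hd' r).deriv) t 0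
    simpa [hU.map_zero, expSeries_zero] using this
  rw [← sub_eq_zero, ← norm_eq_zero, ← sq_eq_zero_iff, norm_sub_sq (𝕜 := ℂ), hconst, hnorm,
    h.norm_expSeries, inner_self_eq_norm_sq_to_K]
  norm_cast
  ring

end IsEntireSymmetric

/-- The unitary groups commute if the operators commute on their common invariant domain and the
double power series of `e^{itT} e^{it'T'} Ψ v` converges absolutely. -/
theorem IsEntireSymmetric.commute [CompleteSpace H] {Ψ : V →ₗ[ℂ] H} {M N : V →ₗ[ℂ] V}
    (hM : IsEntireSymmetric Ψ M) (hN : IsEntireSymmetric Ψ N)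
    (hcomm : ∀ v, Ψ (M (N v)) = Ψ (N (M v)))
    (hsum : ∀ v (t t' : ℝ), Summable fun a : ℕ × ℕ =>
      |t| ^ a.1 / a.1.factorial * (|t'| ^ a.2 / a.2.factorial) * ‖Ψ ((M ^ a.1) ((N ^ a.2) v))‖)
    {U U' : ℝ → H →L[ℂ] H} (hU : IsUnitaryGroupOf (inducedOp Ψ M).closure U)
    (hU' : IsUnitaryGroupOf (inducedOp Ψ N).closure U') (t t' : ℝ) : U t * U' t' = U' t' * U t := by
  have h1 : ∀ n v, Ψ ((M ^ n) (N v)) = Ψ (N ((M ^ n) v)) := by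
    intro n
    induction n with
    | zero => intro v; rfl
    | succ n ih =>
      intro v
      rw [pow_succ', Module.End.mul_apply, Module.End.mul_apply, hM.map_congr (ih v), hcomm]
  have h2 : ∀ n k v, Ψ ((M ^ n) ((N ^ k) v)) = Ψ ((N ^ k) ((M ^ n) v)) := by
    intro n k
    induction k with
    | zero => intro v; rfl
    | succ k ih =>
      intro v
      rw [pow_succ', Module.End.mul_apply, Module.End.mul_apply, h1, hN.map_congr (ih v)]
  ext x
  refine hM.dense.induction_on (p := fun x => U t (U' t' x) = U' t' (U t x)) x
    (isClosed_eq (by fun_prop) (by fun_prop)) fun v => ?_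
  have hL := (U t).hasSum (hN.hasSum_expSeries v t')
  have hR := (U' t').hasSum (hM.hasSum_expSeries v t)
  simp only [map_smul, hM.unitaryGroup_apply hU, hN.unitaryGroup_apply hU'] at hL hR
  rw [hN.unitaryGroup_apply hU', hM.unitaryGroup_apply hU, ← hL.tsum_eq, ← hR.tsum_eq]
  have hs : Summable (Function.uncurry fun n k : ℕ =>
      ((Complex.I * t) ^ n / n.factorial : ℂ) • ((Complex.I * t') ^ k / k.factorial : ℂ) •
        Ψ ((M ^ n) ((N ^ k) v))) := by
    refine Summable.of_norm ((hsum v t t').congr fun a => ?_)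
    simp [Function.uncurry, norm_smul, mul_assoc]
  have e1 : ∀ k : ℕ, ((Complex.I * t') ^ k / k.factorial : ℂ) • expSeries Ψ M t ((N ^ k) v) =
      ∑' n : ℕ, ((Complex.I * t) ^ n / n.factorial : ℂ) • ((Complex.I * t') ^ k / k.factorial : ℂ) •
        Ψ ((M ^ n) ((N ^ k) v)) := fun k => by
    rw [← ((hM.hasSum_expSeries ((N ^ k) v) t).const_smul _).tsum_eq]
    exact tsum_congr fun n => smul_comm _ _ _
  have e2 : ∀ n : ℕ, ((Complex.I * t) ^ n / n.factorial : ℂ) • expSeries Ψ N t' ((M ^ n) v) =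
      ∑' k : ℕ, ((Complex.I * t) ^ n / n.factorial : ℂ) • ((Complex.I * t') ^ k / k.factorial : ℂ) •
        Ψ ((M ^ n) ((N ^ k) v)) := fun n => by
    rw [← ((hN.hasSum_expSeries ((M ^ n) v) t').const_smul _).tsum_eq]
    exact tsum_congr fun k => by rw [h2]
  rw [tsum_congr e1, tsum_congr e2]
  exact hs.tsum_comm

end Nelson

variable {s : ℕ}

/-! ### Momentum space form of the deformed product -/

theorem measurePreserving_append (X : Type*) [MeasureSpace X] [SigmaFinite (volume : Measure X)]
    (k l : ℕ) : MeasurePreserving (fun z : (Fin k → X) × (Fin l → X) => Fin.append z.1 z.2) := by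
  have hm : Measurable fun z : (Fin k → X) × (Fin l → X) => Fin.append z.1 z.2 := by
    refine measurable_pi_lambda _ fun i => ?_
    refine Fin.addCases (fun j => ?_) (fun j => ?_) i
    · simp only [Fin.append_left]; fun_prop
    · simp only [Fin.append_right]; fun_prop
  refine ⟨hm, ?_⟩
  refine (Measure.pi_eq fun t ht => ?_).symm
  rw [Measure.map_apply hm (MeasurableSet.univ_pi ht)]
  have : (fun z : (Fin k → X) × (Fin l → X) => Fin.append z.1 z.2) ⁻¹' Set.univ.pi t =
      (Set.univ.pi fun i => t (Fin.castAdd l i)) ×ˢ (Set.univ.pi fun i => t (Fin.natAdd k i)) := by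
    ext z
    simp only [Set.mem_preimage, Set.mem_pi, Set.mem_univ, true_implies, Set.mem_prod]
    refine ⟨fun h => ⟨fun i => by simpa using h (Fin.castAdd l i),
      fun i => by simpa using h (Fin.natAdd k i)⟩, fun h i => ?_⟩
    refine Fin.addCases (fun j => ?_) (fun j => ?_) i
    · simpa using h.1 j
    · simpa using h.2 j
  rw [this, Measure.volume_eq_prod, Measure.prod_prod, volume_pi_pi, volume_pi_pi, Fin.prod_univ_add]

theorem momentum_tensor {k l : ℕ} (f : TestFn s k) (g : TestFn s l) (p : Fin (k + l) → Vec s) :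
    momentum s (k + l) (tensor s k l f g) p = momentum s k f (fun i => p (Fin.castAdd l i)) *
      momentum s l g (fun i => p (Fin.natAdd k i)) := by
  have hemb : MeasurableEmbedding fun z : (Fin k → Vec s) × (Fin l → Vec s) =>
      (Fin.append z.1 z.2 : Fin (k + l) → Vec s) := by
    refine Continuous.measurableEmbedding ?_ ?_
    · refine continuous_pi fun i => ?_
      refine Fin.addCases (fun j => ?_) (fun j => ?_) i
      · simp only [Fin.append_left]; fun_prop
      · simp only [Fin.append_right]; fun_prop
    · intro z z' hz
      refine Prod.ext (funext fun i => ?_) (funext fun i => ?_)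
      · simpa using congrFun hz (Fin.castAdd l i)
      · simpa using congrFun hz (Fin.natAdd k i)
  rw [momentum_apply, momentum_apply, momentum_apply,
    ← (measurePreserving_append (Vec s) k l).integral_comp hemb, mul_mul_mul_comm,
    ← integral_prod_mul, ← Complex.ofReal_mul, ← Real.rpow_add (by positivity)]
  congr 3
  · push_cast; ring
  · ext z
    simp only [tensor_apply, Fin.append_left, Fin.append_right, Fin.sum_univ_add]
    push_cast
    rw [mul_add, Complex.exp_add]
    ring

/-- The Fourier transform of a one particle test function, as a function of one momentum. -/
noncomputable def oneMomentum (f : TestFn s 1) (p : Vec s) : ℂ := momentum s 1 f fun _ => p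

/-- The exchange kernel `R(p · Q x)`. -/
noncomputable def exchange (R : ℝ → ℂ) (Q : Matrix (Fin (s + 2)) (Fin (s + 2)) ℝ) (p x : Vec s) : ℂ :=
  R (mink p (Q.mulVec x))

theorem IsDeformationFunction.mul_map_neg {R : ℝ → ℂ} (hR : IsDeformationFunction R) (a : ℝ) :
    R a * R (-a) = 1 := by
  rw [← hR.conj_eq, mul_comm]; exact hR.conj_mul_self a

theorem IsDeformationFunction.inv_map {R : ℝ → ℂ} (hR : IsDeformationFunction R) (a : ℝ) :
    (R a)⁻¹ = R (-a) := inv_eq_of_mul_eq_one_right (hR.mul_map_neg a)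

theorem mink_neg_right (x y : Vec s) : mink x (-y) = -mink x y := by
  simp [mink, Finset.sum_neg_distrib]; ring

theorem mink_neg_left (x y : Vec s) : mink (-x) y = -mink x y := by
  simp [mink, Finset.sum_neg_distrib]; ring

theorem mink_comm (x y : Vec s) : mink x y = mink y x := by
  simp [mink, mul_comm]

theorem IsDeformationFunction.npoint_inv {R : ℝ → ℂ} (hR : IsDeformationFunction R)
    (Q : Matrix (Fin (s + 2)) (Fin (s + 2)) ℝ) (n : ℕ) (p : Fin n → Vec s) :
    (npoint R Q n p)⁻¹ = npoint R (-Q) n p := by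
  simp only [npoint, ← Finset.prod_inv_distrib, hR.inv_map, Matrix.neg_mulVec, mink_neg_right]

theorem npoint_cast (R : ℝ → ℂ) (Q : Matrix (Fin (s + 2)) (Fin (s + 2)) ℝ) {a b : ℕ} (h : a = b)
    (p : Fin a → Vec s) : npoint R Q a p = npoint R Q b fun i => p (Fin.cast h.symm i) := by
  subst h; rfl

theorem npoint_succ (R : ℝ → ℂ) (Q : Matrix (Fin (s + 2)) (Fin (s + 2)) ℝ) (n : ℕ)
    (p : Fin (n + 1) → Vec s) : npoint R Q (n + 1) p =
      (∏ r : Fin n, R (-mink (p 0) (Q.mulVec (p r.succ)))) * npoint R Q n fun i => p i.succ := by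
  rw [npoint, Fin.prod_univ_succ, Fin.Ioi_zero_eq_map, Finset.prod_map]
  simp only [npoint, Fin.Ioi_succ, Finset.prod_map]
  rfl

theorem npoint_one (R : ℝ → ℂ) (Q : Matrix (Fin (s + 2)) (Fin (s + 2)) ℝ) (p : Fin 1 → Vec s) :
    npoint R Q 1 p = 1 := by
  rw [npoint_succ]; simp [npoint]

theorem momentum_multiplier {n : ℕ} {u : (Fin n → Vec s) → ℂ} (hu : u.HasTemperateGrowth)
    (f : TestFn s n) (p : Fin n → Vec s) :
    momentum s n (multiplier u f) p = u p * momentum s n f p := by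
  have : momentum s n (multiplier u f) = smulLeftCLM ℂ u (momentum s n f) :=
    (momentum s n).apply_symm_apply _
  rw [this, smulLeftCLM_apply_apply hu, smul_eq_mul]

/-- The deformed product of a one particle test function with an `n` particle test function. -/
noncomputable def deformedTensor (R : ℝ → ℂ) (Q : Matrix (Fin (s + 2)) (Fin (s + 2)) ℝ) {n : ℕ}
    (f : TestFn s 1) (g : TestFn s n) : TestFn s (1 + n) :=
  multiplier (fun p => (npoint R Q (1 + n) p)⁻¹)
    (tensor s 1 n (multiplier (npoint R Q 1) f) (multiplier (npoint R Q n) g))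

theorem deformedMul_lof (R : ℝ → ℂ) (Q : Matrix (Fin (s + 2)) (Fin (s + 2)) ℝ) {n : ℕ}
    (f : TestFn s 1) (g : TestFn s n) :
    deformedMul R Q (oneParticle f) (DirectSum.lof ℂ ℕ (fun n => TestFn s n) n g) =
      DirectSum.lof ℂ ℕ (fun n => TestFn s n) (1 + n) (deformedTensor R Q f g) := by
  simp only [deformedMul, deform, deformInv, oneParticle, LinearMap.comp_apply,
    DirectSum.lmap_lof, BUAlg.mul_lof, deformedTensor]

/-- In momentum space the deformed product with a one particle function multiplies by the exchange
kernels of its momentum with the momenta of the other factor. -/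
theorem momentum_deformedTensor {R : ℝ → ℂ} (hR : IsDeformationFunction R)
    (Q : Matrix (Fin (s + 2)) (Fin (s + 2)) ℝ) {n : ℕ} (f : TestFn s 1) (g : TestFn s n)
    (p : Fin (n + 1) → Vec s) :
    momentum s (1 + n) (deformedTensor R Q f g) (fun i => p (Fin.cast (add_comm 1 n) i)) =
      oneMomentum f (p 0) * ((∏ r : Fin n, exchange R Q (p 0) (p r.succ)) *
        momentum s n g fun i => p i.succ) := by
  have hinv : (fun p => (npoint R Q (1 + n) p)⁻¹) = npoint R (-Q) (1 + n) :=
    funext (hR.npoint_inv Q (1 + n))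
  rw [deformedTensor, momentum_multiplier (by
    rw [hinv]; exact hR.npoint_hasTemperateGrowth (-Q) (1 + n)), momentum_tensor,
    momentum_multiplier (hR.npoint_hasTemperateGrowth Q 1),
    momentum_multiplier (hR.npoint_hasTemperateGrowth Q n), npoint_one, one_mul,
    npoint_cast R Q (add_comm 1 n)]
  have h1 : (fun i : Fin 1 => p (Fin.cast (add_comm 1 n) (Fin.castAdd n i))) = fun _ => p 0 := by
    ext1 i; rw [Subsingleton.elim i 0]; rfl
  have h2 : ∀ i : Fin n, Fin.cast (add_comm 1 n) (Fin.natAdd 1 i) = i.succ := fun i => by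
    ext; simp
  simp only [h1, h2, Fin.cast_cast, Fin.cast_eq_self]
  rw [npoint_succ, mul_inv]
  have h3 : npoint R Q n (fun i => p i.succ) ≠ 0 := fun h0 => by
    refine Finset.prod_ne_zero_iff.2 (fun l _ => Finset.prod_ne_zero_iff.2 fun r _ h => ?_) h0
    have := hR.mul_map_neg (-mink (p l.succ) (Q.mulVec (p r.succ)))
    rw [h] at this
    simp at this
  simp only [← Finset.prod_inv_distrib, hR.inv_map, neg_neg, exchange, oneMomentum]
  field_simp

/-! ### The deformed creation and annihilation operators -/

/-- The properties of the exchange kernel `S(p, x) = R(p · Q x)` that are used on Fock space. -/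
structure IsExchange (S : Vec s → Vec s → ℂ) : Prop where
  continuous : Continuous fun z : Vec s × Vec s => S z.1 z.2
  neg_left_mul : ∀ p x, S (-p) x * S p x = 1
  neg_right_mul : ∀ p x, S p (-x) * S p x = 1
  self : ∀ p, S p p = 1
  conj_eq : ∀ p x, conj (S p x) = S (-p) x

theorem IsExchange.norm_eq_one {S : Vec s → Vec s → ℂ} (hS : IsExchange S) (p x : Vec s) :
    ‖S p x‖ = 1 := by
  have h := hS.neg_left_mul p x
  rw [← hS.conj_eq, Complex.conj_mul'] at h
  have h2 : ‖S p x‖ ^ 2 = 1 := by exact_mod_cast h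
  exact (pow_eq_one_iff_of_nonneg (norm_nonneg _) two_ne_zero).1 h2

theorem isExchange_exchange {R : ℝ → ℂ} (hR : IsDeformationFunction R)
    {Q : Matrix (Fin (s + 2)) (Fin (s + 2)) ℝ}
    (hQ : ∀ x y : Vec s, mink x (Q.mulVec y) = -mink (Q.mulVec x) y) : IsExchange (exchange R Q) where
  continuous := by
    unfold exchange
    refine hR.hasTemperateGrowth.1.continuous.comp ?_
    unfold mink
    have h : Continuous fun z : Vec s × Vec s => Q.mulVec z.2 :=
      (Q.mulVecLin.continuous_of_finiteDimensional).comp continuous_snd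
    have h' : ∀ i, Continuous fun z : Vec s × Vec s => Q.mulVec z.2 i :=
      fun i => (continuous_apply i).comp h
    have h'' : ∀ i, Continuous fun z : Vec s × Vec s => z.1 i := fun i => by fun_prop
    exact ((h'' _).mul (h' _)).sub (continuous_finsetSum _ fun j _ => (h'' _).mul (h' _))
  neg_left_mul p x := by
    rw [exchange, exchange, mink_neg_left, mul_comm, hR.mul_map_neg]
  neg_right_mul p x := by
    rw [exchange, exchange, Matrix.mulVec_neg, mink_neg_right, mul_comm, hR.mul_map_neg]
  self p := by
    have h := hQ p p
    rw [mink_comm (Q.mulVec p)] at h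
    rw [exchange, show mink p (Q.mulVec p) = 0 by linarith, hR.map_zero]
  conj_eq p x := by
    rw [exchange, exchange, mink_neg_left, hR.conj_eq]

/-- The kernel of `-Q` is the transpose of the kernel of `Q`. -/
theorem exchange_neg (R : ℝ → ℂ) {Q : Matrix (Fin (s + 2)) (Fin (s + 2)) ℝ}
    (hQ : ∀ x y : Vec s, mink x (Q.mulVec y) = -mink (Q.mulVec x) y) (p x : Vec s) :
    exchange R (-Q) p x = exchange R Q x p := by
  rw [exchange, exchange, Matrix.neg_mulVec, mink_neg_right, hQ, neg_neg, mink_comm]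

/-- The family `p ↦ f(p) ∏ⱼ S(p, xⱼ) ψ_k(x)` of Fock space functions. Creating, respectively
annihilating, the particle `p` of this family gives the two parts of the deformed field operator. -/
noncomputable def dressed (S : Vec s → Vec s → ℂ) (f : Vec s → ℂ) (ψ : FockFn s) : Vec s → FockFn s :=
  fun p k x => f p * ((∏ j, S p (x j)) * ψ k x)

/-- The deformed field operator on Fock space functions. -/
noncomputable def fieldFn (m : ℝ) (S : Vec s → Vec s → ℂ) (f : Vec s → ℂ) (ψ : FockFn s) : FockFn s :=
  create (dressed S f ψ) + annihilate m (dressed S f ψ)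

/-- A multiplicative factor `u` with `u(-q) u(q) = 1` in every variable passes through the products
of fields, because contracted variables come in pairs `-q, q`. -/
theorem fieldProduct_prod_mul (m : ℝ) {u : Vec s → ℂ} (hu : ∀ q, u (-q) * u q = 1) (n : ℕ) :
    ∀ (F : (Fin n → Vec s) → ℂ) (k : ℕ) (x : Fin k → Vec s),
      fieldProduct m n (fun p => (∏ i, u (p i)) * F p) k x =
        (∏ j, u (x j)) * fieldProduct m n F k x := by
  induction n with
  | zero =>
    intro F k x
    rcases k with _ | k <;> simp [fieldProduct]
  | succ n ih =>
    intro F k x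
    have h1 : ∀ (p : Vec s) (k : ℕ) (x : Fin k → Vec s),
        fieldProduct m n (fun p' => (∏ i, u ((Fin.cons p p' : Fin (n + 1) → Vec s) i)) *
          F (Fin.cons p p')) k x =
        u p * (∏ j, u (x j)) * fieldProduct m n (fun p' => F (Fin.cons p p')) k x := fun p k x => by
      simp only [Fin.prod_univ_succ, Fin.cons_zero, Fin.cons_succ, mul_assoc]
      rw [fieldProduct_smul, ih]
    simp only [fieldProduct, Pi.add_apply, mul_add]
    congr 1
    · rcases k with _ | k
      · simp [create]
      · simp only [create, h1, Finset.mul_sum]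
        refine Finset.sum_congr rfl fun i _ => ?_
        rw [← Fin.mul_prod_removeNth i (fun j => u (x j))]
        simp only [Fin.removeNth_apply]
        ring
    · simp only [annihilate, h1]
      simp only [Fin.prod_univ_succ, Fin.cons_zero, Fin.cons_succ]
      have h2 : ∀ (q : Vec s) (c : ℂ), u (-q) * (u q * c) = c := fun q c => by
        rw [← mul_assoc, hu, one_mul]
      simp only [h2, integral_const_mul]
      ring

theorem fieldProduct_dressed (m : ℝ) {S : Vec s → Vec s → ℂ} (hS : IsExchange S) {n : ℕ}
    (f : Vec s → ℂ) (G : (Fin n → Vec s) → ℂ) :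
    fieldProduct m (n + 1) (fun p => f (p 0) * ((∏ r : Fin n, S (p 0) (p r.succ)) *
      G fun i => p i.succ)) = fieldFn m S f (fieldProduct m n G) := by
  have h1 : (fun p => fieldProduct m n fun p' => f ((Fin.cons p p' : Fin (n + 1) → Vec s) 0) *
      ((∏ r : Fin n, S ((Fin.cons p p' : Fin (n + 1) → Vec s) 0)
        ((Fin.cons p p' : Fin (n + 1) → Vec s) r.succ)) *
      G fun i => (Fin.cons p p' : Fin (n + 1) → Vec s) i.succ)) =
      dressed S f (fieldProduct m n G) := by
    ext p k x
    simp only [Fin.cons_zero, Fin.cons_succ]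
    rw [fieldProduct_smul, fieldProduct_prod_mul m (u := S p) (hS.neg_right_mul p), dressed]
  rw [fieldProduct, h1, fieldFn]

theorem fieldProduct_cast (m : ℝ) {a b : ℕ} (h : a = b) (F : (Fin a → Vec s) → ℂ) :
    fieldProduct m a F = fieldProduct m b fun p => F fun i => p (Fin.cast h i) := by
  subst h; rfl

theorem fieldProduct_deformedTensor (m : ℝ) {R : ℝ → ℂ} (hR : IsDeformationFunction R)
    {Q : Matrix (Fin (s + 2)) (Fin (s + 2)) ℝ}
    (hQ : ∀ x y : Vec s, mink x (Q.mulVec y) = -mink (Q.mulVec x) y) {n : ℕ}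
    (f : TestFn s 1) (g : TestFn s n) :
    fieldProduct m (1 + n) (momentum s (1 + n) (deformedTensor R Q f g)) =
      fieldFn m (exchange R Q) (oneMomentum f) (fieldProduct m n (momentum s n g)) := by
  rw [fieldProduct_cast m (add_comm 1 n)]
  simp only [momentum_deformedTensor hR]
  exact fieldProduct_dressed m (isExchange_exchange hR hQ) _ _

/-! ### Fock space functions -/

/-- The product measure `μ^{⊗ k}` of the mass shell measure. -/
noncomputable abbrev shellPi (s : ℕ) (m : ℝ) (k : ℕ) : Measure (Fin k → Vec s) :=
  Measure.pi fun _ => massShell s m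

instance hasTemperateGrowth_shellPi (m : ℝ) [Fact (0 < m)] (k : ℕ) :
    (shellPi s m k).HasTemperateGrowth := by
  obtain ⟨K, hK⟩ := (inferInstance : (massShell s m).HasTemperateGrowth)
  refine ⟨k * K, (Integrable.fintype_prod fun _ : Fin k => hK).mono' ?_ (Eventually.of_forall fun x => ?_)⟩
  · refine Continuous.aestronglyMeasurable ?_
    exact (continuous_const.add continuous_norm).rpow_const fun x =>
      Or.inl (add_pos_of_pos_of_nonneg one_pos (norm_nonneg x)).ne'
  · rw [Real.norm_of_nonneg (by positivity), Real.rpow_neg (by positivity), Real.rpow_natCast]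
    have h1 : ∏ i, (1 + ‖x i‖) ^ (-(K : ℝ)) = (∏ i, (1 + ‖x i‖) ^ K)⁻¹ := by
      rw [← Finset.prod_inv_distrib]
      exact Finset.prod_congr rfl fun i _ => by
        rw [Real.rpow_neg (by positivity), Real.rpow_natCast]
    rw [h1]
    refine inv_anti₀ (Finset.prod_pos fun i _ => by positivity) ?_
    calc ∏ i, (1 + ‖x i‖) ^ K ≤ ∏ _i : Fin k, (1 + ‖x‖) ^ K :=
          Finset.prod_le_prod (fun i _ => by positivity) fun i _ => by
            gcongr; exact norm_le_pi_norm x i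
      _ = (1 + ‖x‖) ^ (k * K) := by
        rw [Finset.prod_const, Finset.card_univ, Fintype.card_fin, ← pow_mul, mul_comm]

theorem integral_shellPi_succ (m : ℝ) {k : ℕ} (i : Fin (k + 1)) (G : (Fin (k + 1) → Vec s) → ℂ) :
    ∫ x, G x ∂shellPi s m (k + 1) =
      ∫ z : Vec s × (Fin k → Vec s), G (i.insertNth z.1 z.2) ∂(massShell s m).prod (shellPi s m k) :=
  ((measurePreserving_piFinSuccAbove (fun _ : Fin (k + 1) => massShell s m) i).symm.integral_comp'
    G).symm

theorem lintegral_shellPi_succ (m : ℝ) {k : ℕ} (i : Fin (k + 1))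
    (G : (Fin (k + 1) → Vec s) → ENNReal) :
    ∫⁻ x, G x ∂shellPi s m (k + 1) =
      ∫⁻ z : Vec s × (Fin k → Vec s), G (i.insertNth z.1 z.2) ∂(massShell s m).prod (shellPi s m k) :=
  ((measurePreserving_piFinSuccAbove (fun _ : Fin (k + 1) => massShell s m) i).symm.lintegral_comp_emb
    (MeasurableEquiv.measurableEmbedding _) G).symm

theorem integrable_shellPi_succ (m : ℝ) {k : ℕ} (i : Fin (k + 1)) {G : (Fin (k + 1) → Vec s) → ℂ}
    (hG : Integrable G (shellPi s m (k + 1))) :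
    Integrable (fun z : Vec s × (Fin k → Vec s) => G (i.insertNth z.1 z.2))
      ((massShell s m).prod (shellPi s m k)) :=
  ((measurePreserving_piFinSuccAbove (fun _ : Fin (k + 1) => massShell s m) i).symm.integrable_comp_emb
    (MeasurableEquiv.measurableEmbedding _)).2 hG

/-- Fubini's theorem, separating one of the particles. -/
theorem integral_shellPi_succ_eq (m : ℝ) {k : ℕ} (i : Fin (k + 1)) {G : (Fin (k + 1) → Vec s) → ℂ}
    (hG : Integrable G (shellPi s m (k + 1))) :
    ∫ x, G x ∂shellPi s m (k + 1) =
      ∫ y, ∫ q, G (i.insertNth q y) ∂massShell s m ∂shellPi s m k := by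
  rw [integral_shellPi_succ m i, integral_prod_symm _ (integrable_shellPi_succ m i hG)]

/-- Representatives of vectors with at most `N` particles: rapidly decreasing permutation invariant
functions. -/
structure IsFockState (N : ℕ) (ψ : FockFn s) : Prop where
  rapidDecay : ∀ k, RapidDecay (ψ k)
  perm : ∀ k (σ : Equiv.Perm (Fin k)) (x : Fin k → Vec s), ψ k (fun i => x (σ i)) = ψ k x
  eq_zero : ∀ k, N < k → ψ k = 0

theorem IsFockState.insertNth {N : ℕ} {ψ : FockFn s} (hψ : IsFockState N ψ) {k : ℕ} (i : Fin (k + 1))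
    (q : Vec s) (y : Fin k → Vec s) : ψ (k + 1) (i.insertNth q y) = ψ (k + 1) (Fin.cons q y) := by
  rw [← hψ.perm (k + 1) i.cycleRange (Fin.cons q y)]
  simp only [Fin.cons_apply_cycleRange]

namespace RapidDecay

variable {E D : Type*} [NormedAddCommGroup E] [NormedAddCommGroup D]

theorem mul_bounded {G u : E → ℂ} (hG : RapidDecay G) (hu : Continuous u) (hn : ∀ x, ‖u x‖ ≤ 1) :
    RapidDecay fun x => u x * G x := by
  refine ⟨hu.mul hG.1, fun N => ?_⟩
  obtain ⟨C, hC⟩ := hG.2 N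
  refine ⟨C, fun x => le_trans ?_ (hC x)⟩
  rw [norm_mul]
  exact mul_le_mul_of_nonneg_left (mul_le_of_le_one_left (norm_nonneg _) (hn x)) (by positivity)

theorem exists_norm_le {G : E → ℂ} (hG : RapidDecay G) : ∃ C, 0 ≤ C ∧ ∀ x, ‖G x‖ ≤ C := by
  obtain ⟨C, hC⟩ := hG.2 0
  simp only [pow_zero, one_mul] at hC
  exact ⟨C, (norm_nonneg _).trans (hC 0), hC⟩

theorem bounded_mul {G u : E → ℂ} (hG : RapidDecay G) (hu : RapidDecay u) :
    RapidDecay fun x => u x * G x := by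
  obtain ⟨C, hC0, hC⟩ := hu.exists_norm_le
  refine ⟨hu.1.mul hG.1, fun N => ?_⟩
  obtain ⟨C', hC'⟩ := hG.2 N
  refine ⟨C * C', fun x => ?_⟩
  rw [norm_mul, mul_left_comm]
  exact mul_le_mul (hC x) (hC' x) (by positivity) hC0

theorem star_conj {G : E → ℂ} (hG : RapidDecay G) : RapidDecay fun x => conj (G x) :=
  ⟨Complex.continuous_conj.comp hG.1, fun N => by simpa using hG.2 N⟩

theorem prod_mul {G : E → ℂ} {G' : D → ℂ} (hG : RapidDecay G) (hG' : RapidDecay G') :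
    RapidDecay fun z : E × D => G z.1 * G' z.2 := by
  refine ⟨(hG.1.comp continuous_fst).mul (hG'.1.comp continuous_snd), fun N => ?_⟩
  obtain ⟨C, hC⟩ := hG.2 N
  obtain ⟨C', hC'⟩ := hG'.2 N
  refine ⟨C * C', fun z => ?_⟩
  have h1 : 1 + ‖z‖ ≤ (1 + ‖z.1‖) * (1 + ‖z.2‖) := by
    have h2 : ‖z‖ ≤ ‖z.1‖ + ‖z.2‖ :=
      max_le (by linarith [norm_nonneg z.2]) (by linarith [norm_nonneg z.1])
    nlinarith [mul_nonneg (norm_nonneg z.1) (norm_nonneg z.2)]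
  calc (1 + ‖z‖) ^ N * ‖G z.1 * G' z.2‖
      ≤ ((1 + ‖z.1‖) * (1 + ‖z.2‖)) ^ N * ‖G z.1 * G' z.2‖ := by gcongr
    _ = ((1 + ‖z.1‖) ^ N * ‖G z.1‖) * ((1 + ‖z.2‖) ^ N * ‖G' z.2‖) := by rw [norm_mul, mul_pow]; ring
    _ ≤ C * C' := mul_le_mul (hC _) (hC' _) (by positivity)
      (le_trans (by positivity) (hC z.1))

theorem create {V : Vec s → FockFn s}
    (hV : ∀ k, RapidDecay fun z : Vec s × (Fin k → Vec s) => V z.1 k z.2) (k : ℕ) :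
    RapidDecay (DeformedQFT.create V k) := by
  rcases k with _ | k
  · exact RapidDecay.zero
  · refine RapidDecay.const_mul (RapidDecay.sum _ fun i => ?_) _
    refine (hV k).comp (a := fun x : Fin (k + 1) → Vec s => (x i, i.removeNth x)) ?_ fun x => ?_
    · refine Continuous.prodMk (by fun_prop) ?_
      unfold Fin.removeNth; fun_prop
    · refine (pi_norm_le_iff_of_nonneg (norm_nonneg _)).2 fun j => ?_
      rcases Fin.eq_self_or_eq_succAbove i j with rfl | ⟨j, rfl⟩
      · exact le_max_left _ _
      · exact (norm_le_pi_norm (i.removeNth x) j).trans (le_max_right _ _)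

theorem annihilate_integrand {V : Vec s → FockFn s}
    (hV : ∀ k, RapidDecay fun z : Vec s × (Fin k → Vec s) => V z.1 k z.2) (k : ℕ) :
    RapidDecay fun z : (Fin k → Vec s) × Vec s => V (-z.2) (k + 1) (Fin.cons z.2 z.1) := by
  refine (hV (k + 1)).comp (a := fun z : (Fin k → Vec s) × Vec s =>
    (-z.2, (Fin.cons z.2 z.1 : Fin (k + 1) → Vec s))) ?_ fun z => ?_
  · exact Continuous.prodMk (by fun_prop) (continuous_cons (by fun_prop) (by fun_prop))
  · exact max_le ((norm_le_cons _ _).trans (le_max_right _ _))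
      ((norm_head_le_cons _ _).trans (le_max_right _ _))

theorem annihilate (m : ℝ) [Fact (0 < m)] {V : Vec s → FockFn s}
    (hV : ∀ k, RapidDecay fun z : Vec s × (Fin k → Vec s) => V z.1 k z.2) (k : ℕ) :
    RapidDecay (DeformedQFT.annihilate m V k) :=
  RapidDecay.const_mul (RapidDecay.integral (annihilate_integrand hV k) _) _

end RapidDecay

theorem IsExchange.continuous_prod {S : Vec s → Vec s → ℂ} (hS : IsExchange S) (k : ℕ) :
    Continuous fun z : Vec s × (Fin k → Vec s) => ∏ j, S z.1 (z.2 j) :=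
  continuous_finsetProd _ fun j _ => hS.continuous.comp
    (continuous_fst.prodMk ((continuous_apply j).comp continuous_snd))

theorem IsExchange.norm_prod {S : Vec s → Vec s → ℂ} (hS : IsExchange S) {k : ℕ} (p : Vec s)
    (x : Fin k → Vec s) : ‖∏ j, S p (x j)‖ = 1 := by
  simp [hS.norm_eq_one]

theorem RapidDecay.dressed {S : Vec s → Vec s → ℂ} (hS : IsExchange S) {f : Vec s → ℂ}
    (hf : RapidDecay f) {ψ : FockFn s} (hψ : ∀ k, RapidDecay (ψ k)) (k : ℕ) :
    RapidDecay fun z : Vec s × (Fin k → Vec s) => dressed S f ψ z.1 k z.2 := by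
  have h := (hf.prod_mul (hψ k)).mul_bounded (hS.continuous_prod k)
    fun z => (hS.norm_prod z.1 z.2).le
  convert h using 2 with z
  rw [DeformedQFT.dressed]
  ring

theorem create_perm {V : Vec s → FockFn s}
    (hV : ∀ p k (σ : Equiv.Perm (Fin k)) x, V p k (fun i => x (σ i)) = V p k x) (k : ℕ)
    (σ : Equiv.Perm (Fin k)) (x : Fin k → Vec s) :
    create V k (fun i => x (σ i)) = create V k x := by
  rcases k with _ | k
  · rfl
  · simp only [create]
    congr 1
    refine Fintype.sum_equiv σ _ _ fun i => ?_
    obtain ⟨τ, hτ⟩ := removeNth_comp_perm (s := s) σ i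
    rw [hτ x]
    exact hV _ k τ _

theorem annihilate_perm (m : ℝ) {V : Vec s → FockFn s}
    (hV : ∀ p k (σ : Equiv.Perm (Fin k)) x, V p k (fun i => x (σ i)) = V p k x) (k : ℕ)
    (σ : Equiv.Perm (Fin k)) (x : Fin k → Vec s) :
    annihilate m V k (fun i => x (σ i)) = annihilate m V k x := by
  simp only [annihilate]
  congr 1
  refine integral_congr_ae (Eventually.of_forall fun q => ?_)
  have : (Fin.cons q (fun i => x (σ i)) : Fin (k + 1) → Vec s) =
      fun j => (Fin.cons q x : Fin (k + 1) → Vec s) (Equiv.Perm.decomposeFin.symm (0, σ) j) := by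
    ext1 j
    refine Fin.cases ?_ (fun j => ?_) j <;> simp
  simp only [this]
  exact hV _ _ _ _

theorem IsFockState.dressed_perm {N : ℕ} {ψ : FockFn s} (hψ : IsFockState N ψ)
    (S : Vec s → Vec s → ℂ) (f : Vec s → ℂ) (p : Vec s) (k : ℕ) (σ : Equiv.Perm (Fin k))
    (x : Fin k → Vec s) : dressed S f ψ p k (fun i => x (σ i)) = dressed S f ψ p k x := by
  rw [dressed, dressed, hψ.perm, Equiv.prod_comp σ fun i => S p (x i)]

theorem IsFockState.create {N : ℕ} {ψ : FockFn s} (hψ : IsFockState N ψ) {S : Vec s → Vec s → ℂ}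
    (hS : IsExchange S) {f : Vec s → ℂ} (hf : RapidDecay f) :
    IsFockState (N + 1) (create (dressed S f ψ)) where
  rapidDecay := RapidDecay.create (RapidDecay.dressed hS hf hψ.rapidDecay)
  perm := create_perm (hψ.dressed_perm S f)
  eq_zero k hk := by
    obtain ⟨k, rfl⟩ : ∃ l, k = l + 1 := ⟨k - 1, by omega⟩
    ext x
    simp [DeformedQFT.create, dressed, hψ.eq_zero k (by omega)]

theorem IsFockState.annihilate (m : ℝ) [Fact (0 < m)] {N : ℕ} {ψ : FockFn s} (hψ : IsFockState N ψ)
    {S : Vec s → Vec s → ℂ} (hS : IsExchange S) {f : Vec s → ℂ} (hf : RapidDecay f) :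
    IsFockState N (annihilate m (dressed S f ψ)) where
  rapidDecay := RapidDecay.annihilate m (RapidDecay.dressed hS hf hψ.rapidDecay)
  perm := annihilate_perm m (hψ.dressed_perm S f)
  eq_zero k hk := by
    ext x
    simp [DeformedQFT.annihilate, dressed, hψ.eq_zero (k + 1) (by omega)]

theorem IsFockState.mono {N N' : ℕ} {ψ : FockFn s} (hψ : IsFockState N ψ) (h : N ≤ N') :
    IsFockState N' ψ := ⟨hψ.1, hψ.2, fun k hk => hψ.3 k (h.trans_lt hk)⟩

theorem IsFockState.add {N : ℕ} {ψ χ : FockFn s} (hψ : IsFockState N ψ) (hχ : IsFockState N χ) :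
    IsFockState N (ψ + χ) where
  rapidDecay k := (hψ.rapidDecay k).add (hχ.rapidDecay k)
  perm k σ x := by rw [Pi.add_apply, Pi.add_apply, Pi.add_apply, hψ.perm, hχ.perm]
  eq_zero k hk := by rw [Pi.add_apply, hψ.eq_zero k hk, hχ.eq_zero k hk, add_zero]

theorem IsFockState.fieldFn (m : ℝ) [Fact (0 < m)] {N : ℕ} {ψ : FockFn s} (hψ : IsFockState N ψ)
    {S : Vec s → Vec s → ℂ} (hS : IsExchange S) {f : Vec s → ℂ} (hf : RapidDecay f) :
    IsFockState (N + 1) (fieldFn m S f ψ) :=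
  (hψ.create hS hf).add ((hψ.annihilate m hS hf).mono (Nat.le_succ N))

/-! ### The adjoint relation -/

/-- The inner product of the `k`-particle components. -/
noncomputable def pairing (m : ℝ) (k : ℕ) (χ ψ : FockFn s) : ℂ :=
  ∫ x, conj (χ k x) * ψ k x ∂shellPi s m k

theorem conj_pairing (m : ℝ) (k : ℕ) (χ ψ : FockFn s) :
    conj (pairing m k χ ψ) = pairing m k ψ χ := by
  rw [pairing, ← integral_conj]
  simp only [map_mul, Complex.conj_conj, mul_comm, pairing]

theorem pairing_add_right (m : ℝ) [Fact (0 < m)] (k : ℕ) {N : ℕ} {χ ψ ψ' : FockFn s}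
    (hχ : IsFockState N χ) (hψ : IsFockState N ψ) (hψ' : IsFockState N ψ') :
    pairing m k χ (ψ + ψ') = pairing m k χ ψ + pairing m k χ ψ' := by
  simp only [pairing, Pi.add_apply, mul_add]
  exact integral_add (RapidDecay.integrable ((hψ.rapidDecay k).bounded_mul (hχ.rapidDecay k).star_conj) _)
    (RapidDecay.integrable ((hψ'.rapidDecay k).bounded_mul (hχ.rapidDecay k).star_conj) _)

theorem pairing_eq_zero_left (m : ℝ) {k : ℕ} {N : ℕ} {χ ψ : FockFn s} (hχ : IsFockState N χ)
    (h : N < k) : pairing m k χ ψ = 0 := by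
  simp [pairing, hχ.eq_zero k h]

/-- Creation and annihilation are adjoint to each other: by symmetry all the terms of the creation
operator contribute equally. -/
theorem pairing_create (m : ℝ) [Fact (0 < m)] {S : Vec s → Vec s → ℂ} (hS : IsExchange S)
    {f : Vec s → ℂ} (hf : RapidDecay f) (hreal : ∀ q, conj (f q) = f (-q)) {N : ℕ}
    {χ ψ : FockFn s} (hχ : IsFockState N χ) (hψ : IsFockState N ψ) (k : ℕ) :
    pairing m (k + 1) χ (create (dressed S f ψ)) =
      pairing m k (annihilate m (dressed S f χ)) ψ := by
  set J : ℂ := ∫ y, ∫ q, conj (χ (k + 1) (Fin.cons q y)) * dressed S f ψ q k y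
    ∂massShell s m ∂shellPi s m k with hJ
  have hc : ((√(k + 1 : ℝ) : ℝ) : ℂ) ≠ 0 := by
    exact_mod_cast (Real.sqrt_pos.2 (by positivity : (0 : ℝ) < k + 1)).ne'
  have hc2 : ((√(k + 1 : ℝ) : ℝ) : ℂ) * (√(k + 1 : ℝ) : ℝ) = (k + 1 : ℕ) := by
    rw [← Complex.ofReal_mul, Real.mul_self_sqrt (by positivity)]; push_cast; rfl
  have hterm : ∀ i : Fin (k + 1), RapidDecay fun x : Fin (k + 1) → Vec s =>
      conj (χ (k + 1) x) * dressed S f ψ (x i) k (i.removeNth x) := fun i => by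
    refine RapidDecay.bounded_mul ?_ (hχ.rapidDecay _).star_conj
    refine (RapidDecay.dressed hS hf hψ.rapidDecay k).comp
      (a := fun x : Fin (k + 1) → Vec s => (x i, i.removeNth x)) ?_ fun x => ?_
    · refine Continuous.prodMk (by fun_prop) ?_
      unfold Fin.removeNth; fun_prop
    · refine (pi_norm_le_iff_of_nonneg (norm_nonneg _)).2 fun j => ?_
      rcases Fin.eq_self_or_eq_succAbove i j with rfl | ⟨j, rfl⟩
      · exact le_max_left _ _
      · exact (norm_le_pi_norm (i.removeNth x) j).trans (le_max_right _ _)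
  have h1 : pairing m (k + 1) χ (create (dressed S f ψ)) = (√(k + 1 : ℝ) : ℝ) * J := by
    have h2 : ∀ x : Fin (k + 1) → Vec s, conj (χ (k + 1) x) * create (dressed S f ψ) (k + 1) x =
        ((√(k + 1 : ℝ) : ℝ) : ℂ)⁻¹ *
          ∑ i : Fin (k + 1), conj (χ (k + 1) x) * dressed S f ψ (x i) k (i.removeNth x) := fun x => by
      rw [create, ← Finset.mul_sum]; ring
    simp only [pairing, h2]
    rw [integral_const_mul, integral_finsetSum _ fun i _ => (hterm i).integrable _]
    have h3 : ∀ i : Fin (k + 1), ∫ x, conj (χ (k + 1) x) * dressed S f ψ (x i) k (i.removeNth x)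
        ∂shellPi s m (k + 1) = J := fun i => by
      rw [integral_shellPi_succ_eq m i ((hterm i).integrable _)]
      simp only [hχ.insertNth, Fin.insertNth_apply_same, Fin.removeNth_insertNth, hJ]
    rw [Finset.sum_congr rfl fun i _ => h3 i, Finset.sum_const, Finset.card_univ, Fintype.card_fin,
      nsmul_eq_mul, ← hc2]
    field_simp
  rw [h1, pairing, hJ, ← integral_const_mul]
  refine integral_congr_ae (Eventually.of_forall fun y => ?_)
  simp only [annihilate, map_mul, Complex.conj_ofReal]
  rw [← integral_conj, mul_assoc, ← integral_mul_const]
  congr 1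
  refine integral_congr_ae (Eventually.of_forall fun q => ?_)
  have h4 : S (-q) q = 1 := by
    have := hS.neg_left_mul q q
    rwa [hS.self, mul_one] at this
  simp only [dressed, map_mul, map_prod, Fin.prod_univ_succ, Fin.cons_zero, Fin.cons_succ, h4,
    hreal, hS.conj_eq, neg_neg, one_mul]
  ring

theorem pairing_annihilate (m : ℝ) [Fact (0 < m)] {S : Vec s → Vec s → ℂ} (hS : IsExchange S)
    {f : Vec s → ℂ} (hf : RapidDecay f) (hreal : ∀ q, conj (f q) = f (-q)) {N : ℕ}
    {χ ψ : FockFn s} (hχ : IsFockState N χ) (hψ : IsFockState N ψ) (k : ℕ) :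
    pairing m k χ (annihilate m (dressed S f ψ)) =
      pairing m (k + 1) (create (dressed S f χ)) ψ := by
  rw [← conj_pairing, ← pairing_create m hS hf hreal hψ hχ, conj_pairing]

/-- The deformed field operator of a real test function is symmetric. -/
theorem sum_pairing_fieldFn (m : ℝ) [Fact (0 < m)] {S : Vec s → Vec s → ℂ} (hS : IsExchange S)
    {f : Vec s → ℂ} (hf : RapidDecay f) (hreal : ∀ q, conj (f q) = f (-q)) {N : ℕ}
    {χ ψ : FockFn s} (hχ : IsFockState N χ) (hψ : IsFockState N ψ) :
    ∑ k ∈ Finset.range (N + 2), pairing m k χ (fieldFn m S f ψ) =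
      ∑ k ∈ Finset.range (N + 2), pairing m k (fieldFn m S f χ) ψ := by
  have key : ∀ {χ ψ : FockFn s}, IsFockState N χ → IsFockState N ψ →
      ∑ k ∈ Finset.range (N + 2), pairing m k χ (fieldFn m S f ψ) =
      ∑ k ∈ Finset.range (N + 1), (pairing m k (annihilate m (dressed S f χ)) ψ +
        pairing m (k + 1) (create (dressed S f χ)) ψ) := fun {χ ψ} hχ hψ => by
    have h1 : ∀ k, pairing m k χ (fieldFn m S f ψ) = pairing m k χ (create (dressed S f ψ)) +
        pairing m k χ (annihilate m (dressed S f ψ)) := fun k =>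
      pairing_add_right m k (hχ.mono (Nat.le_succ N)) (hψ.create hS hf)
        ((hψ.annihilate m hS hf).mono (Nat.le_succ N))
    have h2 : pairing m 0 χ (create (dressed S f ψ)) = 0 := by simp [pairing, create]
    have h3 : pairing m (N + 1) χ (annihilate m (dressed S f ψ)) = 0 :=
      pairing_eq_zero_left m hχ (Nat.lt_succ_self N)
    rw [Finset.sum_congr rfl fun k _ => h1 k, Finset.sum_add_distrib, Finset.sum_range_succ', h2,
      Finset.sum_range_succ (fun k => pairing m k χ (annihilate m (dressed S f ψ))), h3, add_zero,
      add_zero, ← Finset.sum_add_distrib]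
    refine Finset.sum_congr rfl fun k _ => ?_
    rw [pairing_create m hS hf hreal hχ hψ, pairing_annihilate m hS hf hreal hχ hψ]
  rw [key hχ hψ]
  have h5 : ∀ k, pairing m k (fieldFn m S f χ) ψ = conj (pairing m k ψ (fieldFn m S f χ)) :=
    fun k => (conj_pairing m k _ _).symm
  rw [Finset.sum_congr rfl fun k _ => h5 k, ← map_sum, key hψ hχ, map_sum]
  refine Finset.sum_congr rfl fun k _ => ?_
  rw [map_add, conj_pairing, conj_pairing, pairing_create m hS hf hreal hχ hψ,
    pairing_annihilate m hS hf hreal hχ hψ, add_comm]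

/-! ### Number operator bounds -/

theorem RapidDecay.memLp_two {E : Type*} [NormedAddCommGroup E] [MeasurableSpace E] [BorelSpace E]
    [SecondCountableTopology E] {G : E → ℂ} (hG : RapidDecay G) (μ : Measure E)
    [μ.HasTemperateGrowth] : MemLp G 2 μ := by
  rw [memLp_two_iff_integrable_sq_norm hG.1.aestronglyMeasurable]
  refine ((hG.bounded_mul hG).integrable μ).norm.congr (Eventually.of_forall fun x => ?_)
  simp only [norm_mul, sq]

theorem eLpNorm_two_eq {α : Type*} {_ : MeasurableSpace α} (μ : Measure α) (F : α → ℂ) :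
    eLpNorm F 2 μ = (∫⁻ x, ‖F x‖ₑ ^ (2 : ℝ) ∂μ) ^ (1 / 2 : ℝ) := by
  rw [eLpNorm_eq_lintegral_rpow_enorm_toReal two_ne_zero ENNReal.ofNat_ne_top]
  simp

theorem IsExchange.enorm_dressed {S : Vec s → Vec s → ℂ} (hS : IsExchange S) (f : Vec s → ℂ)
    (ψ : FockFn s) (p : Vec s) (k : ℕ) (x : Fin k → Vec s) :
    ‖dressed S f ψ p k x‖ₑ = ‖f p‖ₑ * ‖ψ k x‖ₑ := by
  rw [dressed, enorm_mul, enorm_mul, ← enorm_norm (∏ j, S p (x j)), hS.norm_prod]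
  simp

/-- The triangle inequality: the `k + 1` terms of the symmetrization have equal norms. -/
theorem eLpNorm_create_le (m : ℝ) [Fact (0 < m)] {S : Vec s → Vec s → ℂ} (hS : IsExchange S)
    {f : Vec s → ℂ} (hf : RapidDecay f) {ψ : FockFn s} (hψ : ∀ k, RapidDecay (ψ k)) (k : ℕ) :
    eLpNorm (create (dressed S f ψ) (k + 1)) 2 (shellPi s m (k + 1)) ≤
      ENNReal.ofReal √(k + 1) * (eLpNorm f 2 (massShell s m) * eLpNorm (ψ k) 2 (shellPi s m k)) := by
  have hterm : ∀ i : Fin (k + 1), Continuous fun x : Fin (k + 1) → Vec s =>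
      dressed S f ψ (x i) k (i.removeNth x) := fun i => by
    refine (RapidDecay.dressed hS hf hψ k).1.comp
      (f := fun x : Fin (k + 1) → Vec s => (x i, i.removeNth x)) (Continuous.prodMk (by fun_prop) ?_)
    unfold Fin.removeNth; fun_prop
  have hnorm : ∀ i : Fin (k + 1), eLpNorm (fun x : Fin (k + 1) → Vec s =>
      dressed S f ψ (x i) k (i.removeNth x)) 2 (shellPi s m (k + 1)) =
      eLpNorm f 2 (massShell s m) * eLpNorm (ψ k) 2 (shellPi s m k) := fun i => by
    rw [eLpNorm_two_eq, eLpNorm_two_eq, eLpNorm_two_eq, lintegral_shellPi_succ m i]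
    simp only [Fin.insertNth_apply_same, Fin.removeNth_insertNth, hS.enorm_dressed]
    simp only [ENNReal.mul_rpow_of_nonneg _ _ (zero_le_two : (0 : ℝ) ≤ 2)]
    rw [lintegral_prod_mul (f := fun q => ‖f q‖ₑ ^ (2 : ℝ)) (g := fun y => ‖ψ k y‖ₑ ^ (2 : ℝ))
      (hf.1.enorm.measurable.pow_const _).aemeasurable
      ((hψ k).1.enorm.measurable.pow_const _).aemeasurable,
      ENNReal.mul_rpow_of_nonneg _ _ (by norm_num)]
  have hc : (0 : ℝ) < √(k + 1 : ℝ) := Real.sqrt_pos.2 (by positivity)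
  have heq : create (dressed S f ψ) (k + 1) = ((√(k + 1 : ℝ) : ℂ)⁻¹) • ∑ i : Fin (k + 1),
      fun x : Fin (k + 1) → Vec s => dressed S f ψ (x i) k (i.removeNth x) := by
    ext x; simp [create]
  rw [heq, eLpNorm_const_smul]
  have hsum := eLpNorm_sum_le (p := 2) (μ := shellPi s m (k + 1)) (s := Finset.univ)
    (f := fun (i : Fin (k + 1)) (x : Fin (k + 1) → Vec s) => dressed S f ψ (x i) k (i.removeNth x))
    (fun i _ => (hterm i).aestronglyMeasurable) one_le_two
  simp only [hnorm, Finset.sum_const, Finset.card_univ, Fintype.card_fin, nsmul_eq_mul] at hsum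
  refine (mul_le_mul_right hsum _).trans (le_of_eq ?_)
  rw [← mul_assoc]
  congr 1
  have h1 : ‖((√(k + 1 : ℝ) : ℂ)⁻¹)‖ₑ = ENNReal.ofReal (√(k + 1 : ℝ))⁻¹ := by
    rw [← ofReal_norm, norm_inv, Complex.norm_real, Real.norm_of_nonneg hc.le]
  rw [h1, ← ENNReal.ofReal_natCast, ← ENNReal.ofReal_mul (by positivity)]
  congr 1
  have : √(k + 1 : ℝ) * √(k + 1 : ℝ) = k + 1 := Real.mul_self_sqrt (by positivity)
  push_cast
  field_simp
  linarith

/-- The Cauchy–Schwarz inequality in the annihilated momentum, followed by Fubini's theorem. -/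
theorem eLpNorm_annihilate_le (m : ℝ) [Fact (0 < m)] {S : Vec s → Vec s → ℂ} (hS : IsExchange S)
    {f : Vec s → ℂ} (hf : RapidDecay f) (hreal : ∀ q, conj (f q) = f (-q)) {ψ : FockFn s}
    (hψ : ∀ k, RapidDecay (ψ k)) (k : ℕ) :
    eLpNorm (annihilate m (dressed S f ψ) k) 2 (shellPi s m k) ≤
      ENNReal.ofReal √(k + 1) *
        (eLpNorm f 2 (massShell s m) * eLpNorm (ψ (k + 1)) 2 (shellPi s m (k + 1))) := by
  have hf2 : ∀ q, ‖f (-q)‖ₑ = ‖f q‖ₑ := fun q => by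
    rw [← hreal, ← ofReal_norm, ← ofReal_norm, Complex.norm_conj]
  have hcons : ∀ x : Fin k → Vec s, Continuous fun q => ψ (k + 1) (Fin.cons q x) := fun x =>
    (hψ (k + 1)).1.comp (continuous_cons continuous_id continuous_const)
  have hpt : ∀ x, ‖∫ q, dressed S f ψ (-q) (k + 1) (Fin.cons q x) ∂massShell s m‖ₑ ≤
      eLpNorm f 2 (massShell s m) *
        (∫⁻ q, ‖ψ (k + 1) (Fin.cons q x)‖ₑ ^ (2 : ℝ) ∂massShell s m) ^ (1 / 2 : ℝ) := fun x => by
    refine (enorm_integral_le_lintegral_enorm _).trans ?_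
    simp only [hS.enorm_dressed, hf2]
    rw [eLpNorm_two_eq]
    exact ENNReal.lintegral_mul_le_Lp_mul_Lq _ Real.HolderConjugate.two_two
      hf.1.enorm.measurable.aemeasurable (hcons x).enorm.measurable.aemeasurable
  have heq : annihilate m (dressed S f ψ) k = (√(k + 1 : ℝ) : ℂ) •
      fun x => ∫ q, dressed S f ψ (-q) (k + 1) (Fin.cons q x) ∂massShell s m := rfl
  rw [heq, eLpNorm_const_smul]
  have h1 : ‖(√(k + 1 : ℝ) : ℂ)‖ₑ = ENNReal.ofReal √(k + 1 : ℝ) := by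
    rw [← ofReal_norm, Complex.norm_real, Real.norm_of_nonneg (Real.sqrt_nonneg _)]
  rw [h1]
  refine mul_le_mul_right ?_ _
  rw [eLpNorm_two_eq (shellPi s m k), eLpNorm_two_eq (shellPi s m (k + 1)),
    lintegral_shellPi_succ m 0, lintegral_prod_symm _ (by
      refine Measurable.aemeasurable ?_
      refine Measurable.pow_const (Continuous.measurable ?_) _
      refine Continuous.enorm ((hψ (k + 1)).1.comp ?_)
      simp only [Fin.insertNth_zero]
      exact continuous_cons continuous_fst continuous_snd)]
  simp only [Fin.insertNth_zero]
  calc _ ≤ (∫⁻ x, eLpNorm f 2 (massShell s m) ^ (2 : ℝ) *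
        ∫⁻ q, ‖ψ (k + 1) (Fin.cons q x)‖ₑ ^ (2 : ℝ) ∂massShell s m ∂shellPi s m k) ^ (1 / 2 : ℝ) := by
        gcongr with x
        calc _ ≤ (eLpNorm f 2 (massShell s m) *
            (∫⁻ q, ‖ψ (k + 1) (Fin.cons q x)‖ₑ ^ (2 : ℝ) ∂massShell s m) ^ (1 / 2 : ℝ)) ^ (2 : ℝ) := by
              gcongr; exact hpt x
          _ = _ := by
              rw [ENNReal.mul_rpow_of_nonneg _ _ zero_le_two, ← ENNReal.rpow_mul]
              norm_num
    _ = _ := by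
        have htop : eLpNorm f 2 (massShell s m) ^ (2 : ℝ) ≠ ⊤ := by
          exact ENNReal.rpow_ne_top_of_nonneg zero_le_two (hf.memLp_two _).2.ne
        rw [lintegral_const_mul' _ _ htop, ENNReal.mul_rpow_of_nonneg _ _ (by norm_num),
          ← ENNReal.rpow_mul]
        norm_num

/-- The sum of the norms of the components with at most `N` particles. It is only used for vectors
without further components, where it dominates the Fock space norm. -/
noncomputable def componentSum (m : ℝ) (N : ℕ) (ψ : FockFn s) : ℝ :=
  ∑ k ∈ Finset.range (N + 1), (eLpNorm (ψ k) 2 (shellPi s m k)).toReal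

theorem componentSum_nonneg (m : ℝ) (N : ℕ) (ψ : FockFn s) : 0 ≤ componentSum m N ψ :=
  Finset.sum_nonneg fun _ _ => ENNReal.toReal_nonneg

/-- The deformed fields are bounded by the square root of the number operator. -/
theorem componentSum_fieldFn_le (m : ℝ) [Fact (0 < m)] {S : Vec s → Vec s → ℂ} (hS : IsExchange S)
    {f : Vec s → ℂ} (hf : RapidDecay f) (hreal : ∀ q, conj (f q) = f (-q)) {N : ℕ} {ψ : FockFn s}
    (hψ : IsFockState N ψ) :
    componentSum m (N + 1) (fieldFn m S f ψ) ≤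
      2 * (eLpNorm f 2 (massShell s m)).toReal * √(N + 1) * componentSum m N ψ := by
  set A := (eLpNorm f 2 (massShell s m)).toReal
  set e : (k : ℕ) → ((Fin k → Vec s) → ℂ) → ℝ := fun k F => (eLpNorm F 2 (shellPi s m k)).toReal
  have hfin : ∀ {k : ℕ} {F : (Fin k → Vec s) → ℂ}, RapidDecay F →
      eLpNorm F 2 (shellPi s m k) ≠ ⊤ := fun hF => (hF.memLp_two _).2.ne
  have hffin : eLpNorm f 2 (massShell s m) ≠ ⊤ := (hf.memLp_two _).2.ne
  have hA : 0 ≤ A := ENNReal.toReal_nonneg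
  have he0 : ∀ k F, 0 ≤ e k F := fun _ _ => ENNReal.toReal_nonneg
  have hc0 : e 0 (create (dressed S f ψ) 0) = 0 := by
    have : create (dressed S f ψ) 0 = 0 := rfl
    simp [e, this]
  have hconv : ∀ (k l : ℕ) (F : (Fin k → Vec s) → ℂ) (G : (Fin l → Vec s) → ℂ) (c : ℝ), 0 ≤ c →
      RapidDecay G → eLpNorm F 2 (shellPi s m k) ≤ ENNReal.ofReal c *
        (eLpNorm f 2 (massShell s m) * eLpNorm G 2 (shellPi s m l)) → e k F ≤ c * (A * e l G) := by
    intro k l F G c hc hG h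
    have h2 := ENNReal.toReal_mono
      (ENNReal.mul_ne_top ENNReal.ofReal_ne_top (ENNReal.mul_ne_top hffin (hfin hG))) h
    rwa [ENNReal.toReal_mul, ENNReal.toReal_mul, ENNReal.toReal_ofReal hc] at h2
  have hc : ∀ k, e (k + 1) (create (dressed S f ψ) (k + 1)) ≤ √(k + 1) * (A * e k (ψ k)) := fun k =>
    hconv _ _ _ _ _ (Real.sqrt_nonneg _) (hψ.rapidDecay k)
      (eLpNorm_create_le m hS hf hψ.rapidDecay k)
  have ha : ∀ k, e k (annihilate m (dressed S f ψ) k) ≤ √(k + 1) * (A * e (k + 1) (ψ (k + 1))) :=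
    fun k => hconv _ _ _ _ _ (Real.sqrt_nonneg _) (hψ.rapidDecay (k + 1))
      (eLpNorm_annihilate_le m hS hf hreal hψ.rapidDecay k)
  have hz : ∀ k, N < k → e k (ψ k) = 0 := fun k hk => by simp [e, hψ.eq_zero k hk]
  have hle : ∀ k, k ≤ N → √((k : ℝ) + 1) ≤ √((N : ℝ) + 1) := fun k hk =>
    Real.sqrt_le_sqrt (by have : (k : ℝ) ≤ N := by exact_mod_cast hk
                          linarith)
  have h1 : ∑ k ∈ Finset.range (N + 2), e k (create (dressed S f ψ) k) ≤
      A * √(N + 1) * componentSum m N ψ := by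
    rw [Finset.sum_range_succ', hc0, add_zero, componentSum, Finset.mul_sum]
    refine Finset.sum_le_sum fun k hk => (hc k).trans ?_
    have := hle k (Nat.lt_succ_iff.1 (Finset.mem_range.1 hk))
    calc _ ≤ √((N : ℝ) + 1) * (A * e k (ψ k)) :=
          mul_le_mul_of_nonneg_right this (mul_nonneg hA (he0 _ _))
      _ = _ := by ring
  have h2 : ∑ k ∈ Finset.range (N + 2), e k (annihilate m (dressed S f ψ) k) ≤
      A * √(N + 1) * componentSum m N ψ := by
    have h3 : ∑ k ∈ Finset.range (N + 2), e (k + 1) (ψ (k + 1)) ≤ componentSum m N ψ := by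
      have h4 : ∑ k ∈ Finset.range (N + 2), e (k + 1) (ψ (k + 1)) ≤
          ∑ k ∈ Finset.range (N + 3), e k (ψ k) := by
        rw [Finset.sum_range_succ' _ (N + 2)]
        linarith [he0 0 (ψ 0)]
      rwa [Finset.sum_range_succ (fun k => e k (ψ k)) (N + 2),
        Finset.sum_range_succ (fun k => e k (ψ k)) (N + 1), hz (N + 1) (by omega),
        hz (N + 2) (by omega), add_zero, add_zero] at h4
    calc _ ≤ ∑ k ∈ Finset.range (N + 2), A * √(N + 1) * e (k + 1) (ψ (k + 1)) := by
          refine Finset.sum_le_sum fun k _ => (ha k).trans ?_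
          rcases Nat.lt_or_ge N (k + 1) with hk | hk
          · rw [hz _ hk]; simp
          · calc _ ≤ √((N : ℝ) + 1) * (A * e (k + 1) (ψ (k + 1))) :=
                  mul_le_mul_of_nonneg_right (hle k (by omega)) (mul_nonneg hA (he0 _ _))
              _ = _ := by ring
      _ ≤ _ := by
          rw [← Finset.mul_sum]
          exact mul_le_mul_of_nonneg_left h3 (by positivity)
  have hadd : ∀ k, e k (fieldFn m S f ψ k) ≤ e k (create (dressed S f ψ) k) +
      e k (annihilate m (dressed S f ψ) k) := fun k => by
    have hC := (hψ.create hS hf).rapidDecay k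
    have hA' := (hψ.annihilate m hS hf).rapidDecay k
    have := eLpNorm_add_le (μ := shellPi s m k) hC.1.aestronglyMeasurable
      hA'.1.aestronglyMeasurable one_le_two
    have h5 := ENNReal.toReal_mono (ENNReal.add_ne_top.2 ⟨hfin hC, hfin hA'⟩) this
    rwa [ENNReal.toReal_add (hfin hC) (hfin hA')] at h5
  calc componentSum m (N + 1) (fieldFn m S f ψ)
      ≤ ∑ k ∈ Finset.range (N + 2), (e k (create (dressed S f ψ) k) +
        e k (annihilate m (dressed S f ψ) k)) := Finset.sum_le_sum fun k _ => hadd k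
    _ ≤ _ := by rw [Finset.sum_add_distrib]; linarith

/-! ### Fock space vectors and their representatives -/

/-- The representative of the Fock space vector `fockVec s m g`. -/
noncomputable def fockRep (s : ℕ) (m : ℝ) [Fact (0 < m)] : BUAlg s →ₗ[ℂ] FockFn s :=
  DirectSum.toModule ℂ ℕ _ fun n =>
    { toFun := fun f => fieldProduct m n (momentum s n f)
      map_add' := fun f g => by
        ext k x
        rw [map_add]
        exact fieldProduct_add m n (RapidDecay.schwartz _) (RapidDecay.schwartz _) k x
      map_smul' := fun c f => by
        ext k x
        rw [map_smul]
        exact fieldProduct_smul m n c _ k x }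

theorem fockRep_lof (m : ℝ) [Fact (0 < m)] {n : ℕ} (f : TestFn s n) :
    fockRep s m (DirectSum.lof ℂ ℕ (fun n => TestFn s n) n f) =
      fieldProduct m n (momentum s n f) := by
  simp [fockRep]

theorem isFockState_fieldProduct (m : ℝ) [Fact (0 < m)] {n : ℕ} (f : TestFn s n) :
    IsFockState n (fieldProduct m n (momentum s n f)) where
  rapidDecay := rapidDecay_fieldProduct m (RapidDecay.schwartz _)
  perm := fieldProduct_perm m n _
  eq_zero := fieldProduct_eq_zero m n _

theorem exists_isFockState (m : ℝ) [Fact (0 < m)] (g : BUAlg s) :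
    ∃ N, IsFockState N (fockRep s m g) := by
  induction g using DirectSum.induction_on with
  | zero =>
    refine ⟨0, ?_, ?_, ?_⟩ <;> simp only [map_zero]
    · exact fun k => RapidDecay.zero
    · exact fun _ _ _ => rfl
    · exact fun _ _ => rfl
  | of n f =>
    refine ⟨n, ?_⟩
    have := isFockState_fieldProduct m f
    rwa [← fockRep_lof] at this
  | add g h hg hh =>
    obtain ⟨N, hN⟩ := hg
    obtain ⟨N', hN'⟩ := hh
    refine ⟨max N N', ?_⟩
    rw [map_add]
    exact (hN.mono (le_max_left _ _)).add (hN'.mono (le_max_right _ _))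

theorem coe_component (m : ℝ) [Fact (0 < m)] {n k : ℕ} (f : TestFn s n) :
    (component s m n k f : ParticleL2 s m k) = (memLp_fieldProduct m f k).toLp _ := rfl

theorem fockVec_lof (m : ℝ) [Fact (0 < m)] {n : ℕ} (f : TestFn s n) :
    fockVec s m (DirectSum.lof ℂ ℕ (fun n => TestFn s n) n f) =
      ∑ k ∈ Finset.range (n + 1), lp.single 2 k (component s m n k f) := by
  simp only [fockVec, DirectSum.toModule_lof, LinearMap.sum_apply]
  rfl

/-- The components of `fockVec` are represented by `fockRep`; identities in Fock space can thus be
checked pointwise on momentum space functions. -/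
theorem fockVec_ae (m : ℝ) [Fact (0 < m)] (g : BUAlg s) (k : ℕ) :
    (((fockVec s m g : FockSpace s m) k : bosonSpace s m k) : ParticleL2 s m k) =ᵐ[shellPi s m k]
      fockRep s m g k := by
  induction g using DirectSum.induction_on with
  | zero =>
    simp only [map_zero]
    exact Lp.coeFn_zero _ _ _
  | of n f =>
    have h1 : ((fockVec s m (DirectSum.of (fun n => TestFn s n) n f) : FockSpace s m) k) =
        component s m n k f := by
      have := fockVec_lof m f
      rw [DirectSum.lof_eq_of] at this
      rw [this, lp.coeFn_sum, Finset.sum_apply]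
      by_cases hk : k < n + 1
      · rw [Finset.sum_eq_single_of_mem k (Finset.mem_range.2 hk) fun j _ hj =>
          lp.single_apply_ne _ _ _ hj.symm, lp.single_apply_self]
      · rw [Finset.sum_eq_zero fun j hj => lp.single_apply_ne _ _ _ (by
          rintro rfl; exact hk (Finset.mem_range.1 hj))]
        refine Subtype.ext ?_
        rw [coe_component]
        refine (Lp.ext ?_).symm
        filter_upwards [(memLp_fieldProduct m f k).coeFn_toLp, Lp.coeFn_zero ℂ 2 (shellPi s m k)]
          with x hx hx0
        rw [hx, fieldProduct_eq_zero m n _ k (by omega)]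
        exact hx0.symm
    rw [h1, coe_component]
    have h2 := fockRep_lof m f
    rw [DirectSum.lof_eq_of] at h2
    rw [h2]
    exact (memLp_fieldProduct m f k).coeFn_toLp
  | add g h hg hh =>
    rw [map_add, map_add]
    filter_upwards [hg, hh, Lp.coeFn_add (((fockVec s m g : FockSpace s m) k : bosonSpace s m k) :
      ParticleL2 s m k) ((fockVec s m h : FockSpace s m) k : bosonSpace s m k)] with x h1 h2 h3
    rw [Pi.add_apply, Pi.add_apply, ← h1, ← h2]
    exact h3

theorem norm_fockVec_apply (m : ℝ) [Fact (0 < m)] (g : BUAlg s) (k : ℕ) :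
    ‖(fockVec s m g : FockSpace s m) k‖ = (eLpNorm (fockRep s m g k) 2 (shellPi s m k)).toReal := by
  rw [← eLpNorm_congr_ae (fockVec_ae m g k), ← Lp.norm_def]
  rfl

theorem fockVec_apply_eq_zero (m : ℝ) [Fact (0 < m)] {g : BUAlg s} {N : ℕ}
    (hg : IsFockState N (fockRep s m g)) {k : ℕ} (hk : N < k) :
    (fockVec s m g : FockSpace s m) k = 0 := by
  rw [← norm_eq_zero, norm_fockVec_apply, hg.eq_zero k hk]
  simp

theorem norm_fockVec_le (m : ℝ) [Fact (0 < m)] {g : BUAlg s} {N : ℕ}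
    (hg : IsFockState N (fockRep s m g)) :
    ‖fockVec s m g‖ ≤ componentSum m N (fockRep s m g) := by
  have h1 : fockVec s m g = ∑ k ∈ Finset.range (N + 1),
      lp.single 2 k ((fockVec s m g : FockSpace s m) k) := by
    ext1
    ext1 j
    rw [lp.coeFn_sum, Finset.sum_apply]
    by_cases hj : j < N + 1
    · rw [Finset.sum_eq_single_of_mem j (Finset.mem_range.2 hj) fun i _ hi =>
        lp.single_apply_ne _ _ _ hi.symm, lp.single_apply_self]
    · rw [Finset.sum_eq_zero fun i hi => lp.single_apply_ne _ _ _ (by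
        rintro rfl; exact hj (Finset.mem_range.1 hi)), fockVec_apply_eq_zero m hg (by omega)]
  rw [h1]
  refine (norm_sum_le _ _).trans (Finset.sum_le_sum fun k _ => ?_)
  rw [lp.norm_single (by norm_num), norm_fockVec_apply]

theorem inner_fockVec (m : ℝ) [Fact (0 < m)] {g h : BUAlg s} {N : ℕ}
    (hh : IsFockState N (fockRep s m h)) {K : ℕ} (hK : N < K) :
    inner ℂ (fockVec s m g) (fockVec s m h) =
      ∑ k ∈ Finset.range K, pairing m k (fockRep s m g) (fockRep s m h) := by
  rw [lp.inner_eq_tsum, tsum_eq_sum (s := Finset.range K) fun k hk => by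
    rw [fockVec_apply_eq_zero m hh (by simp at hk; omega), inner_zero_right]]
  refine Finset.sum_congr rfl fun k _ => ?_
  rw [Submodule.coe_inner, L2.inner_def, pairing]
  refine integral_congr_ae ?_
  filter_upwards [fockVec_ae m g k, fockVec_ae m h k] with x h1 h2
  rw [h1, h2, RCLike.inner_apply, mul_comm]

theorem rapidDecay_oneMomentum (f : TestFn s 1) : RapidDecay (oneMomentum f) :=
  (RapidDecay.schwartz (momentum s 1 f)).comp (a := fun (p : Vec s) (_ : Fin 1) => p) (by fun_prop)
    fun p => norm_le_pi_norm (fun _ : Fin 1 => p) 0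

theorem RapidDecay.integrable_annihilate (m : ℝ) [Fact (0 < m)] {V : Vec s → FockFn s}
    (hV : ∀ k, RapidDecay fun z : Vec s × (Fin k → Vec s) => V z.1 k z.2) {k : ℕ}
    (x : Fin k → Vec s) :
    Integrable (fun q => V (-q) (k + 1) (Fin.cons q x)) (massShell s m) :=
  ((RapidDecay.annihilate_integrand hV k).comp (a := fun q : Vec s => (x, q)) (by fun_prop)
    fun _ => le_max_right _ _).integrable _

theorem annihilate_add (m : ℝ) [Fact (0 < m)] {V W : Vec s → FockFn s}
    (hV : ∀ k, RapidDecay fun z : Vec s × (Fin k → Vec s) => V z.1 k z.2)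
    (hW : ∀ k, RapidDecay fun z : Vec s × (Fin k → Vec s) => W z.1 k z.2) :
    annihilate m (V + W) = annihilate m V + annihilate m W := by
  ext k x
  simp only [annihilate, Pi.add_apply]
  rw [integral_add (RapidDecay.integrable_annihilate m hV x)
    (RapidDecay.integrable_annihilate m hW x), mul_add]

theorem create_add (V W : Vec s → FockFn s) : create (V + W) = create V + create W := by
  ext k x
  rcases k with _ | k
  · simp [create]
  · simp [create, Finset.sum_add_distrib, mul_add]

theorem dressed_add (S : Vec s → Vec s → ℂ) (f : Vec s → ℂ) (ψ χ : FockFn s) :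
    dressed S f (ψ + χ) = dressed S f ψ + dressed S f χ := by
  ext p k x
  simp only [dressed, Pi.add_apply]
  ring

theorem fieldFn_add (m : ℝ) [Fact (0 < m)] {S : Vec s → Vec s → ℂ} (hS : IsExchange S)
    {f : Vec s → ℂ} (hf : RapidDecay f) {ψ χ : FockFn s} (hψ : ∀ k, RapidDecay (ψ k))
    (hχ : ∀ k, RapidDecay (χ k)) :
    fieldFn m S f (ψ + χ) = fieldFn m S f ψ + fieldFn m S f χ := by
  rw [fieldFn, dressed_add, create_add, annihilate_add m (RapidDecay.dressed hS hf hψ)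
    (RapidDecay.dressed hS hf hχ)]
  exact add_add_add_comm _ _ _ _

/-- The deformed field acts on representatives by `fieldFn`. -/
theorem fockRep_deformedMul (m : ℝ) [Fact (0 < m)] {R : ℝ → ℂ} (hR : IsDeformationFunction R)
    {Q : Matrix (Fin (s + 2)) (Fin (s + 2)) ℝ}
    (hQ : ∀ x y : Vec s, mink x (Q.mulVec y) = -mink (Q.mulVec x) y) (f : TestFn s 1) (g : BUAlg s) :
    fockRep s m (deformedMul R Q (oneParticle f) g) =
      fieldFn m (exchange R Q) (oneMomentum f) (fockRep s m g) := by
  have hS := isExchange_exchange hR hQ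
  have hf := rapidDecay_oneMomentum f
  induction g using DirectSum.induction_on with
  | zero =>
    simp only [map_zero]
    ext k x
    rcases k with _ | k <;> simp [fieldFn, create, annihilate, dressed]
  | of n g =>
    have h1 := fockRep_lof m g
    have h2 := deformedMul_lof R Q f g
    rw [DirectSum.lof_eq_of] at h1 h2
    rw [h2, h1, fockRep_lof, fieldProduct_deformedTensor m hR hQ]
  | add g h hg hh =>
    obtain ⟨N, hN⟩ := exists_isFockState m g
    obtain ⟨N', hN'⟩ := exists_isFockState m h
    rw [map_add, map_add, hg, hh, map_add, fieldFn_add m hS hf hN.rapidDecay hN'.rapidDecay]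

/-! ### Cyclicity of the vacuum -/

/-- The component of `φ(F) Ω`, `F` a function of `n` momenta, with the maximal number `n` of
particles is a symmetrization of `F`. -/
theorem exists_fieldProduct_self (m : ℝ) (n : ℕ) :
    ∃ (ι : Type) (_ : Fintype ι) (_ : Nonempty ι) (c : ℂ) (σ : ι → Equiv.Perm (Fin n)), c ≠ 0 ∧
      ∀ (F : (Fin n → Vec s) → ℂ) (x : Fin n → Vec s),
        fieldProduct m n F n x = c * ∑ i, F fun j => x (σ i j) := by
  induction n with
  | zero =>
    refine ⟨Unit, inferInstance, inferInstance, 1, fun _ => 1, one_ne_zero, fun F x => ?_⟩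
    simp only [fieldProduct, if_true, Finset.univ_unique, Finset.sum_singleton, one_mul]
    congr 1
    exact Subsingleton.elim _ _
  | succ n ih =>
    obtain ⟨ι, hι, hne, c, σ, hc, h⟩ := ih
    refine ⟨Fin (n + 1) × ι, inferInstance, inferInstance, (√(n + 1 : ℝ) : ℂ)⁻¹ * c, fun a =>
      (Equiv.Perm.decomposeFin.symm (0, σ a.2)).trans a.1.cycleRange.symm, ?_, fun F x => ?_⟩
    · refine mul_ne_zero (inv_ne_zero ?_) hc
      exact_mod_cast (Real.sqrt_pos.2 (by positivity : (0 : ℝ) < n + 1)).ne'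
    · have h0 : annihilate m (fun p => fieldProduct m n fun p' => F (Fin.cons p p')) (n + 1) x = 0 := by
        simp [annihilate, fieldProduct_eq_zero m n _ (n + 1 + 1) (by omega)]
      rw [fieldProduct, Pi.add_apply, Pi.add_apply, h0, add_zero]
      simp only [create, h]
      rw [← Finset.mul_sum, mul_assoc, Fintype.sum_prod_type]
      congr 2
      refine Finset.sum_congr rfl fun i _ => Finset.sum_congr rfl fun l _ => ?_
      congr 1
      ext1 j
      refine Fin.cases ?_ (fun j => ?_) j
      · simp
      · simp [Fin.removeNth_apply]

theorem Lp_coeFn_sum {α ι : Type*} [MeasurableSpace α] {μ : Measure α} (t : Finset ι)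
    (f : ι → Lp ℂ 2 μ) : (∑ i ∈ t, f i : Lp ℂ 2 μ) =ᵐ[μ] fun x => ∑ i ∈ t, f i x := by
  classical
  induction t using Finset.induction_on with
  | empty => exact Lp.coeFn_zero ℂ 2 μ
  | insert i t hi ih =>
    rw [Finset.sum_insert hi]
    filter_upwards [Lp.coeFn_add (f i) (∑ i ∈ t, f i), ih] with x h1 h2
    rw [h1, Pi.add_apply, h2, Finset.sum_insert hi]

theorem coe_component_self (m : ℝ) [Fact (0 < m)] (n : ℕ) :
    ∃ (ι : Type) (_ : Fintype ι) (_ : Nonempty ι) (c : ℂ) (σ : ι → Equiv.Perm (Fin n)), c ≠ 0 ∧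
      ∀ f : TestFn s n, (component s m n n f : ParticleL2 s m n) = c • ∑ i,
        Lp.compMeasurePreservingₗᵢ ℂ (fun (x : Fin n → Vec s) j => x (σ i j))
          (measurePreserving_perm (massShell s m) (σ i)) ((momentum s n f).toLp 2 (shellPi s m n)) := by
  obtain ⟨ι, hι, hne, c, σ, hc, h⟩ := exists_fieldProduct_self (s := s) m n
  refine ⟨ι, hι, hne, c, σ, hc, fun f => ?_⟩
  rw [coe_component]
  refine Lp.ext ?_
  have h1 : ∀ i, (Lp.compMeasurePreservingₗᵢ ℂ (fun (x : Fin n → Vec s) j => x (σ i j))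
      (measurePreserving_perm (massShell s m) (σ i)) ((momentum s n f).toLp 2 (shellPi s m n)) :
        ParticleL2 s m n) =ᵐ[shellPi s m n] fun x => momentum s n f fun j => x (σ i j) := fun i =>
    (Lp.coeFn_compMeasurePreserving _ (measurePreserving_perm (massShell s m) (σ i))).trans
      ((measurePreserving_perm (massShell s m) (σ i)).quasiMeasurePreserving.ae_eq_comp
        ((momentum s n f).coeFn_toLp 2 (shellPi s m n)))
  have h2 := Lp_coeFn_sum (μ := shellPi s m n) Finset.univ fun i =>
    (Lp.compMeasurePreservingₗᵢ ℂ (fun (x : Fin n → Vec s) j => x (σ i j))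
      (measurePreserving_perm (massShell s m) (σ i)) ((momentum s n f).toLp 2 (shellPi s m n)) :
        ParticleL2 s m n)
  filter_upwards [(memLp_fieldProduct m f n).coeFn_toLp, Lp.coeFn_smul c (∑ i,
    (Lp.compMeasurePreservingₗᵢ ℂ (fun (x : Fin n → Vec s) j => x (σ i j))
      (measurePreserving_perm (massShell s m) (σ i)) ((momentum s n f).toLp 2 (shellPi s m n)) :
        ParticleL2 s m n)), h2, ae_all_iff.2 h1] with x e1 e2 e3 e4
  rw [e1, e2, Pi.smul_apply, e3, h, smul_eq_mul]
  simp only [e4]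

instance (m : ℝ) [Fact (0 < m)] : IsFiniteMeasureOnCompacts (massShell s m) := by
  refine ⟨fun K hK => ?_⟩
  obtain ⟨N, hN⟩ := Measure.HasTemperateGrowth.exists_integrable (μ := massShell s m)
  obtain ⟨r, hr⟩ := hK.isBounded.exists_norm_le
  refine (measure_mono fun x hx => ?_).trans_lt
    (hN.measure_norm_ge_lt_top (ε := (1 + max r 0) ^ (-(N : ℝ))) (by positivity))
  have h1 : ‖x‖ ≤ max r 0 := (hr x hx).trans (le_max_left _ _)
  change _ ≤ ‖_‖
  rw [Real.norm_of_nonneg (by positivity)]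
  exact Real.rpow_le_rpow_of_nonpos (by positivity) (by linarith) (by simp)

/-- The vacuum vector is cyclic: the vectors `φ(g) Ω` are dense in Fock space. -/
theorem denseRange_fockVec (m : ℝ) [Fact (0 < m)] : DenseRange (fockVec s m) := by
  have h0 : (LinearMap.range (fockVec s m))ᗮ = ⊥ := by
    rw [Submodule.eq_bot_iff]
    intro v hv
    ext1
    ext1 k
    induction k using Nat.strong_induction_on with
    | _ k ih =>
    obtain ⟨ι, hι, hne, c, σ, hc, h⟩ := coe_component_self (s := s) m k
    have h1 : ∀ f : TestFn s k, inner ℂ (component s m k k f) (v k) = 0 := fun f => by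
      have h2 := (Submodule.mem_orthogonal _ _).1 hv _
        ⟨DirectSum.lof ℂ ℕ (fun n => TestFn s n) k f, rfl⟩
      rw [fockVec_lof, sum_inner, Finset.sum_range_succ, Finset.sum_eq_zero fun j hj => by
        rw [lp.inner_single_left, ih j (Finset.mem_range.1 hj)]; exact inner_zero_right _, zero_add,
        lp.inner_single_left] at h2
      exact h2
    have h3 : ∀ f : TestFn s k,
        inner ℂ ((momentum s k f).toLp 2 (shellPi s m k)) (v k : ParticleL2 s m k) = 0 := fun f => by
      have h4 := h1 f
      rw [Submodule.coe_inner, h, inner_smul_left, sum_inner] at h4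
      have h5 : ∀ i, inner ℂ (Lp.compMeasurePreservingₗᵢ ℂ (fun (x : Fin k → Vec s) j => x (σ i j))
          (measurePreserving_perm (massShell s m) (σ i)) ((momentum s k f).toLp 2 (shellPi s m k)))
          (v k : ParticleL2 s m k) =
          inner ℂ ((momentum s k f).toLp 2 (shellPi s m k)) (v k : ParticleL2 s m k) := fun i => by
        have h6 : Lp.compMeasurePreservingₗᵢ ℂ (fun (x : Fin k → Vec s) j => x (σ i j))
          (measurePreserving_perm (massShell s m) (σ i)) (v k : ParticleL2 s m k) = v k :=
          (Submodule.mem_iInf _).1 (v k).2 (σ i)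
        conv_lhs => rw [← h6]
        exact LinearIsometry.inner_map_map _ _ _
      rw [Finset.sum_congr rfl fun i _ => h5 i, Finset.sum_const, nsmul_eq_mul] at h4
      have h7 := (mul_eq_zero.1 h4).resolve_left (by simpa using hc)
      exact (mul_eq_zero.1 h7).resolve_left (by simp [Finset.card_univ])
    have h8 : (v k : ParticleL2 s m k) = 0 := by
      have hd : DenseRange (SchwartzMap.toLpCLM ℝ ℂ 2 (shellPi s m k)) :=
        SchwartzMap.denseRange_toLpCLM (by norm_num)
      refine hd.eq_zero_of_inner_right ℂ fun F => ?_
      have := h3 ((momentum s k).symm F)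
      rwa [ContinuousLinearEquiv.apply_symm_apply] at this
    exact Subtype.ext h8
  rw [DenseRange, ← LinearMap.coe_range, Submodule.dense_iff_topologicalClosure_eq_top,
    Submodule.topologicalClosure_eq_top_iff, h0]

/-! ### Analyticity of the finite particle vectors -/

theorem conj_oneMomentum {f : TestFn s 1} (hf : ∀ x, conj (f x) = f x) (q : Vec s) :
    conj (oneMomentum f q) = oneMomentum f (-q) := by
  rw [oneMomentum, oneMomentum, momentum_apply, momentum_apply, map_mul, Complex.conj_ofReal,
    ← integral_conj]
  congr 1
  refine integral_congr_ae (Eventually.of_forall fun x => ?_)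
  simp only [map_mul, hf, ← Complex.exp_conj, Complex.conj_I, Complex.conj_ofReal, mink_neg_left,
    Finset.sum_neg_distrib]
  push_cast
  ring_nf

theorem prod_sqrt_le (N n : ℕ) :
    ∏ j ∈ Finset.range n, √((N + j : ℕ) + 1 : ℝ) ≤ √(2 ^ (N + n) * n.factorial) := by
  have h1 : ∏ j ∈ Finset.range n, √((N + j : ℕ) + 1 : ℝ) = √((N + 1).ascFactorial n) := by
    induction n with
    | zero => simp
    | succ n ih =>
      rw [Finset.prod_range_succ, ih, ← Real.sqrt_mul (by positivity), Nat.ascFactorial_succ]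
      congr 1
      push_cast
      ring
  rw [h1]
  refine Real.sqrt_le_sqrt ?_
  rw [Nat.ascFactorial_eq_factorial_mul_choose]
  push_cast
  rw [mul_comm]
  gcongr
  exact_mod_cast (Nat.choose_le_two_pow _ _)

theorem summable_pow_div_sqrt_factorial (x : ℝ) :
    Summable fun n : ℕ => |x| ^ n / √n.factorial := by
  have h1 : Summable fun n : ℕ => (4 * x ^ 2) ^ n / n.factorial + (1 / 4 : ℝ) ^ n :=
    (Real.summable_pow_div_factorial _).add (summable_geometric_of_lt_one (by norm_num) (by norm_num))
  refine Summable.of_nonneg_of_le (fun n => by positivity) (fun n => ?_) h1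
  have h2 : (0 : ℝ) < n.factorial := by exact_mod_cast n.factorial_pos
  have h3 : 0 < √(n.factorial : ℝ) := Real.sqrt_pos.2 h2
  -- the inequality `ab ≤ a² + b²` for `a = (2|x|)ⁿ / √n!` and `b = 2⁻ⁿ`
  set a := (2 * |x|) ^ n / √(n.factorial : ℝ)
  have h4 : |x| ^ n / √(n.factorial : ℝ) = a * (1 / 2) ^ n := by
    simp only [a]
    rw [mul_pow, div_mul_eq_mul_div, mul_right_comm, ← mul_pow]
    norm_num
  have h5 : (4 * x ^ 2) ^ n / n.factorial = a ^ 2 := by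
    simp only [a]
    rw [div_pow, Real.sq_sqrt h2.le, ← pow_mul, mul_comm n 2, pow_mul,
      show (2 * |x|) ^ 2 = 4 * x ^ 2 by rw [mul_pow, sq_abs]; norm_num]
  have h6 : (1 / 4 : ℝ) ^ n = ((1 / 2) ^ n) ^ 2 := by
    rw [← pow_mul, mul_comm n 2, pow_mul]; norm_num
  rw [h4, h5, h6]
  nlinarith [sq_nonneg (a - (1 / 2) ^ n), sq_nonneg a, sq_nonneg ((1 / 2 : ℝ) ^ n)]

/-- A bound of the type `‖Mⁿ Nᵏ v‖ ≤ D Cⁿ⁺ᵏ √(L + 1) ⋯ √(L + n + k)` makes the double power series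
of `e^{itM} e^{it'N} v` converge. -/
theorem summable_of_sqrt_bound {b : ℕ × ℕ → ℝ} (hb0 : ∀ a, 0 ≤ b a) {C D : ℝ} (hC : 0 ≤ C)
    (hD : 0 ≤ D) {L : ℕ}
    (hb : ∀ a, b a ≤ C ^ (a.1 + a.2) * (∏ j ∈ Finset.range (a.1 + a.2), √((L + j : ℕ) + 1 : ℝ)) * D)
    (t t' : ℝ) : Summable fun a : ℕ × ℕ =>
      |t| ^ a.1 / a.1.factorial * (|t'| ^ a.2 / a.2.factorial) * b a := by
  have h1 := ((summable_pow_div_sqrt_factorial (2 * C * t)).mul_of_nonneg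
    (summable_pow_div_sqrt_factorial (2 * C * t')) (fun n => by positivity)
    fun n => by positivity).mul_left (√(2 ^ L) * D)
  refine Summable.of_nonneg_of_le (fun a => mul_nonneg (by positivity) (hb0 a)) (fun a => ?_) h1
  obtain ⟨n, k⟩ := a
  have h2 : √(2 ^ (L + (n + k)) * ((n + k).factorial : ℝ)) ≤
      √(2 ^ L) * 2 ^ (n + k) * (√n.factorial * √k.factorial) := by
    have h3 : ((n + k).factorial : ℝ) ≤ 2 ^ (n + k) * (n.factorial * k.factorial) := by
      have := Nat.add_choose_mul_factorial_mul_factorial n k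
      rw [← this]
      push_cast
      rw [mul_assoc]
      gcongr
      exact_mod_cast (Nat.choose_le_two_pow _ _)
    have h4 : √((2 : ℝ) ^ L) * 2 ^ (n + k) * (√n.factorial * √k.factorial) =
        √(2 ^ L * (2 ^ (n + k)) ^ 2 * (n.factorial * k.factorial)) := by
      rw [Real.sqrt_mul (by positivity), Real.sqrt_mul (by positivity),
        Real.sqrt_sq (by positivity), Real.sqrt_mul (by positivity)]
    rw [h4]
    refine Real.sqrt_le_sqrt ?_
    rw [pow_add]
    calc (2 : ℝ) ^ L * 2 ^ (n + k) * ((n + k).factorial : ℝ)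
        ≤ 2 ^ L * 2 ^ (n + k) * (2 ^ (n + k) * (n.factorial * k.factorial)) := by gcongr
      _ = _ := by ring
  have h5 : b (n, k) ≤ C ^ (n + k) * (√(2 ^ L) * 2 ^ (n + k) * (√n.factorial * √k.factorial)) * D :=
    (hb (n, k)).trans (by
      gcongr
      exact (prod_sqrt_le L (n + k)).trans h2)
  have hn : √(n.factorial : ℝ) * √n.factorial = n.factorial := Real.mul_self_sqrt (by positivity)
  have hk : √(k.factorial : ℝ) * √k.factorial = k.factorial := Real.mul_self_sqrt (by positivity)
  have hn0 : 0 < √(n.factorial : ℝ) := Real.sqrt_pos.2 (by exact_mod_cast n.factorial_pos)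
  have hk0 : 0 < √(k.factorial : ℝ) := Real.sqrt_pos.2 (by exact_mod_cast k.factorial_pos)
  calc |t| ^ n / n.factorial * (|t'| ^ k / k.factorial) * b (n, k)
      ≤ |t| ^ n / n.factorial * (|t'| ^ k / k.factorial) *
        (C ^ (n + k) * (√(2 ^ L) * 2 ^ (n + k) * (√n.factorial * √k.factorial)) * D) := by
        gcongr
    _ = √(2 ^ L) * D * (|2 * C * t| ^ n / √n.factorial * (|2 * C * t'| ^ k / √k.factorial)) := by
        have e : ∀ u : ℝ, |2 * C * u| = 2 * C * |u| := fun u => by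
          rw [abs_mul, abs_of_nonneg (by positivity)]
        rw [e, e]
        generalize √(n.factorial : ℝ) = rn at hn hn0 ⊢
        generalize √(k.factorial : ℝ) = rk at hk hk0 ⊢
        rw [← hn, ← hk]
        simp only [mul_pow, pow_add]
        field_simp

/-- Maps on test functions that raise the particle number by at most one and are bounded by the
square root of the number operator. -/
def IsNumberBounded (m : ℝ) [Fact (0 < m)] (C : ℝ) (M : BUAlg s →ₗ[ℂ] BUAlg s) : Prop :=
  ∀ (N : ℕ) (g : BUAlg s), IsFockState N (fockRep s m g) → IsFockState (N + 1) (fockRep s m (M g)) ∧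
    componentSum m (N + 1) (fockRep s m (M g)) ≤ C * √(N + 1) * componentSum m N (fockRep s m g)

theorem IsNumberBounded.mono {m : ℝ} [Fact (0 < m)] {C C' : ℝ} {M : BUAlg s →ₗ[ℂ] BUAlg s}
    (hM : IsNumberBounded m C M) (h : C ≤ C') : IsNumberBounded m C' M := fun N g hg =>
  ⟨(hM N g hg).1, (hM N g hg).2.trans (by have := componentSum_nonneg m N (fockRep s m g); gcongr)⟩

theorem IsNumberBounded.pow {m : ℝ} [Fact (0 < m)] {C : ℝ} (hC : 0 ≤ C) {M : BUAlg s →ₗ[ℂ] BUAlg s}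
    (hM : IsNumberBounded m C M) (n : ℕ) {N : ℕ} {g : BUAlg s} (hg : IsFockState N (fockRep s m g)) :
    IsFockState (N + n) (fockRep s m ((M ^ n) g)) ∧
      componentSum m (N + n) (fockRep s m ((M ^ n) g)) ≤
        C ^ n * (∏ j ∈ Finset.range n, √((N + j : ℕ) + 1 : ℝ)) *
          componentSum m N (fockRep s m g) := by
  induction n with
  | zero => exact ⟨hg, by simp⟩
  | succ n ih =>
    obtain ⟨h1, h2⟩ := hM _ _ ih.1
    rw [pow_succ', Module.End.mul_apply]
    refine ⟨h1, h2.trans ((mul_le_mul_of_nonneg_left ih.2 (by positivity)).trans (le_of_eq ?_))⟩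
    rw [Finset.prod_range_succ, pow_succ]
    ring

theorem summable_of_isNumberBounded {m : ℝ} [Fact (0 < m)] {C : ℝ} (hC : 0 ≤ C)
    {M M' : BUAlg s →ₗ[ℂ] BUAlg s} (hM : IsNumberBounded m C M) (hM' : IsNumberBounded m C M')
    (g : BUAlg s) (t t' : ℝ) : Summable fun a : ℕ × ℕ =>
      |t| ^ a.1 / a.1.factorial * (|t'| ^ a.2 / a.2.factorial) *
        ‖fockVec s m ((M ^ a.1) ((M' ^ a.2) g))‖ := by
  obtain ⟨N, hN⟩ := exists_isFockState m g
  refine summable_of_sqrt_bound (b := fun a => ‖fockVec s m ((M ^ a.1) ((M' ^ a.2) g))‖) (L := N)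
    (fun a => norm_nonneg _) hC (componentSum_nonneg m N (fockRep s m g)) (fun a => ?_) t t'
  obtain ⟨h1, h2⟩ := hM'.pow hC a.2 hN
  obtain ⟨h3, h4⟩ := hM.pow hC a.1 h1
  refine (norm_fockVec_le m h3).trans (h4.trans
    ((mul_le_mul_of_nonneg_left h2 (by positivity)).trans (le_of_eq ?_)))
  rw [add_comm a.1, Finset.prod_range_add, pow_add]
  simp only [add_assoc]
  ring

theorem isNumberBounded_deformedMul (m : ℝ) [Fact (0 < m)] {R : ℝ → ℂ} (hR : IsDeformationFunction R)
    {Q : Matrix (Fin (s + 2)) (Fin (s + 2)) ℝ}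
    (hQ : ∀ x y : Vec s, mink x (Q.mulVec y) = -mink (Q.mulVec x) y) {f : TestFn s 1}
    (hf : ∀ x, conj (f x) = f x) :
    IsNumberBounded m (2 * (eLpNorm (oneMomentum f) 2 (massShell s m)).toReal)
      (deformedMul R Q (oneParticle f)) := fun N g hg => by
  rw [fockRep_deformedMul m hR hQ]
  exact ⟨hg.fieldFn m (isExchange_exchange hR hQ) (rapidDecay_oneMomentum f),
    componentSum_fieldFn_le m (isExchange_exchange hR hQ) (rapidDecay_oneMomentum f)
      (conj_oneMomentum hf) hg⟩

theorem isEntireSymmetric_deformedMul (m : ℝ) [Fact (0 < m)] {R : ℝ → ℂ}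
    (hR : IsDeformationFunction R) {Q : Matrix (Fin (s + 2)) (Fin (s + 2)) ℝ}
    (hQ : ∀ x y : Vec s, mink x (Q.mulVec y) = -mink (Q.mulVec x) y) {f : TestFn s 1}
    (hf : ∀ x, conj (f x) = f x) :
    IsEntireSymmetric (fockVec s m) (deformedMul R Q (oneParticle f)) where
  dense := denseRange_fockVec m
  symm h g := by
    obtain ⟨N, hN⟩ := exists_isFockState m h
    obtain ⟨N', hN'⟩ := exists_isFockState m g
    have hh := hN.mono (le_max_left N N')
    have hg := hN'.mono (le_max_right N N')
    have hS := isExchange_exchange hR hQ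
    rw [inner_fockVec m (N := max N N' + 1) (K := max N N' + 2) (by
        rw [fockRep_deformedMul m hR hQ]; exact hg.fieldFn m hS (rapidDecay_oneMomentum f)) (by omega),
      inner_fockVec m (K := max N N' + 2) hg (by omega), fockRep_deformedMul m hR hQ,
      fockRep_deformedMul m hR hQ]
    exact sum_pairing_fieldFn m hS (rapidDecay_oneMomentum f) (conj_oneMomentum hf) hh hg
  summable g t := by
    have hb := isNumberBounded_deformedMul m hR hQ hf
    have h1 := (summable_of_isNumberBounded (by positivity) hb hb g t 0).comp_injective
      (i := fun n : ℕ => (n, 0)) fun a b hab => congrArg Prod.fst hab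
    refine Summable.of_norm (h1.congr fun n => ?_)
    simp

theorem field_eq_inducedOp (m : ℝ) [Fact (0 < m)] (R : ℝ → ℂ)
    (Q : Matrix (Fin (s + 2)) (Fin (s + 2)) ℝ) (f : BUAlg s) :
    field m R Q f = inducedOp (fockVec s m) (deformedMul R Q f) := rfl

/-! ### The commutator of two deformed fields with transposed kernels -/

theorem prod_succAbove_eq {M : Type*} [CommMonoid M] {X : Type*} {n : ℕ} (x : Fin (n + 1) → X)
    (l : Fin (n + 1)) (u : X → M) : ∏ j, u (x j) = u (x l) * ∏ j, u (l.removeNth x j) := by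
  rw [Fin.prod_univ_succAbove _ l]; rfl

/-- Creation operators commute because of the transposed kernels: the factor that the first particle
acquires from the second equals the one that the second acquires from the first. -/
theorem create_create_comm {S T : Vec s → Vec s → ℂ} (hT : ∀ p x, T p x = S x p) (f g : Vec s → ℂ)
    (ψ : FockFn s) : create (dressed S f (create (dressed T g ψ))) =
      create (dressed T g (create (dressed S f ψ))) := by
  ext k x
  rcases k with _ | _ | k
  · rfl
  · simp [create, dressed]
  · simp only [create, dressed]
    congr 1
    simp only [Finset.mul_sum]
    rw [← Finset.sum_product', ← Finset.sum_product']
    -- the pair `(i, l)` stands for the positions `i` and `i.succAbove l`, which are exchanged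
    refine Finset.sum_nbij' (fun a => (a.1.succAbove a.2, a.2.predAbove a.1))
      (fun a => (a.1.succAbove a.2, a.2.predAbove a.1)) (by simp) (by simp) ?_ ?_ ?_
    · rintro ⟨i, l⟩ -
      exact Prod.ext (Fin.succAbove_succAbove_predAbove i l) (Fin.predAbove_predAbove_succAbove i l)
    · rintro ⟨i, l⟩ -
      exact Prod.ext (Fin.succAbove_succAbove_predAbove i l) (Fin.predAbove_predAbove_succAbove i l)
    · rintro ⟨i, l⟩ -
      have h1 : x ((i.succAbove l).succAbove (l.predAbove i)) = x i :=
        congrArg x (Fin.succAbove_succAbove_predAbove i l)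
      simp only
      rw [prod_succAbove_eq (i.removeNth x) l, prod_succAbove_eq ((i.succAbove l).removeNth x)
        (l.predAbove i), ← Fin.removeNth_removeNth_eq_swap x l i]
      simp only [Fin.removeNth_apply i, Fin.removeNth_apply (i.succAbove l), h1, hT (x (i.succAbove l)) (x i)]
      ring

theorem annihilate_annihilate_comm (m : ℝ) [Fact (0 < m)] {S T : Vec s → Vec s → ℂ}
    (hS : IsExchange S) (hT : IsExchange T) (hTS : ∀ p x, T p x = S x p) {f g : Vec s → ℂ}
    (hf : RapidDecay f) (hg : RapidDecay g) {N : ℕ} {ψ : FockFn s} (hψ : IsFockState N ψ) :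
    annihilate m (dressed S f (annihilate m (dressed T g ψ))) =
      annihilate m (dressed T g (annihilate m (dressed S f ψ))) := by
  have key : ∀ {S T : Vec s → Vec s → ℂ} (_ : IsExchange S) (_ : IsExchange T)
      (_ : ∀ p x, T p x = S x p) (f g : Vec s → ℂ) (k : ℕ) (x : Fin k → Vec s),
      annihilate m (dressed S f (annihilate m (dressed T g ψ))) k x =
        √(k + 1 : ℝ) * (√((k + 1 : ℕ) + 1 : ℝ) * ∫ q, ∫ p, f (-q) * g (-p) * (S q (-p) *
          ((∏ j, S (-q) (x j)) * (∏ j, T (-p) (x j))) *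
          ψ (k + 2) (Fin.cons p (Fin.cons q x))) ∂massShell s m ∂massShell s m) := by
    intro S T hS hT hTS f g k x
    simp only [annihilate, dressed]
    congr 1
    rw [← integral_const_mul]
    refine integral_congr_ae (Eventually.of_forall fun q => ?_)
    simp only
    have e : ∀ a b c d : ℂ, a * (b * (c * d)) = c * (a * b * d) := by intros; ring
    rw [e, ← integral_const_mul]
    congr 1
    refine integral_congr_ae (Eventually.of_forall fun p => ?_)
    simp only [Fin.prod_univ_succ, Fin.cons_zero, Fin.cons_succ]
    have h1 := hS.neg_left_mul q q
    have h2 := hT.neg_left_mul p p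
    rw [hS.self, mul_one] at h1
    rw [hT.self, mul_one] at h2
    rw [h1, h2, hTS (-p) q]
    ring
  have hint : ∀ (k : ℕ) (x : Fin k → Vec s), Integrable (fun z : Vec s × Vec s =>
      f (-z.1) * g (-z.2) * (S z.1 (-z.2) * ((∏ j, S (-z.1) (x j)) * (∏ j, T (-z.2) (x j))) *
        ψ (k + 2) (Fin.cons z.2 (Fin.cons z.1 x)))) ((massShell s m).prod (massShell s m)) := by
    intro k x
    have hf' := (hf.comp (a := fun q : Vec s => -q) (by fun_prop) (by simp)).integrable (massShell s m)
    have hg' := (hg.comp (a := fun q : Vec s => -q) (by fun_prop) (by simp)).integrable (massShell s m)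
    obtain ⟨C, -, hC⟩ := (hψ.rapidDecay (k + 2)).exists_norm_le
    refine (hf'.mul_prod hg').mul_bdd (c := C) ?_ (Eventually.of_forall fun z => ?_)
    · refine Continuous.aestronglyMeasurable ?_
      have h1 : Continuous fun z : Vec s × Vec s => S z.1 (-z.2) :=
        hS.continuous.comp (f := fun z : Vec s × Vec s => (z.1, -z.2)) (by fun_prop)
      have h2 : ∀ j, Continuous fun z : Vec s × Vec s => S (-z.1) (x j) := fun j =>
        hS.continuous.comp (f := fun z : Vec s × Vec s => (-z.1, x j)) (by fun_prop)
      have h3 : ∀ j, Continuous fun z : Vec s × Vec s => T (-z.2) (x j) := fun j =>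
        hT.continuous.comp (f := fun z : Vec s × Vec s => (-z.2, x j)) (by fun_prop)
      exact (h1.mul ((continuous_finsetProd _ fun j _ => h2 j).mul
        (continuous_finsetProd _ fun j _ => h3 j))).mul ((hψ.rapidDecay (k + 2)).1.comp
          (continuous_cons continuous_snd (continuous_cons continuous_fst continuous_const)))
    · rw [norm_mul, norm_mul, norm_mul, hS.norm_eq_one, hS.norm_prod, hT.norm_prod]
      simpa using hC _
  ext k x
  rw [key hS hT hTS, key hT hS fun p x => (hTS x p).symm]
  rw [integral_integral_swap (hint k x)]
  congr 2
  refine integral_congr_ae (Eventually.of_forall fun p => integral_congr_ae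
    (Eventually.of_forall fun q => ?_))
  simp only
  have h1 : S q (-p) = T p (-q) := by
    have h0 : S q p ≠ 0 := fun h => by simpa [h] using hS.norm_eq_one q p
    rw [hTS]
    exact mul_right_cancel₀ h0 ((hS.neg_right_mul q p).trans (hS.neg_left_mul q p).symm)
  have h2 : ψ (k + 2) (Fin.cons p (Fin.cons q x)) = ψ (k + 2) (Fin.cons q (Fin.cons p x)) := by
    rw [← hψ.perm (k + 2) (Equiv.swap 0 1) (Fin.cons p (Fin.cons q x))]
    congr 1
    ext1 j
    refine Fin.cases ?_ (fun j => Fin.cases ?_ (fun j => ?_) j) j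
    · rw [Equiv.swap_apply_left]; rfl
    · rw [show (Fin.succ 0 : Fin (k + 2)) = 1 from rfl, Equiv.swap_apply_right]; rfl
    · rw [Equiv.swap_apply_of_ne_of_ne (Fin.succ_ne_zero _)]
      · rfl
      · exact fun h => Fin.succ_ne_zero j (Fin.succ_injective _ h)
  rw [h1, h2]
  ring

/-- Moving an annihilation operator past a creation operator produces the contraction of `f` and
`g`, which carries the kernels of all the other particles. -/
theorem annihilate_create (m : ℝ) [Fact (0 < m)] {S T : Vec s → Vec s → ℂ}
    (hS : IsExchange S) (hT : IsExchange T) (hTS : ∀ p x, T p x = S x p) {f g : Vec s → ℂ}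
    (hf : RapidDecay f) (hg : RapidDecay g) {ψ : FockFn s} (hψ : ∀ k, RapidDecay (ψ k)) (k : ℕ)
    (x : Fin k → Vec s) :
    annihilate m (dressed S f (create (dressed T g ψ))) k x =
      create (dressed T g (annihilate m (dressed S f ψ))) k x +
        (∫ q, f (-q) * g q * ∏ j, (S (-q) (x j) * T q (x j)) ∂massShell s m) * ψ k x := by
  have hk : (√(k + 1 : ℝ) : ℂ) ≠ 0 := by
    exact_mod_cast (Real.sqrt_pos.2 (by positivity : (0 : ℝ) < k + 1)).ne'
  have hs : ∀ q, S (-q) q = 1 := fun q => by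
    have h1 := hS.neg_left_mul q q
    rwa [hS.self, mul_one] at h1
  have h0 : ∀ q, dressed S f (create (dressed T g ψ)) (-q) (k + 1) (Fin.cons q x) =
      (√(k + 1 : ℝ) : ℂ)⁻¹ * (f (-q) * g q * (∏ j, (S (-q) (x j) * T q (x j))) * ψ k x +
        ∑ l : Fin k, f (-q) * (∏ j, S (-q) (x j)) * (g (x l) * ((∏ j, T (x l)
          ((l.succ.removeNth (Fin.cons q x : Fin (k + 1) → Vec s)) j)) * ψ k
            (l.succ.removeNth (Fin.cons q x : Fin (k + 1) → Vec s))))) := fun q => by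
    simp only [dressed, create]
    rw [Fin.sum_univ_succ]
    simp only [Fin.prod_univ_succ, Fin.cons_zero, Fin.cons_succ, hs, one_mul,
      Fin.removeNth_zero, Fin.tail_cons, Finset.prod_mul_distrib, ← Finset.mul_sum]
    ring
  have hone : ∀ q, ‖∏ j, (S (-q) (x j) * T q (x j))‖ = 1 := fun q => by
    simp [hS.norm_eq_one, hT.norm_eq_one]
  have hi0 : Integrable (fun q => f (-q) * g q * (∏ j, (S (-q) (x j) * T q (x j))))
      (massShell s m) := by
    have hf' := hf.comp (a := fun q : Vec s => -q) (by fun_prop) (by simp)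
    refine ((hg.bounded_mul hf').integrable (massShell s m)).mul_bdd (c := 1) ?_
      (Eventually.of_forall fun q => (hone q).le)
    refine (continuous_finsetProd _ fun j _ => ?_).aestronglyMeasurable
    exact (hS.continuous.comp (f := fun q : Vec s => (-q, x j)) (by fun_prop)).mul
      (hT.continuous.comp (f := fun q : Vec s => (q, x j)) (by fun_prop))
  rcases k with _ | k
  · simp only [annihilate, h0, create, Finset.univ_eq_empty, Finset.sum_empty, add_zero, zero_add]
    rw [integral_const_mul, integral_mul_const, mul_inv_cancel_left₀ hk]
  have h1 : ∀ (q : Vec s) (l : Fin (k + 1)),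
      (l.succ.removeNth (Fin.cons q x : Fin (k + 2) → Vec s)) = Fin.cons q (l.removeNth x) :=
    fun q l => by
      ext1 j
      refine Fin.cases ?_ (fun j => ?_) j <;> simp [Fin.removeNth_apply]
  have h2 : ∀ (q : Vec s) (l : Fin (k + 1)), f (-q) * (∏ j, S (-q) (x j)) * (g (x l) * ((∏ j, T (x l)
      ((l.succ.removeNth (Fin.cons q x : Fin (k + 2) → Vec s)) j)) * ψ (k + 1)
        (l.succ.removeNth (Fin.cons q x : Fin (k + 2) → Vec s)))) =
      g (x l) * (∏ j, T (x l) (l.removeNth x j)) *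
        dressed S f ψ (-q) (k + 1) (Fin.cons q (l.removeNth x)) := fun q l => by
    rw [h1, dressed, prod_succAbove_eq x l (S (-q))]
    simp only [Fin.prod_univ_succ, Fin.cons_zero, Fin.cons_succ, hs, one_mul]
    rw [hTS (x l) q]
    linear_combination f (-q) * (∏ j, S (-q) (l.removeNth x j)) * g (x l) *
      (∏ j, T (x l) (l.removeNth x j)) * ψ (k + 1) (Fin.cons q (l.removeNth x)) *
      hS.neg_left_mul q (x l)
  have hi1 : ∀ l : Fin (k + 1), Integrable (fun q => g (x l) * (∏ j, T (x l) (l.removeNth x j)) *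
        dressed S f ψ (-q) (k + 1) (Fin.cons q (l.removeNth x))) (massShell s m) := fun l =>
    (RapidDecay.integrable_annihilate m (RapidDecay.dressed hS hf hψ) (l.removeNth x)).const_mul _
  simp only [annihilate, h0, h2, create]
  rw [integral_const_mul, mul_inv_cancel_left₀ hk, integral_add (hi0.mul_const _)
    (integrable_finsetSum _ fun l _ => hi1 l), integral_mul_const,
    integral_finsetSum _ fun l _ => hi1 l, add_comm]
  congr 1
  rw [Finset.mul_sum]
  refine Finset.sum_congr rfl fun l _ => ?_
  have hk' : (√(k + 1 : ℝ) : ℂ) ≠ 0 := by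
    exact_mod_cast (Real.sqrt_pos.2 (by positivity : (0 : ℝ) < k + 1)).ne'
  rw [integral_const_mul, dressed, annihilate]
  field_simp

/-- Two deformed fields with transposed kernels commute up to the difference of their two
contractions. -/
theorem fieldFn_comm (m : ℝ) [Fact (0 < m)] {S T : Vec s → Vec s → ℂ}
    (hS : IsExchange S) (hT : IsExchange T) (hTS : ∀ p x, T p x = S x p) {f g : Vec s → ℂ}
    (hf : RapidDecay f) (hg : RapidDecay g) {N : ℕ} {ψ : FockFn s} (hψ : IsFockState N ψ) (k : ℕ)
    {x : Fin k → Vec s}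
    (h : ∫ q, f (-q) * g q * ∏ j, (S (-q) (x j) * T q (x j)) ∂massShell s m =
      ∫ q, g (-q) * f q * ∏ j, (T (-q) (x j) * S q (x j)) ∂massShell s m) :
    fieldFn m S f (fieldFn m T g ψ) k x = fieldFn m T g (fieldFn m S f ψ) k x := by
  have expand : ∀ {S T : Vec s → Vec s → ℂ} (_ : IsExchange S) (_ : IsExchange T) {f g : Vec s → ℂ}
      (_ : RapidDecay f) (_ : RapidDecay g), fieldFn m S f (fieldFn m T g ψ) =
        create (dressed S f (create (dressed T g ψ))) +
          annihilate m (dressed S f (create (dressed T g ψ))) +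
          (create (dressed S f (annihilate m (dressed T g ψ))) +
          annihilate m (dressed S f (annihilate m (dressed T g ψ)))) := fun hS hT _ _ hf hg => by
    conv_lhs => rw [fieldFn.eq_1 m _ _ ψ]
    rw [fieldFn_add m hS hf (hψ.create hT hg).rapidDecay (hψ.annihilate m hT hg).rapidDecay]
    rfl
  rw [expand hS hT hf hg, expand hT hS hg hf, create_create_comm hTS,
    annihilate_annihilate_comm m hS hT hTS hf hg hψ]
  simp only [Pi.add_apply]
  rw [annihilate_create m hS hT hTS hf hg hψ.rapidDecay,
    annihilate_create m hT hS (fun p x => (hTS x p).symm) hg hf hψ.rapidDecay, h]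
  ring

/-! ### Rapidity coordinates on the mass shell -/

/-- The transversal energy `(m² + k²)^{1/2}` of the momentum components `k` along the edge of the
wedge. -/
noncomputable def transEnergy (m : ℝ) (k : Fin s → ℝ) : ℝ := √(∑ j, k j ^ 2 + m ^ 2)

/-- The point of the upper mass shell with rapidity `θ` and transversal momentum `k`. -/
noncomputable def rapidityPoint (m : ℝ) (z : ℝ × (Fin s → ℝ)) : Vec s :=
  Fin.cons (transEnergy m z.2 * Real.cosh z.1) (Fin.cons (transEnergy m z.2 * Real.sinh z.1) z.2)

theorem transEnergy_pos {m : ℝ} [hm : Fact (0 < m)] (k : Fin s → ℝ) : 0 < transEnergy m k :=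
  Real.sqrt_pos.2 (by have := hm.out; positivity)

theorem transEnergy_neg (m : ℝ) (k : Fin s → ℝ) : transEnergy m (-k) = transEnergy m k := by
  simp [transEnergy]

theorem continuous_rapidityPoint (m : ℝ) : Continuous (rapidityPoint (s := s) m) := by
  have h : Continuous fun z : ℝ × (Fin s → ℝ) => transEnergy m z.2 := by
    unfold transEnergy; fun_prop
  refine continuous_pi fun μ => ?_
  refine Fin.cases ?_ (fun j => Fin.cases ?_ (fun j => ?_) j) μ
  · exact h.mul (Real.continuous_cosh.comp continuous_fst)
  · exact h.mul (Real.continuous_sinh.comp continuous_fst)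
  · exact (continuous_apply j).comp continuous_snd

theorem energy_cons_sinh (m : ℝ) [hm : Fact (0 < m)] (θ : ℝ) (k : Fin s → ℝ) :
    energy m (Fin.cons (transEnergy m k * Real.sinh θ) k : Fin (s + 1) → ℝ) =
      transEnergy m k * Real.cosh θ := by
  rw [energy, Fin.sum_univ_succ]
  simp only [Fin.cons_zero, Fin.cons_succ]
  rw [Real.sqrt_eq_iff_mul_self_eq_of_pos (mul_pos (transEnergy_pos k) (Real.cosh_pos θ))]
  have h1 : transEnergy m k * transEnergy m k = ∑ j, k j ^ 2 + m ^ 2 :=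
    Real.mul_self_sqrt (by positivity)
  have h2 := Real.cosh_sq θ
  linear_combination Real.cosh θ ^ 2 * h1 + (∑ j, k j ^ 2 + m ^ 2) * h2 -
    Real.sinh θ ^ 2 * h1

/-- In rapidity coordinates the invariant measure of the mass shell is Lebesgue measure. -/
theorem massShell_eq_map_rapidityPoint (m : ℝ) [hm : Fact (0 < m)] :
    massShell s m = Measure.map (rapidityPoint m) volume := by
  refine Measure.ext_of_lintegral _ fun G hG => ?_
  have hE : Measurable fun k : Fin (s + 1) → ℝ => ENNReal.ofReal (energy m k)⁻¹ :=
    ((continuous_energy m).measurable.inv).ennreal_ofReal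
  have hG' : Measurable fun k : Fin (s + 1) → ℝ => G (onShell m k) :=
    hG.comp (continuous_onShell m).measurable
  rw [massShell, lintegral_map hG (continuous_onShell m).measurable,
    lintegral_withDensity_eq_lintegral_mul _ hE hG',
    lintegral_map hG (continuous_rapidityPoint m).measurable,
    ← ((volume_preserving_piFinSuccAbove (fun _ : Fin (s + 1) => ℝ) 0).symm.lintegral_comp_emb
      (MeasurableEquiv.measurableEmbedding _)), Measure.volume_eq_prod, lintegral_prod_symm,
      lintegral_prod_symm]
  · refine lintegral_congr fun k => ?_
    have h1 := lintegral_image_eq_lintegral_abs_deriv_mul (s := Set.univ)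
      (f := fun θ => transEnergy m k * Real.sinh θ) (f' := fun θ => transEnergy m k * Real.cosh θ)
      MeasurableSet.univ
      (fun θ _ => ((Real.hasDerivAt_sinh θ).const_mul _).hasDerivWithinAt)
      (fun a _ b _ hab => Real.sinh_injective (mul_left_cancel₀ (transEnergy_pos k).ne' hab))
      (fun a => ENNReal.ofReal (energy m (Fin.cons a k : Fin (s + 1) → ℝ))⁻¹ *
        G (onShell m (Fin.cons a k : Fin (s + 1) → ℝ)))
    have h2 : (fun θ => transEnergy m k * Real.sinh θ) '' Set.univ = Set.univ := by
      rw [Set.image_univ, Set.range_eq_univ]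
      exact (mul_left_surjective₀ (transEnergy_pos k).ne').comp Real.sinh_surjective
    rw [h2, Measure.restrict_univ] at h1
    refine Eq.trans ?_ (h1.trans ?_)
    · refine lintegral_congr fun a => ?_
      simp [MeasurableEquiv.piFinSuccAbove, Fin.insertNthEquiv]
    · refine lintegral_congr fun θ => ?_
      have h3 : 0 < transEnergy m k * Real.cosh θ := mul_pos (transEnergy_pos k) (Real.cosh_pos θ)
      rw [energy_cons_sinh, ← mul_assoc, ← ENNReal.ofReal_mul (abs_nonneg _),
        abs_of_pos h3, mul_inv_cancel₀ h3.ne', ENNReal.ofReal_one, one_mul, onShell,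
        energy_cons_sinh, rapidityPoint]
  · exact (hG.comp (continuous_rapidityPoint m).measurable).aemeasurable
  · exact ((hE.mul hG').comp (MeasurableEquiv.measurable _)).aemeasurable

/-! ### Shifting a contour across a strip -/

/-- Cauchy's theorem for an entire function that is dominated in the strip `0 ≤ im ζ ≤ b` by an
integrable function of `re ζ` vanishing at infinity. -/
theorem integral_eq_integral_add_mul_I {H : ℂ → ℂ} (hH : Differentiable ℂ H) {b : ℝ} (hb : 0 ≤ b)
    {B : ℝ → ℝ} (hB : Tendsto B (cocompact ℝ) (𝓝 0)) (hBi : Integrable B)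
    (hle : ∀ x y : ℝ, 0 ≤ y → y ≤ b → ‖H (x + y * Complex.I)‖ ≤ B x) :
    ∫ x : ℝ, H x = ∫ x : ℝ, H (x + b * Complex.I) := by
  have hc : ∀ y : ℝ, Continuous fun x : ℝ => H (x + y * Complex.I) := fun y =>
    hH.continuous.comp (by fun_prop)
  have hi : ∀ y : ℝ, 0 ≤ y → y ≤ b → Integrable fun x : ℝ => H (x + y * Complex.I) := fun y h0 h1 =>
    hBi.mono' (hc y).aestronglyMeasurable (Eventually.of_forall fun x => hle x y h0 h1)
  have h0 : Integrable fun x : ℝ => H x := by simpa using hi 0 le_rfl hb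
  have hrect : ∀ T : ℝ, ((∫ x : ℝ in -T..T, H x) - ∫ x : ℝ in -T..T, H (x + b * Complex.I)) =
      Complex.I • (∫ y : ℝ in (0 : ℝ)..b, H ((-T : ℝ) + y * Complex.I)) -
        Complex.I • ∫ y : ℝ in (0 : ℝ)..b, H (T + y * Complex.I) := fun T => by
    have := Complex.integral_boundary_rect_eq_zero_of_differentiableOn H (-T : ℝ)
      ((T : ℂ) + b * Complex.I) hH.differentiableOn
    simp at this
    push_cast
    linear_combination this
  have h1 : Tendsto (fun T : ℝ => (∫ x : ℝ in -T..T, H x) - ∫ x : ℝ in -T..T, H (x + b * Complex.I))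
      atTop (𝓝 ((∫ x : ℝ, H x) - ∫ x : ℝ, H (x + b * Complex.I))) :=
    (intervalIntegral_tendsto_integral h0 tendsto_neg_atTop_atBot tendsto_id).sub
      (intervalIntegral_tendsto_integral (hi b hb le_rfl) tendsto_neg_atTop_atBot tendsto_id)
  have h2 : ∀ u : ℝ, ‖∫ y : ℝ in (0 : ℝ)..b, H (u + y * Complex.I)‖ ≤ B u * |b - 0| := fun u =>
    intervalIntegral.norm_integral_le_of_norm_le_const fun y hy => by
      rw [Set.uIoc_of_le hb] at hy
      exact hle u y hy.1.le hy.2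
  have hside : ∀ {l : Filter ℝ} (u : ℝ → ℝ), Tendsto u l (cocompact ℝ) →
      Tendsto (fun T => Complex.I • ∫ y : ℝ in (0 : ℝ)..b, H (u T + y * Complex.I)) l (𝓝 0) :=
    fun {l} u hu => by
      have h4 : Tendsto (fun T => ∫ y : ℝ in (0 : ℝ)..b, H (u T + y * Complex.I)) l (𝓝 0) :=
        squeeze_zero_norm (fun T => h2 (u T)) (by simpa using (hB.comp hu).mul_const |b - 0|)
      simpa using h4.const_smul Complex.I
  have h3 := (hside (fun T => -T) (tendsto_neg_atTop_atBot.mono_right atBot_le_cocompact)).sub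
    (hside (fun T => T) (tendsto_id.mono_right atTop_le_cocompact))
  rw [sub_zero] at h3
  exact sub_eq_zero.1 (tendsto_nhds_unique (h1.congr hrect) h3)

/-! ### Locality of the free two-point function -/

/-- The analytic continuation of `q · w` in the rapidity of the on-shell momentum `q`. -/
noncomputable def rapidityPhase (m : ℝ) (k : Fin s → ℝ) (w : Vec s) (ζ : ℂ) : ℂ :=
  transEnergy m k * Complex.cosh ζ * w 0 - transEnergy m k * Complex.sinh ζ * w 1 -
    ∑ j, (k j : ℂ) * w j.succ.succ

theorem rapidityPhase_ofReal (m : ℝ) (k : Fin s → ℝ) (w : Vec s) (θ : ℝ) :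
    rapidityPhase m k w θ = (mink (rapidityPoint m (θ, k)) w : ℝ) := by
  rw [rapidityPhase, mink, Fin.sum_univ_succ]
  simp [rapidityPoint]
  ring

/-- Shifting the rapidity by `iπ` reflects the momentum, up to the sign of the transversal part. -/
theorem rapidityPhase_add_pi (m : ℝ) (k : Fin s → ℝ) (w : Vec s) (θ : ℝ) :
    rapidityPhase m k w (θ + Real.pi * Complex.I) = -(mink (rapidityPoint m (θ, -k)) w : ℝ) := by
  rw [rapidityPhase, mink, Fin.sum_univ_succ, Complex.cosh_add, Complex.sinh_add,
    Complex.cosh_mul_I, Complex.sinh_mul_I]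
  simp [rapidityPoint, transEnergy_neg]
  ring

theorem differentiable_rapidityPhase (m : ℝ) (k : Fin s → ℝ) (w : Vec s) :
    Differentiable ℂ (rapidityPhase m k w) := by
  unfold rapidityPhase
  fun_prop

/-- With `im cosh (x + iy) = sinh x sin y` and `im sinh (x + iy) = cosh x sin y`, the sign comes
from `sin y ≥ 0` in the strip and from `|w⁰| < w¹`. -/
theorem im_rapidityPhase_nonpos (m : ℝ) [Fact (0 < m)] (k : Fin s → ℝ) {w : Vec s}
    (hw : w ∈ rightWedge s) (x : ℝ) {y : ℝ} (h0 : 0 ≤ y) (h1 : y ≤ Real.pi) :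
    (rapidityPhase m k w (x + y * Complex.I)).im ≤ 0 := by
  have h2 : (rapidityPhase m k w (x + y * Complex.I)).im =
      transEnergy m k * Real.sin y * (Real.sinh x * w 0 - Real.cosh x * w 1) := by
    rw [rapidityPhase, Complex.cosh_add, Complex.sinh_add, Complex.cosh_mul_I, Complex.sinh_mul_I,
      ← Complex.ofReal_cosh, ← Complex.ofReal_sinh, ← Complex.ofReal_cos, ← Complex.ofReal_sin]
    simp [-Complex.ofReal_cosh, -Complex.ofReal_sinh, -Complex.ofReal_cos, -Complex.ofReal_sin]
    ring
  rw [h2]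
  refine mul_nonpos_of_nonneg_of_nonpos (mul_nonneg (transEnergy_pos k).le
    (Real.sin_nonneg_of_nonneg_of_le_pi h0 h1)) ?_
  have h3 : |Real.sinh x| ≤ Real.cosh x := by
    rw [abs_le]
    constructor
    · linarith [Real.sinh_add_cosh x, Real.exp_pos x]
    · exact (Real.sinh_lt_cosh x).le
  have h4 : |w 0| ≤ w 1 := le_of_lt hw
  have h5 : Real.sinh x * w 0 ≤ Real.cosh x * w 1 :=
    (le_abs_self _).trans (by rw [abs_mul]; exact mul_le_mul h3 h4 (abs_nonneg _) (Real.cosh_pos x).le)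
  linarith

/-- The regulator `exp (-δ (ζ - iπ/2)²)`, which decays in the strip `0 ≤ im ζ ≤ π`. -/
noncomputable def stripRegulator (δ : ℝ) (ζ : ℂ) : ℂ :=
  Complex.exp (-δ * (ζ - Real.pi / 2 * Complex.I) ^ 2)

theorem norm_stripRegulator_le {δ : ℝ} (hδ : 0 ≤ δ) (x : ℝ) {y : ℝ} (h0 : 0 ≤ y) (h1 : y ≤ Real.pi) :
    ‖stripRegulator δ (x + y * Complex.I)‖ ≤
      Real.exp (δ * (Real.pi / 2) ^ 2) * Real.exp (-δ * x ^ 2) := by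
  rw [stripRegulator, Complex.norm_exp, ← Real.exp_add]
  refine Real.exp_le_exp.2 ?_
  have h2 : (-δ * (x + y * Complex.I - Real.pi / 2 * Complex.I) ^ 2 : ℂ) =
      ((-δ * (x ^ 2 - (y - Real.pi / 2) ^ 2) : ℝ) : ℂ) +
        ((-δ * 2 * x * (y - Real.pi / 2) : ℝ) : ℂ) * Complex.I := by
    push_cast
    linear_combination (-δ * (y - Real.pi / 2) ^ 2 : ℂ) * Complex.I_sq
  rw [h2, Complex.add_re, Complex.ofReal_re, Complex.re_ofReal_mul, Complex.I_re, mul_zero, add_zero]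
  have h3 : (y - Real.pi / 2) ^ 2 ≤ (Real.pi / 2) ^ 2 := by nlinarith [Real.pi_pos]
  nlinarith

theorem differentiable_stripRegulator (δ : ℝ) : Differentiable ℂ (stripRegulator δ) := by
  unfold stripRegulator
  fun_prop

/-- For `w` in the right wedge `e^{-i q(ζ) · w}` is bounded in the strip `0 ≤ im ζ ≤ π`, so the
contour can be shifted from one boundary to the other. -/
theorem integral_regulated_exp_eq (m : ℝ) [Fact (0 < m)] {δ : ℝ} (hδ : 0 < δ) (k : Fin s → ℝ)
    {w : Vec s} (hw : w ∈ rightWedge s) :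
    ∫ θ : ℝ, Complex.exp (-Complex.I * (mink (rapidityPoint m (θ, k)) w : ℝ)) * stripRegulator δ θ =
      ∫ θ : ℝ, Complex.exp (Complex.I * (mink (rapidityPoint m (θ, -k)) w : ℝ)) *
        stripRegulator δ (θ + Real.pi * Complex.I) := by
  have h := integral_eq_integral_add_mul_I
    (H := fun ζ => Complex.exp (-Complex.I * rapidityPhase m k w ζ) * stripRegulator δ ζ)
    (b := Real.pi)
    (((differentiable_rapidityPhase m k w).const_mul _).cexp.mul (differentiable_stripRegulator δ))
    Real.pi_pos.le (B := fun x => Real.exp (δ * (Real.pi / 2) ^ 2) * Real.exp (-δ * x ^ 2)) ?_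
    ((integrable_exp_neg_mul_sq hδ).const_mul _) fun x y h0 h1 => ?_
  · simpa only [rapidityPhase_ofReal, rapidityPhase_add_pi, neg_mul_neg] using h
  · have h1 := tendsto_rpow_abs_mul_exp_neg_mul_sq_cocompact hδ 0
    simpa using h1.const_mul (Real.exp (δ * (Real.pi / 2) ^ 2))
  · rw [norm_mul, ← one_mul (Real.exp _ * _)]
    refine mul_le_mul ?_ (norm_stripRegulator_le hδ.le x h0 h1) (norm_nonneg _) zero_le_one
    rw [Complex.norm_exp]
    refine Real.exp_le_one_iff.2 ?_
    simpa using im_rapidityPhase_nonpos m k hw x h0 h1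

theorem norm_exp_I_mul (u : ℝ) : ‖Complex.exp (Complex.I * u)‖ = 1 := by
  rw [mul_comm, Complex.norm_exp_ofReal_mul_I]

theorem norm_exp_neg_I_mul (u : ℝ) : ‖Complex.exp (-Complex.I * u)‖ = 1 := by
  rw [neg_mul, ← mul_neg, ← Complex.ofReal_neg, norm_exp_I_mul]

theorem oneMomentum_apply (f : TestFn s 1) (p : Vec s) :
    oneMomentum f p = (((2 * Real.pi) ^ (-((1 * (s + 2) : ℕ) : ℝ) / 2) : ℝ) : ℂ) *
      ∫ x : Fin 1 → Vec s, f x * Complex.exp (Complex.I * (mink p (x 0) : ℝ)) := by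
  rw [oneMomentum, momentum_apply]
  simp

theorem mink_add_right (p x y : Vec s) : mink p (x + y) = mink p x + mink p y := by
  simp only [mink, Pi.add_apply, mul_add, Finset.sum_add_distrib]; ring

theorem continuous_mink : Continuous fun z : Vec s × Vec s => mink z.1 z.2 := by
  unfold mink; fun_prop

/-- `f̃(-q) g̃(q) e^{-i q · z}` as an integral over configuration space. -/
theorem oneMomentum_mul_exp (f g : TestFn s 1) (z q : Vec s) :
    oneMomentum f (-q) * oneMomentum g q * Complex.exp (-Complex.I * (mink q z : ℝ)) =
      ((((2 * Real.pi) ^ (-((1 * (s + 2) : ℕ) : ℝ) / 2) : ℝ) : ℂ)) ^ 2 *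
        ∫ a : (Fin 1 → Vec s) × (Fin 1 → Vec s), f a.1 * g a.2 *
          Complex.exp (-Complex.I * (mink q (a.1 0 - a.2 0 + z) : ℝ)) := by
  rw [oneMomentum_apply, oneMomentum_apply, mul_mul_mul_comm, ← sq, mul_assoc]
  congr 1
  rw [← integral_prod_mul, ← integral_mul_const, ← Measure.volume_eq_prod]
  congr 1
  ext a
  rw [sub_eq_add_neg, mink_add_right, mink_add_right, mink_neg_right, mink_neg_left]
  rw [mul_mul_mul_comm, mul_assoc, ← Complex.exp_add, ← Complex.exp_add]
  push_cast
  ring_nf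

theorem abs_le_of_mem_closure_rightWedge {z : Vec s} (hz : z ∈ closure (rightWedge s)) :
    |z 0| ≤ z 1 := by
  have hc : IsClosed {z : Vec s | |z 0| ≤ z 1} := isClosed_le (by fun_prop) (by fun_prop)
  have hs : rightWedge s ⊆ {z : Vec s | |z 0| ≤ z 1} := fun y (hy : |y 0| < y 1) => hy.le
  exact closure_minimal hs hc hz

theorem add_mem_rightWedge {x z : Vec s} (hx : x ∈ rightWedge s) (hz : |z 0| ≤ z 1) :
    x + z ∈ rightWedge s := by
  have hx' : |x 0| < x 1 := hx
  change |x 0 + z 0| < x 1 + z 1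
  exact (abs_add_le _ _).trans_lt (add_lt_add_of_lt_of_le hx' hz)

/-- For each transversal momentum, the contour shift applied under the integral over the positions,
whose difference lies in the right wedge. -/
theorem integral_regulated_eq (m : ℝ) [Fact (0 < m)] {δ : ℝ} (hδ : 0 < δ) (k : Fin s → ℝ)
    {f g : TestFn s 1} (hf : tsupport f ⊆ {x | x 0 ∈ rightWedge s})
    (hg : tsupport g ⊆ {x | x 0 ∈ leftWedge s}) {z : Vec s} (hz : |z 0| ≤ z 1) :
    ∫ θ : ℝ, oneMomentum f (-rapidityPoint m (θ, k)) * oneMomentum g (rapidityPoint m (θ, k)) *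
        Complex.exp (-Complex.I * (mink (rapidityPoint m (θ, k)) z : ℝ)) * stripRegulator δ θ =
      ∫ θ : ℝ, oneMomentum f (rapidityPoint m (θ, -k)) * oneMomentum g (-rapidityPoint m (θ, -k)) *
        Complex.exp (Complex.I * (mink (rapidityPoint m (θ, -k)) z : ℝ)) *
          stripRegulator δ (θ + Real.pi * Complex.I) := by
  have hfg : Integrable (fun a : (Fin 1 → Vec s) × (Fin 1 → Vec s) => f a.1 * g a.2) :=
    haveI : (volume : Measure (Fin 1 → Vec s)).IsAddHaarMeasure :=
      Measure.pi.isAddHaarMeasure fun _ : Fin 1 => (volume : Measure (Vec s))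
    f.integrable.mul_prod g.integrable
  have hB : Integrable fun x : ℝ => Real.exp (δ * (Real.pi / 2) ^ 2) * Real.exp (-δ * x ^ 2) :=
    (integrable_exp_neg_mul_sq hδ).const_mul _
  have hr0 : Integrable fun θ : ℝ => stripRegulator δ θ :=
    hB.mono' ((differentiable_stripRegulator δ).continuous.comp
      Complex.continuous_ofReal).aestronglyMeasurable (Eventually.of_forall fun θ => by
        simpa using norm_stripRegulator_le hδ.le θ le_rfl Real.pi_pos.le)
  have hr1 : Integrable fun θ : ℝ => stripRegulator δ (θ + Real.pi * Complex.I) :=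
    hB.mono' ((differentiable_stripRegulator δ).continuous.comp
      (by fun_prop)).aestronglyMeasurable (Eventually.of_forall fun θ =>
        norm_stripRegulator_le hδ.le θ Real.pi_pos.le le_rfl)
  -- the regulator makes the integral over positions and rapidity absolutely convergent
  have swap : ∀ {q : ℝ → Vec s} (_ : Continuous q) {r : ℝ → ℂ} (_ : Integrable r) (σ : ℂ)
      (_ : ∀ u : ℝ, ‖Complex.exp (σ * u)‖ = 1),
      ∫ θ, (∫ a : (Fin 1 → Vec s) × (Fin 1 → Vec s), f a.1 * g a.2 *
          Complex.exp (σ * (mink (q θ) (a.1 0 - a.2 0 + z) : ℝ))) * r θ =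
        ∫ a : (Fin 1 → Vec s) × (Fin 1 → Vec s), f a.1 * g a.2 *
          ∫ θ, Complex.exp (σ * (mink (q θ) (a.1 0 - a.2 0 + z) : ℝ)) * r θ := by
    intro q hq r hr σ hσ
    simp only [← integral_mul_const, ← integral_const_mul]
    rw [integral_integral_swap]
    · simp only [mul_assoc]
    · have h1 := (hr.mul_prod hfg).mul_bdd (c := 1) (g := fun b : ℝ × ((Fin 1 → Vec s) × (Fin 1 → Vec s)) =>
        Complex.exp (σ * (mink (q b.1) (b.2.1 0 - b.2.2 0 + z) : ℝ))) ?_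
        (Eventually.of_forall fun b => (hσ _).le)
      · refine h1.congr (Eventually.of_forall fun b => ?_)
        simp only [Function.uncurry]
        ring
      · refine Continuous.aestronglyMeasurable ?_
        have h2 : Continuous fun b : ℝ × ((Fin 1 → Vec s) × (Fin 1 → Vec s)) =>
            mink (q b.1) (b.2.1 0 - b.2.2 0 + z) :=
          continuous_mink.comp (f := fun b : ℝ × ((Fin 1 → Vec s) × (Fin 1 → Vec s)) =>
            (q b.1, b.2.1 0 - b.2.2 0 + z)) (by fun_prop)
        fun_prop
  have hq : ∀ k : Fin s → ℝ, Continuous fun θ : ℝ => rapidityPoint m (θ, k) := fun k =>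
    (continuous_rapidityPoint m).comp (by fun_prop)
  have h2 : ∀ q : Vec s, oneMomentum f q * oneMomentum g (-q) *
      Complex.exp (Complex.I * (mink q z : ℝ)) =
      ((((2 * Real.pi) ^ (-((1 * (s + 2) : ℕ) : ℝ) / 2) : ℝ) : ℂ)) ^ 2 *
        ∫ a : (Fin 1 → Vec s) × (Fin 1 → Vec s), f a.1 * g a.2 *
          Complex.exp (Complex.I * (mink q (a.1 0 - a.2 0 + z) : ℝ)) := fun q => by
    simpa [mink_neg_left] using oneMomentum_mul_exp f g z (-q)
  simp only [oneMomentum_mul_exp, h2, mul_assoc (_ ^ 2)]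
  rw [integral_const_mul, integral_const_mul,
    swap (hq k) hr0 _ norm_exp_neg_I_mul, swap (hq (-k)) hr1 _ norm_exp_I_mul]
  congr 2
  ext a
  by_cases ha : f a.1 * g a.2 = 0
  · rw [ha, zero_mul, zero_mul]
  rw [integral_regulated_exp_eq m hδ k]
  refine add_mem_rightWedge ?_ hz
  have h3 : |a.1 0 0| < a.1 0 1 := hf (subset_tsupport _ (left_ne_zero_of_mul ha))
  have h4 : |-a.2 0 0| < -a.2 0 1 := hg (subset_tsupport _ (right_ne_zero_of_mul ha))
  change |a.1 0 0 - a.2 0 0| < a.1 0 1 - a.2 0 1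
  rw [sub_eq_add_neg, sub_eq_add_neg]
  exact (abs_add_le _ _).trans_lt (add_lt_add h3 h4)

/-- The free field is local: the commutator of fields in spacelike separated wedges, one of them
translated further by `z`, vanishes. -/
theorem integral_massShell_eq_neg (m : ℝ) [Fact (0 < m)]
    {f g : TestFn s 1} (hf : tsupport f ⊆ {x | x 0 ∈ rightWedge s})
    (hg : tsupport g ⊆ {x | x 0 ∈ leftWedge s}) {z : Vec s} (hz : |z 0| ≤ z 1) :
    ∫ q, oneMomentum f (-q) * oneMomentum g q * Complex.exp (-Complex.I * (mink q z : ℝ))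
        ∂massShell s m =
      ∫ q, oneMomentum f q * oneMomentum g (-q) * Complex.exp (Complex.I * (mink q z : ℝ))
        ∂massShell s m := by
  have hemb : AEMeasurable (rapidityPoint (s := s) m) := (continuous_rapidityPoint m).aemeasurable
  have hm : Continuous fun q : Vec s => mink q z :=
    continuous_mink.comp (f := fun q : Vec s => (q, z)) (by fun_prop)
  have hneg : ∀ {F : Vec s → ℂ}, RapidDecay F → RapidDecay fun q => F (-q) := fun hF =>
    hF.comp (a := fun q : Vec s => -q) (by fun_prop) (by simp)
  have hR1 : RapidDecay fun q => oneMomentum f (-q) * oneMomentum g q *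
      Complex.exp (-Complex.I * (mink q z : ℝ)) := by
    have := ((rapidDecay_oneMomentum g).bounded_mul (hneg (rapidDecay_oneMomentum f))).mul_bounded
      (u := fun q => Complex.exp (-Complex.I * (mink q z : ℝ))) (by fun_prop) fun q =>
        (norm_exp_neg_I_mul _).le
    simpa only [mul_comm (Complex.exp _)] using this
  have hR2 : RapidDecay fun q => oneMomentum f q * oneMomentum g (-q) *
      Complex.exp (Complex.I * (mink q z : ℝ)) := by
    have := ((hneg (rapidDecay_oneMomentum g)).bounded_mul (rapidDecay_oneMomentum f)).mul_bounded
      (u := fun q => Complex.exp (Complex.I * (mink q z : ℝ))) (by fun_prop) fun q =>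
        (norm_exp_I_mul _).le
    simpa only [mul_comm (Complex.exp _)] using this
  have hi1 := hR1.integrable (massShell s m)
  have hi2 := hR2.integrable (massShell s m)
  rw [massShell_eq_map_rapidityPoint] at hi1 hi2 ⊢
  rw [integral_map hemb hR1.1.aestronglyMeasurable, integral_map hemb hR2.1.aestronglyMeasurable]
  rw [integrable_map_measure hR1.1.aestronglyMeasurable hemb] at hi1
  rw [integrable_map_measure hR2.1.aestronglyMeasurable hemb] at hi2
  rw [Measure.volume_eq_prod] at hi1 hi2 ⊢
  refine (integral_prod_symm _ hi1).trans (Eq.trans ?_ (integral_prod_symm _ hi2).symm)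
  rw [← integral_neg_eq_self (fun k : Fin s → ℝ => ∫ θ : ℝ, ((fun q => oneMomentum f q *
    oneMomentum g (-q) * Complex.exp (Complex.I * (mink q z : ℝ))) ∘ rapidityPoint m) (θ, k))]
  simp only [Function.comp_def] at hi1 hi2 ⊢
  have hi2' : ∀ᵐ k : Fin s → ℝ, Integrable (fun θ : ℝ => oneMomentum f (rapidityPoint m (θ, -k)) *
      oneMomentum g (-rapidityPoint m (θ, -k)) *
        Complex.exp (Complex.I * (mink (rapidityPoint m (θ, -k)) z : ℝ))) :=
    (Measure.measurePreserving_neg (volume : Measure (Fin s → ℝ))).quasiMeasurePreserving.ae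
      hi2.prod_left_ae
  refine integral_congr_ae ?_
  filter_upwards [hi1.prod_left_ae, hi2'] with k hk1 hk2
  -- the regulator is removed by dominated convergence
  have lim : ∀ {F : ℝ → ℂ} (_ : Integrable F) {y : ℝ} (_ : 0 ≤ y) (_ : y ≤ Real.pi),
      Tendsto (fun δ : ℝ => ∫ θ : ℝ, F θ * stripRegulator δ (θ + y * Complex.I)) (𝓝[>] 0)
        (𝓝 (∫ θ, F θ)) := by
    intro F hF y h0 h1
    refine tendsto_integral_filter_of_dominated_convergence
      (fun θ => ‖F θ‖ * Real.exp ((Real.pi / 2) ^ 2)) ?_ ?_ (hF.norm.mul_const _) ?_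
    · refine Eventually.of_forall fun δ => hF.aestronglyMeasurable.mul
        ((differentiable_stripRegulator δ).continuous.comp (by fun_prop)).aestronglyMeasurable
    · filter_upwards [Ioc_mem_nhdsGT (zero_lt_one (α := ℝ))] with δ hδ
      refine Eventually.of_forall fun θ => ?_
      rw [norm_mul]
      refine mul_le_mul_of_nonneg_left ((norm_stripRegulator_le hδ.1.le θ h0 h1).trans ?_)
        (norm_nonneg _)
      rw [← Real.exp_add]
      refine Real.exp_le_exp.2 ?_
      have := mul_le_mul_of_nonneg_right hδ.2 (sq_nonneg (Real.pi / 2))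
      nlinarith [mul_nonneg hδ.1.le (sq_nonneg θ)]
    · refine Eventually.of_forall fun θ => ?_
      have h2 : Continuous fun δ : ℝ => F θ * stripRegulator δ (θ + y * Complex.I) := by
        unfold stripRegulator; fun_prop
      have h3 := h2.tendsto 0
      simp only [stripRegulator, Complex.ofReal_zero, neg_zero, zero_mul, Complex.exp_zero,
        mul_one] at h3
      exact h3.mono_left nhdsWithin_le_nhds
  have h1 := lim hk1 le_rfl Real.pi_pos.le
  have h2 := lim hk2 Real.pi_pos.le le_rfl
  refine tendsto_nhds_unique h1 (h2.congr' ?_)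
  filter_upwards [self_mem_nhdsWithin] with δ hδ
  rw [← integral_regulated_eq m hδ k hf hg hz]
  simp

/-! ### Approximating the deformation function -/

/-- A tempered distribution vanishes on the compactly supported test functions whose support does
not meet the support of the distribution. -/
theorem apply_eq_zero_of_disjoint_dsupport (T : 𝓢'(ℝ, ℂ)) (φ : 𝓢(ℝ, ℂ)) (hc : HasCompactSupport φ)
    (hd : Disjoint (tsupport φ) (Distribution.dsupport T)) : T φ = 0 := by
  let ι : Type := {U : Set ℝ // Distribution.IsVanishingOn T U ∧ IsOpen U}
  have hcov : tsupport φ ⊆ ⋃ i : ι, i.1 := fun x hx => by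
    obtain ⟨U, h1, h2, h3⟩ := (Distribution.notMem_dsupport_iff x).1 (Set.disjoint_left.1 hd hx)
    exact Set.mem_iUnion.2 ⟨⟨U, h1, h2⟩, h3⟩
  obtain ⟨ρ, hρ⟩ := SmoothPartitionOfUnity.exists_isSubordinate (modelWithCornersSelf ℝ ℝ)
    (isClosed_tsupport φ) (fun i : ι => i.1) (fun i => i.2.2) hcov
  have hfin := ρ.locallyFinite.finite_nonempty_inter_compact hc
  have hsm : ∀ i, ContDiff ℝ ((⊤ : ℕ∞) : WithTop ℕ∞) fun x => (ρ i x : ℂ) * φ x := fun i =>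
    (Complex.ofRealCLM.contDiff.comp (ρ i).contMDiff.contDiff).mul (φ.smooth _)
  have hcs : ∀ i, HasCompactSupport fun x => (ρ i x : ℂ) * φ x := fun i => hc.mul_left
  let P : ι → 𝓢(ℝ, ℂ) := fun i => (hcs i).toSchwartzMap (hsm i)
  have hP : ∀ i x, P i x = (ρ i x : ℂ) * φ x := fun i x => rfl
  have hzero : ∀ i, T (P i) = 0 := fun i => by
    refine i.2.1 (P i) (subset_trans (closure_mono fun x hx => ?_) (hρ i))
    rw [Function.mem_support, hP] at hx
    exact fun h => hx (by rw [h]; simp)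
  have hsum : φ = ∑ i ∈ hfin.toFinset, P i := by
    ext x
    rw [sum_apply]
    simp only [hP, ← Finset.sum_mul]
    by_cases hx : φ x = 0
    · simp [hx]
    have hx' : x ∈ tsupport φ := subset_tsupport _ hx
    have h1 := ρ.sum_eq_one hx'
    rw [finsum_eq_sum_of_support_subset (s := hfin.toFinset) _ (fun i hi => by
      simpa using ⟨x, hi, hx'⟩)] at h1
    rw [← Complex.ofReal_sum, h1]
    simp
  rw [hsum, map_sum]
  exact Finset.sum_eq_zero fun i _ => hzero i

theorem exists_bump_tsupport_subset_Iio : ∃ χ : 𝓢(ℝ, ℂ), HasCompactSupport χ ∧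
    tsupport χ ⊆ Set.Iio 0 ∧ ∫ x, χ x = 1 := by
  let b : ContDiffBump (-2 : ℝ) := ⟨1 / 2, 1, by norm_num, by norm_num⟩
  have h1 : HasCompactSupport fun x => (b.normed volume x : ℂ) :=
    b.hasCompactSupport_normed.comp_left (g := fun x : ℝ => (x : ℂ)) Complex.ofReal_zero
  have h2 : ContDiff ℝ ((⊤ : ℕ∞) : WithTop ℕ∞) fun x => (b.normed volume x : ℂ) :=
    Complex.ofRealCLM.contDiff.comp b.contDiff_normed
  refine ⟨h1.toSchwartzMap h2, h1, ?_, ?_⟩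
  · have h3 : tsupport (fun x => (b.normed volume x : ℂ)) ⊆ tsupport (b.normed volume) :=
      closure_mono fun x hx => by simpa using hx
    refine h3.trans ?_
    rw [b.tsupport_normed_eq]
    intro x hx
    have h4 : dist x (-2) ≤ 1 := hx
    rw [Real.dist_eq, abs_le] at h4
    rw [Set.mem_Iio]
    linarith [h4.2]
  · change ∫ x, (b.normed volume x : ℂ) = 1
    rw [integral_complex_ofReal, b.integral_normed, Complex.ofReal_one]

/-- The bump functions `y ↦ t χ(t (y - ξ))` and their Fourier transforms. -/
theorem exists_rescaled_bump {χ : 𝓢(ℝ, ℂ)} (hc : HasCompactSupport χ) (hs : tsupport χ ⊆ Set.Iio 0)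
    {t : ℝ} (ht : 0 < t) (ξ : ℝ) : ∃ ψ : 𝓢(ℝ, ℂ), HasCompactSupport ψ ∧ tsupport ψ ⊆ Set.Iio ξ ∧
      ∀ a, 𝓕 ψ a = Complex.exp (-2 * Real.pi * Complex.I * a * ξ) * 𝓕 χ (a / t) := by
  let e : ℝ ≃ₜ ℝ := (Homeomorph.subRight ξ).trans (Homeomorph.mulLeft₀ t ht.ne')
  have h1 : HasCompactSupport fun y => (t : ℂ) * χ (t * (y - ξ)) :=
    (hc.comp_homeomorph e).mul_left
  have h2 : ContDiff ℝ ((⊤ : ℕ∞) : WithTop ℕ∞) fun y => (t : ℂ) * χ (t * (y - ξ)) :=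
    contDiff_const.mul ((χ.smooth _).comp (by fun_prop))
  refine ⟨h1.toSchwartzMap h2, h1, ?_, fun a => ?_⟩
  · have h3 : tsupport (fun y => (t : ℂ) * χ (t * (y - ξ))) ⊆ {y | t * (y - ξ) ∈ tsupport χ} := by
      refine closure_minimal (fun y hy => subset_tsupport _ (right_ne_zero_of_mul hy)) ?_
      exact (isClosed_tsupport χ).preimage (by fun_prop)
    intro y hy
    have h4 : t * (y - ξ) < 0 := hs (h3 hy)
    rw [Set.mem_Iio]
    by_contra! h5
    exact h4.not_ge (mul_nonneg ht.le (sub_nonneg.2 h5))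
  · rw [fourier_coe, fourier_coe, Real.fourier_real_eq_integral_exp_smul,
      Real.fourier_real_eq_integral_exp_smul]
    change ∫ y, Complex.exp _ • ((t : ℂ) * χ (t * (y - ξ))) = _
    rw [← integral_add_right_eq_self _ ξ]
    have h3 := Measure.integral_comp_mul_left
      (fun u : ℝ => Complex.exp ((-2 * Real.pi * u * (a / t) : ℝ) * Complex.I) • χ u) t
    rw [abs_of_pos (inv_pos.2 ht)] at h3
    have h4 : ∀ y : ℝ, Complex.exp ((-2 * Real.pi * (y + ξ) * a : ℝ) * Complex.I) •
        ((t : ℂ) * χ (t * (y + ξ - ξ))) = Complex.exp (-2 * Real.pi * Complex.I * a * ξ) * t *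
        (Complex.exp ((-2 * Real.pi * (t * y) * (a / t) : ℝ) * Complex.I) • χ (t * y)) := fun y => by
      rw [add_sub_cancel_right, smul_eq_mul, smul_eq_mul]
      have h5 : Complex.exp ((-2 * Real.pi * (y + ξ) * a : ℝ) * Complex.I) =
          Complex.exp (-2 * Real.pi * Complex.I * a * ξ) *
            Complex.exp ((-2 * Real.pi * (t * y) * (a / t) : ℝ) * Complex.I) := by
        rw [← Complex.exp_add, show (-2 * Real.pi * (t * y) * (a / t) : ℝ) = -2 * Real.pi * y * a by
          field_simp]
        push_cast
        ring_nf
      rw [h5]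
      ring
    simp only [h4]
    rw [integral_const_mul, h3]
    have ht' : (t : ℂ) ≠ 0 := by exact_mod_cast ht.ne'
    rw [Complex.real_smul, Complex.ofReal_inv, mul_assoc, mul_inv_cancel_left₀ ht']

theorem IsDeformationFunction.norm_eq_one {R : ℝ → ℂ} (hR : IsDeformationFunction R) (a : ℝ) :
    ‖R a‖ = 1 := by
  have h3 := hR.conj_mul_self a
  rw [Complex.conj_mul'] at h3
  exact (pow_eq_one_iff_of_nonneg (norm_nonneg _) two_ne_zero).1 (by exact_mod_cast h3)

/-- Since the Fourier transform of `R` is supported in the half line `ξ ≥ 0`, `R` is a pointwise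
limit of uniformly bounded superpositions of the exponentials `e^{2πiξa}`, `ξ ≥ 0`. -/
theorem IsDeformationFunction.exists_approx {R : ℝ → ℂ} (hR : IsDeformationFunction R) :
    ∃ (r : ℕ → ℝ → ℂ) (C : ℝ), (∀ n, Integrable (r n)) ∧ (∀ n ξ, ξ < 0 → r n ξ = 0) ∧
      (∀ n (a : ℝ), ‖∫ ξ : ℝ, r n ξ * Complex.exp (2 * Real.pi * Complex.I * a * ξ)‖ ≤ C) ∧
      ∀ a : ℝ, Tendsto (fun n => ∫ ξ : ℝ, r n ξ * Complex.exp (2 * Real.pi * Complex.I * a * ξ)) atTop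
        (𝓝 (R a)) := by
  obtain ⟨χ, hc, hs, h1⟩ := exists_bump_tsupport_subset_Iio
  have ht : ∀ n : ℕ, (0 : ℝ) < n + 1 := fun n => by positivity
  choose ψ hψc hψs hψ using fun n : ℕ => exists_rescaled_bump hc hs (ht n)
  have hT := hR.hasTemperateGrowth
  -- `r n` is the Fourier transform of `R` smeared with a bump of size `1 / (n + 1)`, which keeps the
  -- support in the half line and multiplies `R` by the cutoff `𝓕 χ (a / (n + 1)) → 1`
  let ρ : ℕ → 𝓢(ℝ, ℂ) := fun n => smulLeftCLM ℂ R (𝓕 (ψ n 0))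
  have hρ : ∀ n a, ρ n a = R a * 𝓕 χ (a / (n + 1)) := fun n a => by
    simp only [ρ]
    rw [smulLeftCLM_apply_apply hT, hψ, smul_eq_mul]
    simp
  let r : ℕ → 𝓢(ℝ, ℂ) := fun n => 𝓕 (ρ n)
  have hinv : ∀ n (a : ℝ), ∫ ξ : ℝ, r n ξ * Complex.exp (2 * Real.pi * Complex.I * a * ξ) =
      R a * 𝓕 χ (a / (n + 1)) := fun n a => by
    rw [← hρ]
    have h2 : ρ n = 𝓕⁻ (r n) := (FourierTransform.fourierInv_fourier_eq (ρ n)).symm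
    rw [h2, fourierInv_coe, Real.fourierInv_eq']
    refine integral_congr_ae (Eventually.of_forall fun ξ => ?_)
    simp only [smul_eq_mul]
    rw [mul_comm]
    congr 2
    simp
    ring
  refine ⟨fun n => r n, SchwartzMap.seminorm ℝ 0 0 (𝓕 χ), fun n => (r n).integrable,
    fun n ξ hξ => ?_, fun n a => ?_, fun a => ?_⟩
  · have h2 : r n ξ = (𝓕 hT.toTemperedDistribution : 𝓢'(ℝ, ℂ)) (ψ n ξ) := by
      rw [TemperedDistribution.fourier_apply]
      change _ = ∫ a, 𝓕 (ψ n ξ) a • R a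
      rw [fourier_coe, Real.fourier_real_eq_integral_exp_smul]
      refine integral_congr_ae (Eventually.of_forall fun a => ?_)
      simp only [hρ, hψ, smul_eq_mul]
      rw [mul_comm (R a), ← mul_assoc]
      congr 3
      push_cast
      ring
    refine h2.trans ?_
    refine apply_eq_zero_of_disjoint_dsupport _ _ (hψc n ξ) (Set.disjoint_left.2 fun x hx hx' => ?_)
    have h3 : x < ξ := hψs n ξ hx
    have h4 : 0 ≤ x := hR.fourier_support hx'
    linarith
  · rw [hinv, norm_mul]
    rw [hR.norm_eq_one, one_mul]
    exact SchwartzMap.norm_le_seminorm ℝ _ _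
  · simp only [hinv]
    have h2 : 𝓕 χ 0 = 1 := by
      rw [fourier_coe, Real.fourier_real_eq_integral_exp_smul]
      simpa using h1
    have h3 : Tendsto (fun n : ℕ => 𝓕 χ (a / (n + 1))) atTop (𝓝 (𝓕 χ 0)) :=
      ((𝓕 χ).continuous.tendsto 0).comp (by
        simpa [div_eq_mul_inv] using (tendsto_one_div_add_atTop_nhds_zero_nat (𝕜 := ℝ)).const_mul a)
    simpa [h2] using h3.const_mul (R a)

/-! ### Wedge locality of the deformed contraction -/

/-- The functions `u` which, inserted into both terms of a vanishing commutator, preserve the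
vanishing for all translations of the fields away from each other. -/
structure IsWedgeLocal (μ : Measure (Vec s)) (F G u : Vec s → ℂ) : Prop where
  continuous : Continuous u
  bounded : ∃ C, ∀ q, ‖u q‖ ≤ C
  integral_eq : ∀ z : Vec s, |z 0| ≤ z 1 →
    ∫ q, F q * u (-q) * Complex.exp (-Complex.I * (mink q z : ℝ)) ∂μ =
      ∫ q, G q * u q * Complex.exp (Complex.I * (mink q z : ℝ)) ∂μ

theorem mink_smul_right (t : ℝ) (p x : Vec s) : mink p (t • x) = t * mink p x := by
  simp only [mink, Pi.smul_apply, smul_eq_mul, mul_sub, Finset.mul_sum]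
  congr 1
  · ring
  · exact Finset.sum_congr rfl fun j _ => by ring

/-- Fubini's theorem, exhibiting a superposition of exponentials of `mink q y` as a superposition of
translations along `y`. -/
theorem integral_mul_integral_exp {μ : Measure (Vec s)} [SFinite μ] {A : Vec s → ℂ}
    (hA : Integrable A μ) {r : ℝ → ℂ} (hr : Integrable r) (y : Vec s) {σ : ℂ}
    (hσ : ∀ u : ℝ, ‖Complex.exp (σ * u)‖ = 1) :
    ∫ q, A q * (∫ ξ : ℝ, r ξ * Complex.exp (σ * (mink q ((2 * Real.pi * ξ) • y) : ℝ))) ∂μ =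
      ∫ ξ : ℝ, r ξ * ∫ q, A q * Complex.exp (σ * (mink q ((2 * Real.pi * ξ) • y) : ℝ)) ∂μ := by
  simp only [← integral_const_mul]
  rw [integral_integral_swap]
  · refine integral_congr_ae (Eventually.of_forall fun ξ => integral_congr_ae
      (Eventually.of_forall fun q => ?_))
    ring
  · have h1 := (hA.mul_prod hr).mul_bdd (c := 1) (g := fun b : Vec s × ℝ =>
      Complex.exp (σ * (mink b.1 ((2 * Real.pi * b.2) • y) : ℝ))) ?_
      (Eventually.of_forall fun b => (hσ _).le)
    · refine h1.congr (Eventually.of_forall fun b => ?_)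
      simp only [Function.uncurry]
      ring
    · refine Continuous.aestronglyMeasurable ?_
      have h2 : Continuous fun b : Vec s × ℝ => mink b.1 ((2 * Real.pi * b.2) • y) :=
        continuous_mink.comp (f := fun b : Vec s × ℝ => (b.1, (2 * Real.pi * b.2) • y))
          (by fun_prop)
      fun_prop

/-- As `R` is a superposition of the exponentials `e^{2πiξa}` with `ξ ≥ 0`, multiplication by `R(q
· y)` amounts to a superposition of translations into the wedge if `y` lies in the closed wedge. -/
theorem IsWedgeLocal.mul_map {μ : Measure (Vec s)} [SFinite μ] {F G u : Vec s → ℂ}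
    (hF : Integrable F μ) (hG : Integrable G μ) (hu : IsWedgeLocal μ F G u) {R : ℝ → ℂ}
    (hR : IsDeformationFunction R) {y : Vec s} (hy : |y 0| ≤ y 1) :
    IsWedgeLocal μ F G fun q => u q * R (mink q y) := by
  obtain ⟨r, C, hr, hr0, hC, hlim⟩ := hR.exists_approx
  obtain ⟨D, hD⟩ := hu.bounded
  have hm : ∀ z : Vec s, Continuous fun q : Vec s => mink q z := fun z =>
    continuous_mink.comp (f := fun q : Vec s => (q, z)) (by fun_prop)
  refine ⟨hu.continuous.mul (hR.hasTemperateGrowth.1.continuous.comp (hm y)), ⟨D, fun q => ?_⟩,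
    fun z hz => ?_⟩
  · rw [norm_mul, hR.norm_eq_one, mul_one]
    exact hD q
  have hu' := hu.continuous
  have hA : Integrable (fun q => F q * u (-q) * Complex.exp (-Complex.I * (mink q z : ℝ))) μ := by
    have h := hm z
    refine (hF.mul_bdd (c := D) (Continuous.aestronglyMeasurable (by fun_prop))
      (Eventually.of_forall fun q => hD (-q))).mul_bdd (c := 1)
      (Continuous.aestronglyMeasurable (by fun_prop))
      (Eventually.of_forall fun q => (norm_exp_neg_I_mul _).le)
  have hB : Integrable (fun q => G q * u q * Complex.exp (Complex.I * (mink q z : ℝ))) μ := by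
    have h := hm z
    refine (hG.mul_bdd (c := D) (Continuous.aestronglyMeasurable (by fun_prop))
      (Eventually.of_forall fun q => hD q)).mul_bdd (c := 1)
      (Continuous.aestronglyMeasurable (by fun_prop))
      (Eventually.of_forall fun q => (norm_exp_I_mul _).le)
  have lim : ∀ {A : Vec s → ℂ} (_ : Integrable A μ) {a : Vec s → ℝ} (_ : Continuous a),
      Tendsto (fun n => ∫ q, A q * (∫ ξ : ℝ, r n ξ *
        Complex.exp (2 * Real.pi * Complex.I * a q * ξ)) ∂μ) atTop (𝓝 (∫ q, A q * R (a q) ∂μ)) := by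
    intro A hA a ha
    refine tendsto_integral_of_dominated_convergence (fun q => ‖A q‖ * C) (fun n => ?_)
      (hA.norm.mul_const _) (fun n => Eventually.of_forall fun q => ?_)
      (Eventually.of_forall fun q => (hlim (a q)).const_mul _)
    · have h1 : Continuous fun t : ℝ =>
          ∫ ξ : ℝ, r n ξ * Complex.exp (2 * Real.pi * Complex.I * t * ξ) := by
        have hn : ∀ t ξ : ℝ, ‖Complex.exp (2 * Real.pi * Complex.I * t * ξ)‖ = 1 := fun t ξ => by
          rw [← norm_exp_I_mul (2 * Real.pi * t * ξ)]
          push_cast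
          ring_nf
        refine continuous_of_dominated (bound := fun ξ => ‖r n ξ‖) (fun t => ?_)
          (fun t => Eventually.of_forall fun ξ => ?_) (hr n).norm
          (Eventually.of_forall fun ξ => by fun_prop)
        · exact (hr n).aestronglyMeasurable.mul (Continuous.aestronglyMeasurable (by fun_prop))
        · rw [norm_mul, hn, mul_one]
      exact hA.aestronglyMeasurable.mul (h1.comp ha).aestronglyMeasurable
    · rw [norm_mul]
      exact mul_le_mul_of_nonneg_left (hC n _) (norm_nonneg _)
  have h1 := lim hA (a := fun q => mink (-q) y) ((hm y).comp continuous_neg)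
  have h2 := lim hB (hm y)
  have h3 : ∀ n, ∫ q, F q * u (-q) * Complex.exp (-Complex.I * (mink q z : ℝ)) *
      (∫ ξ : ℝ, r n ξ * Complex.exp (2 * Real.pi * Complex.I * (mink (-q) y : ℝ) * ξ)) ∂μ =
      ∫ q, G q * u q * Complex.exp (Complex.I * (mink q z : ℝ)) *
      (∫ ξ : ℝ, r n ξ * Complex.exp (2 * Real.pi * Complex.I * (mink q y : ℝ) * ξ)) ∂μ := by
    intro n
    have e1 : ∀ (q : Vec s) (ξ : ℝ), (2 * Real.pi * Complex.I * (mink (-q) y : ℝ) * ξ : ℂ) =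
        -Complex.I * (mink q ((2 * Real.pi * ξ) • y) : ℝ) := fun q ξ => by
      rw [mink_smul_right, mink_neg_left]; push_cast; ring
    have e2 : ∀ (q : Vec s) (ξ : ℝ), (2 * Real.pi * Complex.I * (mink q y : ℝ) * ξ : ℂ) =
        Complex.I * (mink q ((2 * Real.pi * ξ) • y) : ℝ) := fun q ξ => by
      rw [mink_smul_right]; push_cast; ring
    simp only [e1, e2]
    rw [integral_mul_integral_exp hA (hr n) y norm_exp_neg_I_mul,
      integral_mul_integral_exp hB (hr n) y norm_exp_I_mul]
    refine integral_congr_ae (Eventually.of_forall fun ξ => ?_)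
    simp only
    rcases lt_or_ge ξ 0 with hξ | hξ
    · rw [hr0 n ξ hξ, zero_mul, zero_mul]
    congr 1
    have h4 := hu.integral_eq (z + (2 * Real.pi * ξ) • y) (by
      have h5 : 0 ≤ 2 * Real.pi * ξ := by positivity
      simp only [Pi.add_apply, Pi.smul_apply, smul_eq_mul]
      refine (abs_add_le _ _).trans (add_le_add hz ?_)
      rw [abs_mul, abs_of_nonneg h5]
      exact mul_le_mul_of_nonneg_left hy h5)
    simpa only [mink_add_right, Complex.ofReal_add, mul_add, Complex.exp_add, mul_assoc] using h4
  have h4 := tendsto_nhds_unique (h1.congr h3) h2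
  convert h4 using 3 <;> ring

/-- The two contractions of the deformed fields of opposite wedges agree. -/
theorem integral_contraction_eq (m : ℝ) [Fact (0 < m)] {R : ℝ → ℂ} (hR : IsDeformationFunction R)
    {f g : TestFn s 1} (hf : tsupport f ⊆ {x | x 0 ∈ rightWedge s})
    (hg : tsupport g ⊆ {x | x 0 ∈ leftWedge s}) {k : ℕ} {y : Fin k → Vec s}
    (hy : ∀ j, |y j 0| ≤ y j 1) :
    ∫ q, oneMomentum f (-q) * oneMomentum g q *
        ∏ j, (R (mink (-q) (y j)) * R (mink (-q) (y j))) ∂massShell s m =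
      ∫ q, oneMomentum g (-q) * oneMomentum f q *
        ∏ j, (R (mink q (y j)) * R (mink q (y j))) ∂massShell s m := by
  have hneg : ∀ {F : Vec s → ℂ}, RapidDecay F → RapidDecay fun q => F (-q) := fun hF =>
    hF.comp (a := fun q : Vec s => -q) (by fun_prop) (by simp)
  have hF := ((rapidDecay_oneMomentum g).bounded_mul
    (hneg (rapidDecay_oneMomentum f))).integrable (massShell s m)
  have hG := ((hneg (rapidDecay_oneMomentum g)).bounded_mul
    (rapidDecay_oneMomentum f)).integrable (massShell s m)
  have key : ∀ t : Finset (Fin k), IsWedgeLocal (massShell s m)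
      (fun q => oneMomentum f (-q) * oneMomentum g q) (fun q => oneMomentum f q * oneMomentum g (-q))
      (fun q => ∏ j ∈ t, (R (mink q (y j)) * R (mink q (y j)))) := by
    intro t
    induction t using Finset.induction_on with
    | empty =>
      refine ⟨by simpa using continuous_const, ⟨1, fun q => by simp⟩, fun z hz => ?_⟩
      simpa using integral_massShell_eq_neg m hf hg hz
    | insert j t hj ih =>
      have h := (ih.mul_map hF hG hR (hy j)).mul_map hF hG hR (hy j)
      convert h using 2 with q
      rw [Finset.prod_insert hj]
      ring
  have h := (key Finset.univ).integral_eq 0 (by simp)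
  have h0 : ∀ q : Vec s, mink q 0 = 0 := fun q => by simp [mink]
  simpa only [h0, Complex.ofReal_zero, mul_zero, Complex.exp_zero, mul_one,
    mul_comm (oneMomentum f _)] using h

/-! ### Commutation of the deformed fields of opposite wedges -/

theorem onShell_mem_closedForwardCone (m : ℝ) (k : Fin (s + 1) → ℝ) :
    onShell m k ∈ closedForwardCone s := by
  have h : energy m k * energy m k = ∑ j, k j ^ 2 + m ^ 2 := Real.mul_self_sqrt (by positivity)
  refine ⟨?_, Real.sqrt_nonneg _⟩
  simp only [mink, onShell, Fin.cons_zero, Fin.cons_succ, h, ← sq]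
  nlinarith

theorem ae_massShell_mem_closedForwardCone (m : ℝ) :
    ∀ᵐ q ∂massShell s m, q ∈ closedForwardCone s := by
  have hc : IsClosed (closedForwardCone s) :=
    (isClosed_le continuous_const (continuous_mink.comp (f := fun q : Vec s => (q, q))
      (by fun_prop))).inter (isClosed_le continuous_const (continuous_apply 0))
  rw [massShell]
  exact (ae_map_iff (p := fun q => q ∈ closedForwardCone s) (continuous_onShell m).aemeasurable
    hc.measurableSet).2 (Eventually.of_forall (onShell_mem_closedForwardCone m))

/-- The deformed fields of opposite wedges commute on the domain `𝒟`. On the mass shell `Q x` lies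
in the closed wedge, so the contractions agree for almost all momenta. -/
theorem fockVec_deformedMul_comm (m : ℝ) [Fact (0 < m)] {R : ℝ → ℂ} (hR : IsDeformationFunction R)
    {Q : Matrix (Fin (s + 2)) (Fin (s + 2)) ℝ}
    (hQ : ∀ x y : Vec s, mink x (Q.mulVec y) = -mink (Q.mulVec x) y)
    (hQ' : Set.MapsTo Q.mulVec (closedForwardCone s) (closure (rightWedge s)))
    {f g : TestFn s 1} (hf : tsupport f ⊆ {x | x 0 ∈ rightWedge s})
    (hg : tsupport g ⊆ {x | x 0 ∈ leftWedge s}) (h : BUAlg s) :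
    fockVec s m (deformedMul R Q (oneParticle f) (deformedMul R (-Q) (oneParticle g) h)) =
      fockVec s m (deformedMul R (-Q) (oneParticle g) (deformedMul R Q (oneParticle f) h)) := by
  have hnQ : ∀ x y : Vec s, mink x ((-Q).mulVec y) = -mink ((-Q).mulVec x) y := fun x y => by
    rw [Matrix.neg_mulVec, Matrix.neg_mulVec, mink_neg_right, mink_neg_left, hQ]
  obtain ⟨N, hN⟩ := exists_isFockState m h
  ext1
  ext1 k
  refine Subtype.ext (Lp.ext ((fockVec_ae m _ k).trans (EventuallyEq.trans ?_ (fockVec_ae m _ k).symm)))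
  rw [fockRep_deformedMul m hR hQ, fockRep_deformedMul m hR hnQ, fockRep_deformedMul m hR hnQ,
    fockRep_deformedMul m hR hQ]
  have hcone : ∀ᵐ x ∂shellPi s m k, ∀ j, x j ∈ closedForwardCone s := ae_all_iff.2 fun j =>
    (Measure.quasiMeasurePreserving_eval (fun _ : Fin k => massShell s m) j).ae
      (ae_massShell_mem_closedForwardCone m)
  filter_upwards [hcone] with x hx
  refine fieldFn_comm m (isExchange_exchange hR hQ) (isExchange_exchange hR hnQ)
    (fun p x => exchange_neg R hQ p x) (rapidDecay_oneMomentum f) (rapidDecay_oneMomentum g) hN k ?_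
  have h1 := integral_contraction_eq m hR hf hg (y := fun j => Q.mulVec (x j)) fun j =>
    abs_le_of_mem_closure_rightWedge (hQ' (hx j))
  simpa only [exchange, Matrix.neg_mulVec, mink_neg_right, mink_neg_left, neg_neg] using h1

end DeformedQFT

open DeformedQFT

theorem mainTheorem9 (s : ℕ) (hs : Even s) (m : ℝ) [Fact (0 < m)] (R : ℝ → ℂ)
    (hR : IsDeformationFunction R) (Q : Matrix (Fin (s + 2)) (Fin (s + 2)) ℝ)
    (hQ : IsAdmissible Q) :
    (∀ f : TestFn s 1, (∀ x, starRingEnd ℂ (f x) = f x) →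
      (∀ g : BUAlg s, (fockVec s m g, fockVec s m (deformedMul R Q (oneParticle f) g)) ∈
        (field m R Q (oneParticle f)).graph) ∧
      (∀ ψ ∈ (field m R Q (oneParticle f)).domain,
        IsEntireAnalyticVector (field m R Q (oneParticle f)) ψ) ∧
      IsEssentiallySelfAdjoint (field m R Q (oneParticle f))) ∧
    (∀ f g : TestFn s 1, (∀ x, starRingEnd ℂ (f x) = f x) → (∀ x, starRingEnd ℂ (g x) = g x) →
      tsupport f ⊆ {x | x 0 ∈ rightWedge s} → tsupport g ⊆ {x | x 0 ∈ leftWedge s} →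
      (∃ U, IsUnitaryGroupOf (field m R Q (oneParticle f)).closure U) ∧
      (∃ V, IsUnitaryGroupOf (field m R (-Q) (oneParticle g)).closure V) ∧
      ∀ U V, IsUnitaryGroupOf (field m R Q (oneParticle f)).closure U →
        IsUnitaryGroupOf (field m R (-Q) (oneParticle g)).closure V →
        ∀ t t' : ℝ, U t * V t' = V t' * U t) := by
  have hA := hQ.antisymm
  have hA' : ∀ x y : Vec s, mink x ((-Q).mulVec y) = -mink ((-Q).mulVec x) y := fun x y => by
    rw [Matrix.neg_mulVec, Matrix.neg_mulVec, mink_neg_right, mink_neg_left, hA]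
  simp only [field_eq_inducedOp]
  refine ⟨fun f hf => ?_, fun f g hf hg hsf hsg => ?_⟩
  · have h := isEntireSymmetric_deformedMul m hR hA hf
    exact ⟨fun g => h.mem_graph_inducedOp.2 ⟨g, rfl⟩, fun ψ hψ => h.isEntireAnalyticVector hψ,
      h.isEssentiallySelfAdjoint⟩
  · have h := isEntireSymmetric_deformedMul m hR hA hf
    have h' := isEntireSymmetric_deformedMul m hR hA' hg
    refine ⟨⟨_, h.isUnitaryGroupOf⟩, ⟨_, h'.isUnitaryGroupOf⟩, fun U V hU hV t t' => ?_⟩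
    refine h.commute h' (fockVec_deformedMul_comm m hR hA hQ.maps_cone hsf hsg) ?_ hU hV t t'
    exact summable_of_isNumberBounded (le_max_of_le_left (by positivity))
      ((isNumberBounded_deformedMul m hR hA hf).mono (le_max_left _ _))
      ((isNumberBounded_deformedMul m hR hA' hg).mono (le_max_right _ _))
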